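/- **Proposition (microlocal Wronskian).** Points of $T^*\mathbb R$ are written $(x,\xi)$. Let $m>0$ be an order function on $T^*\mathbb R$ (i.e. $m(z)\le C(1+|z-w|)^{N}m(w)$), and let $p(x,\xi;h)$, $0<h\le h_0$, be a real classical symbol in $S^0(m)$: $p\sim\sum_j h^jp_j$, where $p_j\in S^0(m)$ does not depend on $h$ and $p-\sum_{j<N}h^jp_j\in S^N(m)=\{q:\ q(\cdot;h)\in C^\infty,\ |\partial^\alpha q|\le C_\alpha h^Nm\}$ for all $N$. Let $P=\mathrm{Op}(p)$ be its Weyl quantization, $$Pu(x)=(2\pi h)^{-1}\iint e^{\frac ih(x-y)\eta}\,p\big(\tfrac{x+y}2,\eta;h\big)\,u(y)\,dy\,d\eta ,$$ extended to $L^2(\mathbb R)$ in the sense of distributions. Let $\Lambda_E\subset\{p_0=E\}$ be a nonconstant periodic orbit $\gamma$ of the Hamiltonian vector field $(\partial_\xi p_0,-\partial_xp_0)$, with minimal period $T$, let $a=\gamma(0)\in\Lambda_E$ (focal point or not), and let $\Omega$ be an open neighbourhood of $a$. *Microlocal solutions.* $\mathcal K_h(E)$ denotes the set of families $u=(u_h)$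 in $L^2(\mathbb R)$ with $\|u_h\|=\mathcal O(h^{-N_0})$ for some $N_0$, such that $\|\mathrm{Op}(\theta)u_h\|_{L^2}=\mathcal O(h^\infty)$ for all $\theta\in C_0^\infty(\Omega\setminus\Lambda_E)$ (in $\Omega$, $u$ is microlocalized on $\Lambda_E$), and $\|\mathrm{Op}(\theta)(P-E)u_h\|_{L^2}=\mathcal O(h^\infty)$ for all $\theta\in C_0^\infty(\Omega)$ (that is, $(P-E)u=\mathcal O(h^\infty)$ microlocally in $\Omega$). *Cut-offs and Wronskians.* Let $\chi^a\in C_0^\infty(\Omega;\mathbb R)$ be equal to $1$ near $a$. In operator expressions $\chi^a$ stands for $\mathrm{Op}(\chi^a)$. Whenever some $\gamma(s)$, $0<s<T$, lies outside $\operatorname{supp}\chi^a$, cut the orbit there; the two oriented segments at $a$ are $\Lambda_+=\gamma((0,s))$ and $\Lambda_-=\gamma((s-T,0))$. For $\rho=\pm$ put $[P,\chi^a]_\rho=\mathrm{Op}(\psi_\rho)[P,\chi^a]$, where $\psi_\rho\in C_0^\infty(\mathbb R^2;\mathbb R)$ equals $1$ near $\operatorname{supp}d\chi^a\cap\Lambda_\rho$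 and $0$ near $\operatorname{supp}d\chi^a\cap\Lambda_{-\rho}$, and $$\mathcal W^a_\rho(u,\overline v)=\big(\tfrac ih[P,\chi^a]_\rho u\,\big|\,v\big)_{L^2}.$$ Let $\widehat u(\xi)=(2\pi h)^{-1/2}\int e^{-ix\xi/h}u(x)\,dx$ be the unitary $h$-Fourier transform; in the $h$-Fourier representation an operator $c(x,hD_x)$ acts as the Weyl quantization $c(-hD_\xi,\xi)$. Then for all $u^a,v^a\in\mathcal K_h(E)$: 1. for every $\chi^a$, modulo $\mathcal O(h^\infty)$ as $h\to0^+$, $$\big(\tfrac ih[P,\chi^a]u^a\,\big|\,v^a\big)=\big(\tfrac ih[P,\chi^a]\widehat u^a\,\big|\,\widehat v^a\big)=0,$$ where in the middle term $P$ and $\chi^a$ act in the $h$-Fourier representation; 2. for every $\chi^a$, and every $s$, $\psi_+$, $\psi_-$ as above, $\mathcal W^a_+(u^a,\overline{v^a})=-\mathcal W^a_-(u^a,\overline{v^a})$ modulo $\mathcal O(h^\infty)$; 3. for $\rho=\pm$, modulo $\mathcal O(h^\infty)$, $\mathcal W^a_\rho(u^a,\overline{v^a})$ does not depend on the choice of $\chi^a$,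 nor on the auxiliary choices of $s$ and $\psi_\rho$. -/

import Mathlib

open Real Set Filter Topology MeasureTheory Asymptotics
open scoped ContDiff FourierTransform ComplexConjugate

noncomputable section

/-! ### Symbols on phase space `T*ℝ = ℝ × ℝ`, points `z = (x, ξ)` -/

/-- Order functions: positive, with `m z ≤ C (1 + ‖z - w‖)^N m w`. -/
def IsOrderFunction (m : ℝ × ℝ → ℝ) : Prop :=
  (∀ z, 0 < m z) ∧ ∃ (C : ℝ) (N : ℕ), ∀ z w, m z ≤ C * (1 + ‖z - w‖) ^ N * m w

/-- The symbol class `S^N(m)`, for the semiclassical parameter `h ∈ (0, h₀]`. -/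
def IsSymbol (h₀ : ℝ) (N : ℕ) (m : ℝ × ℝ → ℝ) (p : ℝ → ℝ × ℝ → ℝ) : Prop :=
  (∀ h ∈ Ioc 0 h₀, ContDiff ℝ ∞ (p h)) ∧
  ∀ k : ℕ, ∃ C : ℝ, ∀ h ∈ Ioc 0 h₀, ∀ z, ‖iteratedFDeriv ℝ k (p h) z‖ ≤ C * h ^ N * m z

/-- `p` is a classical symbol in `S^0(m)`: `p(z; h) ∼ ∑ h^j p_j(z)`, with `h`-independent `p_j`.
The function `p_0` is the principal symbol. -/
structure IsClassicalSymbol (h₀ : ℝ) (m : ℝ × ℝ → ℝ) (p : ℝ → ℝ × ℝ → ℝ)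
    (pj : ℕ → ℝ × ℝ → ℝ) : Prop where
  coeff : ∀ j, IsSymbol h₀ 0 m (fun _ => pj j)
  expansion : ∀ N : ℕ, IsSymbol h₀ N m (fun h z => p h z - ∑ j ∈ Finset.range N, h ^ j * pj j z)

/-! ### Weyl quantization -/

/-- Weyl quantization of the real symbol `p`,
`(2πh)⁻¹ ∬ e^{i(x-y)η/h} p((x+y)/2, η) f(y) dy dη`.  It is used for symbols in a class `S^0(m)` and
Schwartz functions `f`, and for compactly supported symbols and `L²` functions `f`;  in both
cases the iterated integral converges and the result is a Schwartz function. -/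
def weyl (h : ℝ) (p : ℝ × ℝ → ℝ) (f : ℝ → ℂ) (x : ℝ) : ℂ :=
  ((2 * π * h)⁻¹ : ℝ) *
    ∫ η : ℝ, ∫ y : ℝ, Complex.exp (Complex.I * ((x - y) * η / h : ℝ)) * p ((x + y) / 2, η) * f y

/-- Integral kernel of the Weyl quantization of a compactly supported symbol `θ`. It is a Schwartz
function on `ℝ²`, with `weylKernel h θ x y = conj (weylKernel h θ y x)`. -/
def weylKernel (h : ℝ) (θ : ℝ × ℝ → ℝ) (x y : ℝ) : ℂ :=
  ((2 * π * h)⁻¹ : ℝ) *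
    ∫ η : ℝ, Complex.exp (Complex.I * ((x - y) * η / h : ℝ)) * θ ((x + y) / 2, η)

/-- The tempered distribution `P u`, where `P` is the Weyl quantization of the real symbol `p` and
`u` is in `L²`, paired (antilinearly) with the Schwartz function `φ`:
`(P u | φ) = (u | P φ)`, since `P` is formally self-adjoint. -/
def weylPairing (h : ℝ) (p : ℝ × ℝ → ℝ) (u φ : ℝ → ℂ) : ℂ :=
  ∫ y : ℝ, u y * conj (weyl h p φ y)

/-- `Op(θ) (P u)` for a compactly supported symbol `θ`, a symbol `p` and `u` in `L²`: the smoothing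
operator `Op(θ)` applied to the distribution `P u`. At `x` this is `P u` paired with
`y ↦ conj (K_θ(x, y)) = K_θ(y, x)`. -/
def weylSmooth (h : ℝ) (θ p : ℝ × ℝ → ℝ) (u : ℝ → ℂ) (x : ℝ) : ℂ :=
  weylPairing h p u (fun y => weylKernel h θ y x)

/-- `[P, χ] u = P (χ u) - χ (P u)`, where `P` and `χ` are the Weyl quantizations of `p` and of the
cut-off `χ`. -/
def weylCommutator (h : ℝ) (p χ : ℝ × ℝ → ℝ) (u : ℝ → ℂ) (x : ℝ) : ℂ :=
  weyl h p (weyl h χ u) x - weylSmooth h χ p u x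

/-- The scalar product `(f | g)` of `L²(ℝ)`, linear in `f`. -/
def scalarProd (f g : ℝ → ℂ) : ℂ := ∫ x : ℝ, f x * conj (g x)

/-! ### The `h`-Fourier representation -/

/-- The unitary `h`-Fourier transform on `L²(ℝ)`,
`û(ξ) = (2πh)^{-1/2} ∫ e^{-ixξ/h} u(x) dx`. -/
def hFourier (h : ℝ) (u : Lp ℂ 2 (volume : Measure ℝ)) (ξ : ℝ) : ℂ :=
  ((√(2 * π * h))⁻¹ : ℝ) * (𝓕 u : Lp ℂ 2 (volume : Measure ℝ)) (ξ / (2 * π * h))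

/-- In the `h`-Fourier representation the Weyl quantization `c(x, hD_x)` acts as `c(-hD_ξ, ξ)`:
`(2πh)⁻¹ ∬ e^{-i(ξ-η)y/h} c(y, (ξ+η)/2) v(η) dy dη`,
which is the Weyl quantization, in the position variable `ξ`, of `(ξ, η) ↦ c(-η, ξ)`. -/
def fourierSymbol (c : ℝ × ℝ → ℝ) (z : ℝ × ℝ) : ℝ := c (-z.2, z.1)

/-! ### `O(h^∞)` and microlocal solutions -/

/-- `f = g` mod `O(h^∞)`. -/
def EqModHInfty (f g : ℝ → ℂ) : Prop :=
  ∀ N : ℕ, (fun h => f h - g h) =O[𝓝[>] 0] (fun h : ℝ => h ^ N)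

/-- `f_h = O(h^∞)` in `L²(ℝ)`. -/
def IsHInftyL2 (f : ℝ → ℝ → ℂ) : Prop :=
  ∀ N : ℕ, ∃ C : ℝ, ∀ᶠ h in 𝓝[>] (0 : ℝ), eLpNorm (f h) 2 volume ≤ ENNReal.ofReal (C * h ^ N)

/-- Real-valued `C_0^∞` functions on phase space with support in `U`. -/
structure IsTestSymbol (U : Set (ℝ × ℝ)) (θ : ℝ × ℝ → ℝ) : Prop where
  smooth : ContDiff ℝ ∞ θ
  compact : HasCompactSupport θ
  support : tsupport θ ⊆ U

/-- The microlocal kernel `K_h(E)` of `P - E`, near the part of the curve `Λ` in the open set `Ω`: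
tempered families `u_h ∈ L²(ℝ)` that are, in `Ω`, microlocalized on `Λ`
(that is, `WF_h(u) ∩ Ω ⊆ Λ`) and satisfy
`(P - E) u = O(h^∞)` microlocally in `Ω`. -/
structure IsMicrolocalSolution (p : ℝ → ℝ × ℝ → ℝ) (E : ℝ) (Λ Ω : Set (ℝ × ℝ))
    (u : ℝ → Lp ℂ 2 (volume : Measure ℝ)) : Prop where
  tempered : ∃ (N : ℕ) (C : ℝ), ∀ᶠ h in 𝓝[>] (0 : ℝ), ‖u h‖ ≤ C * (h ^ N)⁻¹
  localized : ∀ θ, IsTestSymbol (Ω \ Λ) θ → IsHInftyL2 (fun h => weyl h θ (u h))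
  equation : ∀ θ, IsTestSymbol Ω θ →
    IsHInftyL2 (fun h x => weylSmooth h θ (p h) (u h) x - E * weyl h θ (u h) x)

/-! ### The closed orbit, cut-offs and Wronskians -/

/-- `γ` is a (nonconstant) periodic orbit, of minimal period `T`, of the Hamiltonian vector field
`H_{p₀} = (∂_ξ p₀, -∂_x p₀)`, in the energy surface `{p₀ = E}`. -/
structure IsPeriodicOrbit (p₀ : ℝ × ℝ → ℝ) (E T : ℝ) (γ : ℝ → ℝ × ℝ) : Prop where
  flow : ∀ t, HasDerivAt γ (fderiv ℝ p₀ (γ t) (0, 1), -fderiv ℝ p₀ (γ t) (1, 0)) t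
  energy : ∀ t, p₀ (γ t) = E
  pos : 0 < T
  periodic : Function.Periodic γ T
  inj : InjOn γ (Ico 0 T)

/-- A cut-off at `a` with support in `Ω`: a `C_0^∞` function equal to `1` near `a`. -/
structure IsCutoffAt (Ω : Set (ℝ × ℝ)) (a : ℝ × ℝ) (χ : ℝ × ℝ → ℝ) : Prop extends
    IsTestSymbol Ω χ where
  eq_one : ∀ᶠ z in 𝓝 a, χ z = 1

/-- The two oriented segments `ρ = ±1` of the closed orbit at `a = γ 0`:  the orbit is cut at the
point `γ s`, `0 < s < T`; the part after `a` is `ρ = 1`, the part before `a` is `ρ = -1`. -/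
def orbitSegment (γ : ℝ → ℝ × ℝ) (T s : ℝ) (ρ : ℤˣ) : Set (ℝ × ℝ) :=
  if ρ = 1 then γ '' Ioo 0 s else γ '' Ioo (s - T) 0

/-- `ψ` localizes to a neighbourhood `ω_ρ` of the part of `supp [P, χ] ∩ Λ` on the segment `ρ`:
a `C_0^∞` function equal to `1` near `supp dχ ∩ Λ` on this segment, and to `0` near
`supp dχ ∩ Λ` on the other one. The point `γ s` that separates the two segments
away from `a` lies outside `supp χ`. -/
structure IsSegmentLocalizer (γ : ℝ → ℝ × ℝ) (T s : ℝ) (χ : ℝ × ℝ → ℝ) (ρ : ℤˣ)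
    (ψ : ℝ × ℝ → ℝ) : Prop where
  cut_mem : s ∈ Ioo 0 T
  cut_notMem : γ s ∉ tsupport χ
  smooth : ContDiff ℝ ∞ ψ
  compact : HasCompactSupport ψ
  eq_one : ∀ z ∈ tsupport (fderiv ℝ χ) ∩ orbitSegment γ T s ρ, ∀ᶠ w in 𝓝 z, ψ w = 1
  eq_zero : ∀ z ∈ tsupport (fderiv ℝ χ) ∩ orbitSegment γ T s (-ρ), ∀ᶠ w in 𝓝 z, ψ w = 0

/-- The full Wronskian `((i/h) [P, χ] u | v)`. -/
def fullWronskian (h : ℝ) (p χ : ℝ × ℝ → ℝ) (u v : ℝ → ℂ) : ℂ :=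
  scalarProd (fun x => Complex.I / h * weylCommutator h p χ u x) v

/-- The microlocal Wronskian `((i/h) [P, χ]_ρ u | v)`, where `[P, χ]_ρ = Op(ψ) [P, χ]` is the part
of the commutator supported microlocally in `ω_ρ`, and `ψ` localizes to `ω_ρ`. -/
def microlocalWronskian (h : ℝ) (p χ ψ : ℝ × ℝ → ℝ) (u v : ℝ → ℂ) : ℂ :=
  scalarProd (fun x => Complex.I / h * weyl h ψ (weylCommutator h p χ u) x) v

end

/-! Put Q = P - E. A real constant commutes with everything, so ((i/h)[P,χ]u | w) = (i/h) {(Q Op(χ)u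
| w) - (Op(χ)Q u | w)}. Since χ is supported in Ω, the second term is O(h^∞) for every tempered w,
by the equation for u. If w = v, the first term is (u | Op(χ)Q v), negligible by the equation for v;
hence the full Wronskian vanishes. If w = Op(ψ)v, there remains (i/h) (Q Op(χ)u | Op(ψ)v), a form
which up to conjugation is symmetric in the pairs (χ, u) and (ψ, v).

The claims on the segments follow from one localization principle,
`SymbolFamily.negligible_of_localized`: (Q Op(φ)a | Op(χ)b) is O(h^∞) if supp φ ∩ supp χ lies in Ω
and supp φ avoids supp dχ ∩ Λ. Near a point of supp φ outside supp χ the supports are disjoint; near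
a point of Ω off Λ the family a is negligible; near a point of Λ the function χ is constant, and the
equation for b applies.

So only the values of ψ near supp dχ ∩ Λ matter. For the change of sign, ψ₊ may be replaced by g -
ψ₋ with g = 1 near supp χ, and g contributes nothing. For the independence, both sets of data are
compared with a cut-off χ₀ that meets the orbit only in an arc about a so short that neither cut
touches it. The passage from χ to χ₀ is allowed because ψ can first be replaced by a ψ₀ that is
locally constant near the part of the orbit in supp(χ - χ₀).

The analytic input is that Weyl operators with symbols of disjoint supports compose to O(h^∞). A
unitary dilation by l = √(2πh) reduces to 2πh = 1 with symbols c(l z). The Bargmann transform `bt`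
is an isometry into L² of phase space, where Op(c) becomes the integral kernel `wm c`. Integration
by parts against a Gaussian gives its rapid decay off the diagonal, with constants depending only on
the symbol bounds (`exists_norm_wm_le`). A Schur estimate with the weights (1 + dist(l z,
S)/l)^(-k), tempered uniformly in l, then yields arbitrary powers of l
(`exists_norm_bform_disjoint_le`). No expansion of composed symbols and no sharp L² bound is needed,
because a loss of finitely many powers of h is harmless against O(h^∞). The Fourier transform is a
quarter turn of phase space, under which `wm` is covariant (`wm_rot`). -/

noncomputable section

/-! ### `L²` preliminaries -/

section L2
variable {α : Type*} [MeasurableSpace α] {μ : Measure α} {f g : α → ℂ}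

theorem memLp_toLp_inner (hf : MemLp f 2 μ) (hg : MemLp g 2 μ) :
    inner ℂ (hg.toLp g) (hf.toLp f) = ∫ x, f x * conj (g x) ∂μ := by
  rw [L2.inner_def]
  refine integral_congr_ae ?_
  filter_upwards [hf.coeFn_toLp, hg.coeFn_toLp] with x h1 h2
  rw [h1, h2, RCLike.inner_apply]

theorem integrable_mul_conj (hf : MemLp f 2 μ) (hg : MemLp g 2 μ) :
    Integrable (fun x => f x * conj (g x)) μ := by
  refine (L2.integrable_inner (𝕜 := ℂ) (hg.toLp g) (hf.toLp f)).congr ?_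
  filter_upwards [hf.coeFn_toLp, hg.coeFn_toLp] with x h1 h2
  rw [h1, h2, RCLike.inner_apply]

theorem norm_toLp_eq_lpNorm (hf : MemLp f 2 μ) : ‖hf.toLp f‖ = lpNorm f 2 μ := by
  rw [Lp.norm_toLp, toReal_eLpNorm hf.1]

theorem norm_integral_mul_conj_le (hf : MemLp f 2 μ) (hg : MemLp g 2 μ) :
    ‖∫ x, f x * conj (g x) ∂μ‖ ≤ lpNorm f 2 μ * lpNorm g 2 μ := by
  rw [← memLp_toLp_inner hf hg, ← norm_toLp_eq_lpNorm hf, ← norm_toLp_eq_lpNorm hg, mul_comm]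
  exact norm_inner_le_norm _ _

theorem lpNorm_sq_eq (hf : MemLp f 2 μ) : lpNorm f 2 μ ^ 2 = ∫ x, ‖f x‖ ^ 2 ∂μ := by
  rw [lpNorm_eq_integral_norm_rpow_toReal (by norm_num) (by norm_num) hf.1]
  rw [← Real.rpow_natCast, ← Real.rpow_mul (by positivity)]
  simp

theorem memLp_conj (hf : MemLp f 2 μ) : MemLp (fun x => conj (f x)) 2 μ := hf.star

theorem integrable_mul_of_memLp (hf : MemLp f 2 μ) (hg : MemLp g 2 μ) :
    Integrable (fun x => f x * g x) μ := by
  simpa using integrable_mul_conj hf (memLp_conj hg)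

theorem integral_conj_comm : ∫ x, f x * conj (g x) ∂μ = conj (∫ x, g x * conj (f x) ∂μ) := by
  rw [← integral_conj]
  congr 1; ext x; simp [mul_comm]

end L2

/-! ### Phases, coherent states and their Gram kernel -/

/-- `e^{it}`. -/
def cis (t : ℝ) : ℂ := Complex.exp (t * Complex.I)

@[simp] theorem norm_cis (t : ℝ) : ‖cis t‖ = 1 := Complex.norm_exp_ofReal_mul_I t
theorem cis_add (s t : ℝ) : cis (s + t) = cis s * cis t := by
  simp [cis, ← Complex.exp_add, add_mul]
@[simp] theorem cis_zero : cis 0 = 1 := by simp [cis]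
@[simp] theorem conj_cis (t : ℝ) : conj (cis t) = cis (-t) := by
  simp [cis, ← Complex.exp_conj]
@[fun_prop] theorem continuous_cis : Continuous cis := by unfold cis; fun_prop

/-- The coherent state centred at `z = (x, ξ)`. -/
def gs (z : ℝ × ℝ) (y : ℝ) : ℂ :=
  ((2 ^ (1 / 4 : ℝ) * rexp (-π * (y - z.1) ^ 2) : ℝ) : ℂ) * cis (2 * π * (z.2 * (y - z.1 / 2)))

/-- The scalar product of two coherent states. -/
def gram (a b : ℝ × ℝ) : ℂ :=
  (rexp (-(π / 2) * ((a.1 - b.1) ^ 2 + (a.2 - b.2) ^ 2)) : ℂ) * cis (π * (a.2 * b.1 - a.1 * b.2))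

@[fun_prop] theorem continuous_gs : Continuous (fun q : (ℝ × ℝ) × ℝ => gs q.1 q.2) := by
  unfold gs; fun_prop

@[fun_prop] theorem continuous_gs_comp {X : Type*} [TopologicalSpace X] {f : X → ℝ × ℝ} {g : X → ℝ}
    (hf : Continuous f) (hg : Continuous g) : Continuous (fun x => gs (f x) (g x)) :=
  continuous_gs.comp (hf.prodMk hg)

@[fun_prop] theorem continuous_gram_comp {X : Type*} [TopologicalSpace X] {f g : X → ℝ × ℝ}
    (hf : Continuous f) (hg : Continuous g) : Continuous (fun x => gram (f x) (g x)) := by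
  unfold gram; fun_prop

theorem norm_gs (z : ℝ × ℝ) (y : ℝ) :
    ‖gs z y‖ = 2 ^ (1 / 4 : ℝ) * rexp (-π * (y - z.1) ^ 2) := by
  rw [gs, norm_mul, norm_cis, mul_one, Complex.norm_real, Real.norm_of_nonneg (by positivity)]

theorem norm_gs_le (z : ℝ × ℝ) (y : ℝ) : ‖gs z y‖ ≤ 2 * rexp (-π * (y - z.1) ^ 2) := by
  rw [norm_gs]
  gcongr
  calc (2 : ℝ) ^ (1 / 4 : ℝ) ≤ 2 ^ (1 : ℝ) := by
        apply Real.rpow_le_rpow_of_exponent_le <;> norm_num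
    _ = 2 := by simp

theorem norm_gs_le_two (z : ℝ × ℝ) (y : ℝ) : ‖gs z y‖ ≤ 2 := by
  refine (norm_gs_le z y).trans ?_
  have : rexp (-π * (y - z.1) ^ 2) ≤ 1 := by
    rw [Real.exp_le_one_iff]; have := Real.pi_pos; nlinarith [sq_nonneg (y - z.1)]
  linarith

theorem norm_gram (a b : ℝ × ℝ) :
    ‖gram a b‖ = rexp (-(π / 2) * ((a.1 - b.1) ^ 2 + (a.2 - b.2) ^ 2)) := by
  rw [gram, norm_mul, norm_cis, mul_one, Complex.norm_real, Real.norm_of_nonneg (by positivity)]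

theorem conj_gram (a b : ℝ × ℝ) : conj (gram a b) = gram b a := by
  simp only [gram, map_mul, Complex.conj_ofReal, conj_cis]
  congr 3 <;> ring

/-- The Fourier transform of `e^{-2πy²}`. -/
theorem integral_gauss_cis (κ : ℝ) :
    ∫ y : ℝ, (rexp (-(2 * π) * y ^ 2) : ℂ) * cis (2 * π * (κ * y)) =
      ((√2)⁻¹ * rexp (-(π / 2) * κ ^ 2) : ℝ) := by
  have hb : 0 < ((2 * π : ℝ) : ℂ).re := by simp [Real.pi_pos]
  have h := fourierIntegral_gaussian hb ((2 * π * κ : ℝ) : ℂ)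
  have hpi := Real.pi_pos.ne'
  have hpiC : (π : ℂ) ≠ 0 := by exact_mod_cast hpi
  calc _ = ∫ x : ℝ, Complex.exp (Complex.I * ((2 * π * κ : ℝ) : ℂ) * x) *
        Complex.exp (-((2 * π : ℝ) : ℂ) * x ^ 2) := by
        congr 1; ext y
        rw [cis, mul_comm]; push_cast; congr 2; ring
    _ = _ := by
        rw [h]
        have h1 : ((π : ℂ) / ((2 * π : ℝ) : ℂ)) ^ (1 / 2 : ℂ) = (((√2)⁻¹ : ℝ) : ℂ) := by
          rw [show (π : ℂ) / ((2 * π : ℝ) : ℂ) = ((2⁻¹ : ℝ) : ℂ) by push_cast; field_simp]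
          rw [← Real.sqrt_inv, Real.sqrt_eq_rpow, Complex.ofReal_cpow (by norm_num)]
          norm_num
        rw [h1]; push_cast; congr 2; field_simp; ring

theorem sqrt_two_eq : (2 : ℝ) ^ (1 / 4 : ℝ) * 2 ^ (1 / 4 : ℝ) = √2 := by
  rw [← Real.rpow_add (by norm_num), Real.sqrt_eq_rpow]; norm_num

/-- Around the midpoint of the centres the two Gaussians merge into a single one in `t`. The phase
normalization of `gs`, with `y - z.1 / 2`, leaves exactly the symplectic form of `a` and `b` as the
constant phase. -/
theorem gs_mul_conj_gs (a b : ℝ × ℝ) (t : ℝ) :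
    gs a (t + (a.1 + b.1) / 2) * conj (gs b (t + (a.1 + b.1) / 2)) =
      ((√2 * rexp (-(π / 2) * (a.1 - b.1) ^ 2) : ℝ) : ℂ) * cis (π * (a.2 * b.1 - a.1 * b.2)) *
        ((rexp (-(2 * π) * t ^ 2) : ℂ) * cis (2 * π * ((a.2 - b.2) * t))) := by
  simp only [gs, map_mul, Complex.conj_ofReal, conj_cis]
  rw [← sqrt_two_eq]
  rw [mul_mul_mul_comm, mul_mul_mul_comm (((_ : ℝ) : ℂ)) (cis _), ← cis_add, ← cis_add,
    ← Complex.ofReal_mul, ← Complex.ofReal_mul]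
  congr 2
  · rw [mul_mul_mul_comm, ← Real.exp_add, mul_assoc _ (rexp _), ← Real.exp_add]
    congr 2; ring
  · ring

theorem integral_gs_mul_conj_gs (a b : ℝ × ℝ) : ∫ y, gs a y * conj (gs b y) = gram a b := by
  rw [← integral_add_right_eq_self _ ((a.1 + b.1) / 2)]
  simp_rw [gs_mul_conj_gs, integral_const_mul, integral_gauss_cis, gram]
  have h2 : ((√2 : ℝ) : ℂ) * ((√2 : ℝ) : ℂ)⁻¹ = 1 := by
    rw [mul_inv_cancel₀]; exact_mod_cast (by positivity : √2 ≠ 0)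
  rw [mul_add, Real.exp_add]
  push_cast
  linear_combination (Complex.exp (-(↑π / 2) * (↑a.1 - ↑b.1) ^ 2) * cis (π * (a.2 * b.1 - a.1 * b.2)) *
    Complex.exp (-(↑π / 2) * (↑a.2 - ↑b.2) ^ 2)) * h2

theorem memLp_gs (z : ℝ × ℝ) : MemLp (gs z) 2 volume := by
  rw [memLp_two_iff_integrable_sq_norm (by
    exact (continuous_gs_comp continuous_const continuous_id).aestronglyMeasurable)]
  have := (integrable_exp_neg_mul_sq (b := 2 * π) (by positivity)).comp_sub_right z.1
  refine (this.const_mul ((2 ^ (1 / 4 : ℝ)) ^ 2)).congr (ae_of_all _ fun y => ?_)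
  simp only [norm_gs, mul_pow, ← Real.exp_nat_mul]
  congr 2; push_cast; ring

theorem integrable_gs (z : ℝ × ℝ) : Integrable (gs z) := by
  have := (integrable_exp_neg_mul_sq (b := π) (by positivity)).comp_sub_right z.1
  refine (this.const_mul 2).mono' ?_ (ae_of_all _ fun y => norm_gs_le z y)
  exact (continuous_gs_comp continuous_const continuous_id).aestronglyMeasurable

/-! ### The Fourier transform on `L¹ ∩ L²` -/

open SchwartzMap in
-- The `L²` transform, defined by extension, and the integral agree because both satisfy ∫ f̂ φ = ∫
-- f φ̂ for every test function φ.
theorem fourier_toLp_ae_eq {f : ℝ → ℂ} (h1 : Integrable f) (h2 : MemLp f 2 volume) :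
    ((𝓕 (h2.toLp f) : Lp ℂ 2 (volume : Measure ℝ)) : ℝ → ℂ) =ᵐ[volume] 𝓕 f := by
  have hcont : Continuous (𝓕 f) :=
    VectorFourier.fourierIntegral_continuous Real.continuous_fourierChar continuous_inner h1
  refine ae_eq_of_integral_contDiff_smul_eq ((Lp.memLp _).locallyIntegrable (by norm_num))
    hcont.locallyIntegrable fun g hg hgc => ?_
  have hgc' : HasCompactSupport (fun x => (g x : ℂ)) := hgc.comp_left (g := ((↑) : ℝ → ℂ)) rfl
  have hg' : ContDiff ℝ ∞ (fun x => (g x : ℂ)) := Complex.ofRealCLM.contDiff.comp hg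
  set φ : 𝓢(ℝ, ℂ) := hgc'.toSchwartzMap hg' with hφ
  have hφx : ∀ x, φ x = (g x : ℂ) := fun x => rfl
  have key := congrArg (fun T : 𝓢'(ℝ, ℂ) => T φ)
    (Lp.fourier_toTemperedDistribution_eq (h2.toLp f))
  simp only [TemperedDistribution.fourier_apply, Lp.toTemperedDistribution_apply] at key
  have s1 : ∫ x, g x • (𝓕 (h2.toLp f) : Lp ℂ 2 (volume : Measure ℝ)) x =
      ∫ x, φ x • (𝓕 (h2.toLp f) : Lp ℂ 2 (volume : Measure ℝ)) x := by simp [hφx]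
  have s2 : ∫ x, (𝓕 φ : 𝓢(ℝ, ℂ)) x • (h2.toLp f) x = ∫ x, f x • (𝓕 (φ : ℝ → ℂ)) x := by
    refine integral_congr_ae ?_
    filter_upwards [h2.coeFn_toLp] with x hx
    rw [hx, SchwartzMap.fourier_coe, smul_eq_mul, smul_eq_mul, mul_comm]
  have s3 : ∫ x, (𝓕 f) x • φ x = ∫ x, f x • (𝓕 (φ : ℝ → ℂ)) x := by
    have := VectorFourier.integral_fourierIntegral_smul_eq_flip (L := innerₗ ℝ) (μ := volume)
      (ν := volume) (f := f) (g := (φ : ℝ → ℂ)) Real.continuous_fourierChar continuous_inner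
      h1 φ.integrable
    rw [flip_innerₗ] at this
    exact this
  have s4 : ∫ x, (𝓕 f) x • φ x = ∫ x, g x • (𝓕 f) x := by simp [hφx, mul_comm]
  rw [s1, ← key, s2, ← s3, s4]

theorem integral_fourier_mul_conj {f g : ℝ → ℂ} (hf1 : Integrable f) (hf2 : MemLp f 2 volume)
    (hg1 : Integrable g) (hg2 : MemLp g 2 volume) :
    MemLp (𝓕 f) 2 volume ∧
    ∫ ξ, (𝓕 f) ξ * conj ((𝓕 g) ξ) = ∫ x, f x * conj (g x) := by
  have hF := fourier_toLp_ae_eq hf1 hf2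
  have hG := fourier_toLp_ae_eq hg1 hg2
  refine ⟨(memLp_congr_ae hF).1 (Lp.memLp _), ?_⟩
  rw [← memLp_toLp_inner hf2 hg2, ← Lp.inner_fourier_eq, L2.inner_def]
  refine integral_congr_ae ?_
  filter_upwards [hF, hG] with x h1 h2
  rw [h1, h2, RCLike.inner_apply]

theorem ae_eq_zero_of_fourier_eq_zero {f : ℝ → ℂ} (h1 : Integrable f) (h2 : MemLp f 2 volume)
    (h : ∀ ξ, 𝓕 f ξ = 0) : f =ᵐ[volume] 0 := by
  have h3 := (integral_fourier_mul_conj h1 h2 h1 h2).2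
  simp only [h, zero_mul, integral_zero] at h3
  rw [← memLp_toLp_inner h2 h2, eq_comm, inner_self_eq_zero] at h3
  have := h2.coeFn_toLp
  rw [h3] at this
  exact this.symm.trans (Lp.coeFn_zero _ _ _)

/-! ### The Bargmann transform -/

/-- The (FBI–)Bargmann transform `z ↦ (f | g_z)`. -/
def bt (f : ℝ → ℂ) (z : ℝ × ℝ) : ℂ := ∫ y, f y * conj (gs z y)

theorem conj_gs_eq (x ξ y : ℝ) : conj (gs (x, ξ) y) =
    cis (π * (x * ξ)) * (gs (x, 0) y * cis (-(2 * π * (y * ξ)))) := by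
  simp only [gs, map_mul, Complex.conj_ofReal, zero_mul, mul_zero, cis_zero, mul_one]
  rw [conj_cis, mul_left_comm (cis _), ← cis_add]
  congr 2; ring

theorem fourier_eq_cis (f : ℝ → ℂ) (ξ : ℝ) : 𝓕 f ξ = ∫ y, f y * cis (-(2 * π * (y * ξ))) := by
  rw [Real.fourier_real_eq_integral_exp_smul]
  congr 1; ext y
  rw [smul_eq_mul, mul_comm, cis]
  congr 3; ring_nf

/-- For fixed `x` the Bargmann transform is a windowed Fourier transform. Its isometry thus reduces
to Plancherel in `ξ`, followed by Fubini in `x` with windows of norm one. -/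
theorem bt_eq_fourier (f : ℝ → ℂ) (x ξ : ℝ) :
    bt f (x, ξ) = cis (π * (x * ξ)) * 𝓕 (fun y => f y * gs (x, 0) y) ξ := by
  rw [bt, fourier_eq_cis, ← integral_const_mul]
  congr 1; ext y; rw [conj_gs_eq]; ring

theorem bt_gs (a : ℝ × ℝ) : bt (gs a) = gram a := by
  ext b; exact integral_gs_mul_conj_gs a b

theorem aestronglyMeasurable_bt {f : ℝ → ℂ} (hf : AEStronglyMeasurable f volume) :
    AEStronglyMeasurable (bt f) volume := by
  unfold bt
  refine AEStronglyMeasurable.integral_prod_right' (f := fun q : (ℝ × ℝ) × ℝ =>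
    f q.2 * conj (gs q.1 q.2)) ?_
  exact hf.comp_snd.mul (by fun_prop : Continuous fun q : (ℝ × ℝ) × ℝ => conj (gs q.1 q.2)).aestronglyMeasurable

theorem integrable_mul_gs {f : ℝ → ℂ} (hf : MemLp f 2 volume) (z : ℝ × ℝ) :
    Integrable (fun y => f y * gs z y) := integrable_mul_of_memLp hf (memLp_gs z)

theorem memLp_mul_gs {f : ℝ → ℂ} (hf : MemLp f 2 volume) (z : ℝ × ℝ) :
    MemLp (fun y => f y * gs z y) 2 volume := by
  refine (hf.norm.const_mul 2).mono (hf.1.mul (memLp_gs z).1) (ae_of_all _ fun y => ?_)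
  rw [norm_mul, norm_mul, norm_norm, mul_comm]
  gcongr
  simpa using norm_gs_le_two z y

theorem integrable_norm_gs_sq (y : ℝ) : Integrable (fun x : ℝ => ‖gs (x, 0) y‖ ^ 2) ∧
    ∫ x : ℝ, ‖gs (x, 0) y‖ ^ 2 = 1 := by
  have h0 : (fun x : ℝ => ‖gs (x, 0) y‖ ^ 2) = fun x => ‖gs (y, 0) x‖ ^ 2 := by
    ext x; simp only [norm_gs]; congr 3; ring
  have h1 := (memLp_two_iff_integrable_sq_norm (memLp_gs (y, 0)).1).1 (memLp_gs (y, 0))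
  rw [h0]
  refine ⟨h1, ?_⟩
  have h2 := integral_gs_mul_conj_gs (y, 0) (y, 0)
  simp only [Complex.mul_conj, Complex.normSq_eq_norm_sq] at h2
  rw [integral_complex_ofReal] at h2
  simpa [gram] using h2

theorem integrable_window {F : ℝ → ℂ} (hF : Integrable F) :
    Integrable (fun q : ℝ × ℝ => F q.2 * (‖gs (q.1, 0) q.2‖ ^ 2 : ℝ)) := by
  rw [Measure.volume_eq_prod]
  rw [integrable_prod_iff']
  · refine ⟨ae_of_all _ fun y => ?_, ?_⟩
    · exact ((integrable_norm_gs_sq y).1.ofReal (𝕜 := ℂ)).const_mul (F y)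
    · refine hF.norm.congr (ae_of_all _ fun y => ?_)
      simp only [norm_mul, Complex.norm_real, norm_pow, norm_norm, integral_const_mul,
        (integrable_norm_gs_sq y).2, mul_one]
  · exact hF.1.comp_snd.mul (by fun_prop : Continuous fun q : ℝ × ℝ =>
      (((‖gs (q.1, 0) q.2‖ ^ 2 : ℝ) : ℂ))).aestronglyMeasurable

theorem integral_bt_section {f g : ℝ → ℂ} (hf : MemLp f 2 volume) (hg : MemLp g 2 volume) (x : ℝ) :
    ∫ ξ, bt f (x, ξ) * conj (bt g (x, ξ)) =
      ∫ y, f y * conj (g y) * (‖gs (x, 0) y‖ ^ 2 : ℝ) := by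
  have h := (integral_fourier_mul_conj (integrable_mul_gs hf (x, 0)) (memLp_mul_gs hf (x, 0))
    (integrable_mul_gs hg (x, 0)) (memLp_mul_gs hg (x, 0))).2
  have e1 : ∀ ξ, bt f (x, ξ) * conj (bt g (x, ξ)) =
      𝓕 (fun y => f y * gs (x, 0) y) ξ * conj (𝓕 (fun y => g y * gs (x, 0) y) ξ) := by
    intro ξ
    rw [bt_eq_fourier, bt_eq_fourier, map_mul, mul_mul_mul_comm, Complex.mul_conj,
      Complex.normSq_eq_norm_sq, norm_cis]
    simp
  simp_rw [e1, h]
  congr 1; ext y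
  rw [map_mul, mul_mul_mul_comm, Complex.mul_conj (gs (x, 0) y), Complex.normSq_eq_norm_sq]

theorem memLp_bt {f : ℝ → ℂ} (hf : MemLp f 2 volume) : MemLp (bt f) 2 volume := by
  rw [memLp_two_iff_integrable_sq_norm (aestronglyMeasurable_bt hf.1)]
  rw [Measure.volume_eq_prod, integrable_prod_iff]
  · constructor
    · refine ae_of_all _ fun x => ?_
      have h := (integral_fourier_mul_conj (integrable_mul_gs hf (x, 0)) (memLp_mul_gs hf (x, 0))
        (integrable_mul_gs hf (x, 0)) (memLp_mul_gs hf (x, 0))).1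
      refine ((memLp_two_iff_integrable_sq_norm h.1).1 h).congr (ae_of_all _ fun ξ => ?_)
      simp [bt_eq_fourier]
    · have h1 := (integrable_window (integrable_mul_conj hf hf))
      rw [Measure.volume_eq_prod] at h1
      refine h1.integral_prod_left.re.congr (ae_of_all _ fun x => ?_)
      have h2 := integral_bt_section hf hf x
      simp only [Complex.mul_conj, Complex.normSq_eq_norm_sq] at h2
      rw [integral_complex_ofReal] at h2
      simp only [Complex.mul_conj, Complex.normSq_eq_norm_sq, ← h2, norm_pow, norm_norm]
      simp
  · exact ((aestronglyMeasurable_bt hf.1).norm.pow 2)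

/-- The Bargmann transform is an isometry. -/
theorem integral_bt_mul_conj_bt {f g : ℝ → ℂ} (hf : MemLp f 2 volume) (hg : MemLp g 2 volume) :
    ∫ z, bt f z * conj (bt g z) = ∫ y, f y * conj (g y) := by
  have h1 := integrable_mul_conj (memLp_bt hf) (memLp_bt hg)
  have h2 := integrable_window (integrable_mul_conj hf hg)
  rw [Measure.volume_eq_prod] at h1 h2 ⊢
  rw [integral_prod _ h1]
  simp_rw [integral_bt_section hf hg]
  rw [integral_integral_swap h2]
  congr 1; ext y
  rw [integral_const_mul, integral_complex_ofReal, (integrable_norm_gs_sq y).2]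
  simp

theorem lpNorm_bt {f : ℝ → ℂ} (hf : MemLp f 2 volume) :
    lpNorm (bt f) 2 volume = lpNorm f 2 volume := by
  have h := integral_bt_mul_conj_bt hf hf
  simp only [Complex.mul_conj, Complex.normSq_eq_norm_sq] at h
  rw [integral_complex_ofReal, integral_complex_ofReal] at h
  have h2 : lpNorm (bt f) 2 volume ^ 2 = lpNorm f 2 volume ^ 2 := by
    rw [lpNorm_sq_eq hf, lpNorm_sq_eq (memLp_bt hf)]
    exact_mod_cast h
  exact (pow_left_inj₀ lpNorm_nonneg lpNorm_nonneg two_ne_zero).1 h2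

/-! ### Polynomial growth against Gaussians. -/

theorem exists_poly_mul_gauss_le' {b : ℝ} (hb : 0 < b) (N : ℕ) :
    ∃ K : ℝ, 0 < K ∧ ∀ x : ℝ, (1 + |x|) ^ N * rexp (-b * x ^ 2) ≤ K := by
  -- The power is at most `N! e^(1 + |x|)`, and `|x| - b x² ≤ 1 / (4b)` by completing the square.
  refine ⟨N.factorial * rexp (1 + (4 * b)⁻¹), by positivity, fun x => ?_⟩
  have h1 : (1 + |x|) ^ N ≤ N.factorial * rexp (1 + |x|) := by
    have := Real.pow_div_factorial_le_exp (1 + |x|) (by positivity) N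
    rwa [div_le_iff₀' (by positivity)] at this
  calc _ ≤ N.factorial * rexp (1 + |x|) * rexp (-b * x ^ 2) := by gcongr
    _ = N.factorial * rexp (1 + |x| - b * x ^ 2) := by
      rw [mul_assoc, ← Real.exp_add]; congr 2; ring
    _ ≤ _ := by
      gcongr
      have h3 : (4 * b)⁻¹ - |x| + b * |x| ^ 2 = b * (|x| - (2 * b)⁻¹) ^ 2 := by field_simp; ring
      have h4 : 0 ≤ b * (|x| - (2 * b)⁻¹) ^ 2 := by positivity
      rw [sq_abs] at h3
      linarith

theorem exists_poly_mul_gauss_le (N : ℕ) :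
    ∃ K : ℝ, 0 < K ∧ ∀ x : ℝ, (1 + |x|) ^ N * rexp (-(π / 2) * x ^ 2) ≤ K :=
  exists_poly_mul_gauss_le' (by positivity) N

theorem one_add_abs_le (x y : ℝ) : 1 + |x| ≤ (1 + |y|) * (1 + |x - y|) := by
  have : |x| ≤ |y| + |x - y| := by simpa using abs_add_le y (x - y)
  nlinarith [abs_nonneg y, abs_nonneg (x - y)]

/-- A function of polynomial growth times a coherent state has Gaussian decay. -/
theorem exists_norm_mul_gs_le {f : ℝ → ℂ} {C : ℝ} {N : ℕ} (hf : ∀ x, ‖f x‖ ≤ C * (1 + |x|) ^ N)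
    (z : ℝ × ℝ) : ∃ K : ℝ, ∀ x, ‖f x * gs z x‖ ≤ K * rexp (-(π / 2) * (x - z.1) ^ 2) := by
  obtain ⟨K, hK0, hK⟩ := exists_poly_mul_gauss_le N
  have hC : 0 ≤ C := by have := (norm_nonneg _).trans (hf 0); simpa using this
  refine ⟨C * (1 + |z.1|) ^ N * K * 2, fun x => ?_⟩
  rw [norm_mul]
  calc ‖f x‖ * ‖gs z x‖ ≤ (C * ((1 + |z.1|) * (1 + |x - z.1|)) ^ N) *
        (2 * rexp (-π * (x - z.1) ^ 2)) := by
        gcongr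
        · exact (hf x).trans (by gcongr; exact one_add_abs_le x z.1)
        · exact norm_gs_le z x
    _ = C * (1 + |z.1|) ^ N * ((1 + |x - z.1|) ^ N * rexp (-(π / 2) * (x - z.1) ^ 2)) * 2 *
        rexp (-(π / 2) * (x - z.1) ^ 2) := by
        rw [show -π * (x - z.1) ^ 2 = -(π / 2) * (x - z.1) ^ 2 + -(π / 2) * (x - z.1) ^ 2 by ring,
          Real.exp_add, mul_pow]
        ring
    _ ≤ _ := by
        gcongr; exact hK _

theorem integrable_gauss_sub (b a : ℝ) (hb : 0 < b) :
    Integrable (fun x : ℝ => rexp (-b * (x - a) ^ 2)) :=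
  (integrable_exp_neg_mul_sq hb).comp_sub_right a

theorem integrable_mul_gs_of_poly {f : ℝ → ℂ} (hf : AEStronglyMeasurable f volume) {C : ℝ} {N : ℕ}
    (hfC : ∀ x, ‖f x‖ ≤ C * (1 + |x|) ^ N) (z : ℝ × ℝ) : Integrable (fun x => f x * gs z x) := by
  obtain ⟨K, hK⟩ := exists_norm_mul_gs_le hfC z
  exact ((integrable_gauss_sub (π / 2) z.1 (by positivity)).const_mul K).mono'
    (hf.mul (memLp_gs z).1) (ae_of_all _ hK)

theorem memLp_mul_gs_of_poly {f : ℝ → ℂ} (hf : AEStronglyMeasurable f volume) {C : ℝ} {N : ℕ}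
    (hfC : ∀ x, ‖f x‖ ≤ C * (1 + |x|) ^ N) (z : ℝ × ℝ) :
    MemLp (fun x => f x * gs z x) 2 volume := by
  obtain ⟨K, hK⟩ := exists_norm_mul_gs_le hfC z
  refine (memLp_two_iff_integrable_sq_norm (hf.mul (memLp_gs z).1)).2 ?_
  refine ((integrable_gauss_sub π z.1 (by positivity)).const_mul (K ^ 2)).mono'
    ((hf.mul (memLp_gs z).1).norm.pow 2) (ae_of_all _ fun x => ?_)
  rw [norm_pow, norm_norm]
  calc _ ≤ (K * rexp (-(π / 2) * (x - z.1) ^ 2)) ^ 2 := by gcongr; exact hK x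
    _ = _ := by rw [mul_pow, ← Real.exp_nat_mul]; congr 2; push_cast; ring

/-- Coherent states separate functions of at most polynomial growth. -/
theorem ae_eq_of_bt_eq {f g : ℝ → ℂ} (hf : AEStronglyMeasurable f volume)
    (hg : AEStronglyMeasurable g volume) {C C' : ℝ} {N N' : ℕ}
    (hfC : ∀ x, ‖f x‖ ≤ C * (1 + |x|) ^ N) (hgC : ∀ x, ‖g x‖ ≤ C' * (1 + |x|) ^ N')
    (h : bt f = bt g) : f =ᵐ[volume] g := by
  have hif := integrable_mul_gs_of_poly hf hfC (0, 0)
  have hig := integrable_mul_gs_of_poly hg hgC (0, 0)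
  -- The centres `(0, ξ)` suffice: multiplied by one Gaussian, both functions lie in `L¹ ∩ L²` and
  -- have the same Fourier transform, and the Gaussian never vanishes.
  have hz : (fun y => f y * gs (0, 0) y) - (fun y => g y * gs (0, 0) y) =ᵐ[volume] 0 := by
    refine ae_eq_zero_of_fourier_eq_zero (hif.sub hig)
      ((memLp_mul_gs_of_poly hf hfC _).sub (memLp_mul_gs_of_poly hg hgC _)) fun ξ => ?_
    have h1 := congrFun h (0, ξ)
    rw [bt_eq_fourier, bt_eq_fourier] at h1
    simp only [zero_mul, mul_zero, cis_zero, one_mul] at h1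
    have hi : ∀ {k : ℝ → ℂ}, Integrable k → Integrable (fun y => k y * cis (-(2 * π * (y * ξ)))) :=
      fun hk => hk.mul_bdd (c := 1) (by fun_prop : Continuous fun y : ℝ =>
        cis (-(2 * π * (y * ξ)))).aestronglyMeasurable (ae_of_all _ fun y => by simp)
    rw [fourier_eq_cis] at h1 ⊢
    rw [fourier_eq_cis] at h1
    simp only [Pi.sub_apply, sub_mul]
    rw [integral_sub (hi hif) (hi hig), h1, sub_self]
  filter_upwards [hz] with x hx
  simp only [Pi.sub_apply, Pi.zero_apply, ← sub_mul] at hx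
  have hne : gs (0, 0) x ≠ 0 := by
    rw [← norm_pos_iff, norm_gs]; positivity
  exact sub_eq_zero.1 ((mul_eq_zero.1 hx).resolve_right hne)

/-! ### Fourier integrals with a Gaussian weight -/

theorem exists_polynomial_iteratedDeriv_gauss (b : ℝ) (j : ℕ) :
    ∃ P : Polynomial ℝ, ∀ t : ℝ,
      iteratedDeriv j (fun t : ℝ => rexp (-b * t ^ 2)) t = P.eval t * rexp (-b * t ^ 2) := by
  induction j with
  | zero => exact ⟨1, fun t => by simp⟩
  | succ j ih =>
    obtain ⟨P, hP⟩ := ih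
    refine ⟨Polynomial.derivative P + P * (Polynomial.C (-2 * b) * Polynomial.X), fun t => ?_⟩
    rw [iteratedDeriv_succ, funext hP]
    have h1 : HasDerivAt (fun t : ℝ => rexp (-b * t ^ 2)) (rexp (-b * t ^ 2) * (-b * (2 * t))) t := by
      have := ((hasDerivAt_pow 2 t).const_mul (-b)).exp
      simpa using this
    have h2 : deriv (fun x => P.eval x * rexp (-b * x ^ 2)) t = _ :=
      ((P.hasDerivAt t).mul h1).deriv
    rw [h2]
    simp; ring

theorem exists_norm_polynomial_le (P : Polynomial ℝ) :
    ∃ (C : ℝ) (n : ℕ), 0 ≤ C ∧ ∀ t : ℝ, |P.eval t| ≤ C * (1 + |t|) ^ n := by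
  induction P using Polynomial.induction_on' with
  | add p q hp hq =>
    obtain ⟨C, n, hC, h⟩ := hp
    obtain ⟨C', n', hC', h'⟩ := hq
    refine ⟨C + C', n + n', by positivity, fun t => ?_⟩
    have h1 : (1 : ℝ) ≤ 1 + |t| := by linarith [abs_nonneg t]
    rw [Polynomial.eval_add, add_mul]
    refine (abs_add_le _ _).trans (add_le_add ((h t).trans ?_) ((h' t).trans ?_))
    · gcongr
      all_goals omega
    · gcongr
      all_goals omega
  | monomial n a =>
    refine ⟨|a|, n, abs_nonneg a, fun t => ?_⟩
    rw [Polynomial.eval_monomial, abs_mul, abs_pow]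
    gcongr; linarith

theorem exists_iteratedDeriv_gauss_le {b : ℝ} (hb : 0 < b) (N j : ℕ) :
    ∃ K : ℝ, 0 < K ∧ ∀ t : ℝ, (1 + |t|) ^ N * |iteratedDeriv j (fun t : ℝ => rexp (-b * t ^ 2)) t| ≤
      K * rexp (-(b / 2) * t ^ 2) := by
  obtain ⟨P, hP⟩ := exists_polynomial_iteratedDeriv_gauss b j
  obtain ⟨C, n, hC, h⟩ := exists_norm_polynomial_le P
  obtain ⟨K, hK0, hK⟩ := exists_poly_mul_gauss_le' (half_pos hb) (N + n)
  refine ⟨C * K + 1, by positivity, fun t => ?_⟩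
  rw [hP, abs_mul, Real.abs_exp]
  calc (1 + |t|) ^ N * (|P.eval t| * rexp (-b * t ^ 2))
      ≤ (1 + |t|) ^ N * ((C * (1 + |t|) ^ n) * rexp (-b * t ^ 2)) := by gcongr; exact h t
    _ = C * ((1 + |t|) ^ (N + n) * rexp (-(b / 2) * t ^ 2)) * rexp (-(b / 2) * t ^ 2) := by
      rw [show -b * t ^ 2 = -(b / 2) * t ^ 2 + -(b / 2) * t ^ 2 by ring, Real.exp_add, pow_add]
      ring
    _ ≤ (C * K + 1) * rexp (-(b / 2) * t ^ 2) := by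
      gcongr
      exact (mul_le_mul_of_nonneg_left (hK t) hC).trans (by linarith)

theorem one_add_pow_le (x : ℝ) (hx : 0 ≤ x) (k : ℕ) : (1 + x) ^ k ≤ 2 ^ k * (1 + x ^ k) := by
  refine (add_pow_le zero_le_one hx k).trans ?_
  rw [one_pow]
  gcongr
  · norm_num
  · omega

/-- Integration by parts against a Gaussian. -/
theorem exists_gauss_fourier_le {b : ℝ} (hb : 0 < b) (k N : ℕ) :
    ∃ K : ℝ, 0 < K ∧ ∀ (q : ℝ → ℝ) (A : ℝ), ContDiff ℝ ∞ q →
      (∀ j ≤ k, ∀ t, ‖iteratedFDeriv ℝ j q t‖ ≤ A * (1 + |t|) ^ N) → ∀ κ : ℝ,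
      ‖∫ t : ℝ, ((q t * rexp (-b * t ^ 2) : ℝ) : ℂ) * cis (-(2 * π * (t * κ)))‖ ≤
        K * A * ((1 + |κ|) ^ k)⁻¹ := by
  choose Kj hKj0 hKj using exists_iteratedDeriv_gauss_le hb N
  set S : ℝ := ∑ i ∈ Finset.range (k + 1), Kj i with hS
  have hS0 : 0 < S := Finset.sum_pos (fun i _ => hKj0 i) (by simp)
  have hSj : ∀ j ≤ k, Kj j ≤ S := fun j hj =>
    Finset.single_le_sum (fun i _ => (hKj0 i).le) (Finset.mem_range.2 (by omega))
  have hgi : Integrable (fun t : ℝ => rexp (-(b / 2) * t ^ 2)) := integrable_exp_neg_mul_sq (half_pos hb)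
  set I : ℝ := ∫ t : ℝ, rexp (-(b / 2) * t ^ 2) with hI
  have hI0 : 0 ≤ I := integral_nonneg fun t => (Real.exp_pos _).le
  -- `I + 1` in place of `I` only serves to make the constant visibly positive; the same device
  -- recurs in the later estimates.
  refine ⟨2 ^ k * (2 * (2 ^ k * S * (I + 1))), by positivity, fun q A hq hA κ => ?_⟩
  have hA0 : 0 ≤ A := by
    have := (norm_nonneg _).trans (hA 0 (Nat.zero_le _) 0); simpa using this
  set G : ℝ → ℝ := fun t => rexp (-b * t ^ 2) with hG
  have hGs : ContDiff ℝ ∞ G := by rw [hG]; fun_prop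
  set f : ℝ → ℂ := fun t => ((q t * rexp (-b * t ^ 2) : ℝ) : ℂ) with hf
  have hfs : ContDiff ℝ ∞ f := Complex.ofRealCLM.contDiff.comp (hq.mul hGs)
  have hbd : ∀ j ≤ k, ∀ t, ‖iteratedDeriv j f t‖ ≤ 2 ^ k * S * A * rexp (-(b / 2) * t ^ 2) := by
    intro j hj t
    rw [← norm_iteratedFDeriv_eq_norm_iteratedDeriv]
    have e1 : ‖iteratedFDeriv ℝ j f t‖ = ‖iteratedFDeriv ℝ j (fun t => q t * G t) t‖ :=
      Complex.ofRealLI.norm_iteratedFDeriv_comp_left ((hq.mul hGs).contDiffAt) (i := j)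
        (by exact_mod_cast le_top)
    rw [e1]
    refine (norm_iteratedFDeriv_mul_le hq hGs t (n := j) (by exact_mod_cast le_top)).trans ?_
    have : ∀ i ∈ Finset.range (j + 1), (j.choose i : ℝ) * ‖iteratedFDeriv ℝ i q t‖ *
        ‖iteratedFDeriv ℝ (j - i) G t‖ ≤ (j.choose i : ℝ) * (S * A * rexp (-(b / 2) * t ^ 2)) := by
      intro i hi
      rw [mul_assoc]
      refine mul_le_mul_of_nonneg_left ?_ (Nat.cast_nonneg _)
      rw [norm_iteratedFDeriv_eq_norm_iteratedDeriv (f := G)]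
      have hi' : i ≤ j := Nat.lt_succ_iff.1 (Finset.mem_range.1 hi)
      calc _ ≤ (A * (1 + |t|) ^ N) * ‖iteratedDeriv (j - i) G t‖ := by
            gcongr; exact hA i (hi'.trans hj) t
        _ = A * ((1 + |t|) ^ N * |iteratedDeriv (j - i) G t|) := by rw [Real.norm_eq_abs]; ring
        _ ≤ A * (Kj (j - i) * rexp (-(b / 2) * t ^ 2)) :=
            mul_le_mul_of_nonneg_left (hKj _ t) hA0
        _ ≤ A * (S * rexp (-(b / 2) * t ^ 2)) := by gcongr; exact hSj _ (by omega)
        _ = _ := by ring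
    refine (Finset.sum_le_sum this).trans ?_
    rw [← Finset.sum_mul]
    have hc : (∑ i ∈ Finset.range (j + 1), (j.choose i : ℝ)) = 2 ^ j := by
      exact_mod_cast Nat.sum_range_choose j
    rw [hc, mul_assoc, mul_assoc, mul_assoc]
    gcongr
    norm_num
  have hint : ∀ j ≤ k, Integrable (iteratedDeriv j f) := fun j hj =>
    (hgi.const_mul (2 ^ k * S * A)).mono'
      ((hfs.continuous_iteratedDeriv j (by exact_mod_cast le_top)).aestronglyMeasurable)
      (ae_of_all _ (hbd j hj))
  have hI2 : ∀ j ≤ k, ∫ t, ‖iteratedDeriv j f t‖ ≤ 2 ^ k * S * A * I := by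
    intro j hj
    rw [hI, ← integral_const_mul]
    exact integral_mono (hint j hj).norm (hgi.const_mul _) (hbd j hj)
  have hF0 : ‖𝓕 f κ‖ ≤ 2 ^ k * S * A * I := by
    have h1 : ‖𝓕 f κ‖ ≤ ∫ t, ‖f t‖ :=
      VectorFourier.norm_fourierIntegral_le_integral_norm _ _ _ _ _
    have h2 := hI2 0 (Nat.zero_le _)
    simp only [iteratedDeriv_zero] at h2
    exact h1.trans h2
  -- Differentiating `k` times produces `(2πκ)^k`, and the factor `2π ≥ 1` is dropped. Together with
  -- the bound without derivatives this controls `(1 + |κ|)^k`.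
  have hFk : |κ| ^ k * ‖𝓕 f κ‖ ≤ 2 ^ k * S * A * I := by
    have h1 := congrFun (Real.fourier_iteratedDeriv (N := (k : ℕ∞)) (n := k)
      (hfs.of_le (by exact_mod_cast le_top)) (fun n hn => hint n (by exact_mod_cast hn)) le_rfl) κ
    have h2 : ‖𝓕 (iteratedDeriv k f) κ‖ ≤ ∫ t, ‖iteratedDeriv k f t‖ :=
      VectorFourier.norm_fourierIntegral_le_integral_norm _ _ _ _ _
    rw [h1, norm_smul, norm_pow] at h2
    refine le_trans ?_ (h2.trans (hI2 k le_rfl))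
    gcongr
    have : ‖(2 * π * Complex.I * κ : ℂ)‖ = 2 * π * |κ| := by
      simp [abs_of_pos Real.pi_pos]
    rw [this]
    have := Real.pi_gt_three
    nlinarith [abs_nonneg κ]
  rw [← fourier_eq_cis f κ, ← div_eq_mul_inv, le_div_iff₀ (by positivity)]
  calc ‖𝓕 f κ‖ * (1 + |κ|) ^ k ≤ ‖𝓕 f κ‖ * (2 ^ k * (1 + |κ| ^ k)) := by
        gcongr; exact one_add_pow_le _ (abs_nonneg κ) k
    _ = 2 ^ k * (‖𝓕 f κ‖ + |κ| ^ k * ‖𝓕 f κ‖) := by ring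
    _ ≤ 2 ^ k * (2 ^ k * S * A * I + 2 ^ k * S * A * I) := by gcongr
    _ = 2 ^ k * (2 * (2 ^ k * S * I)) * A := by ring
    _ ≤ 2 ^ k * (2 * (2 ^ k * S * (I + 1))) * A := by gcongr; linarith

/-- Used for slices, the swap of coordinates, dilations and the quarter turn; in all of them the
linear map has norm at most one, so that symbol bounds pass over with the same constants. -/
theorem norm_iteratedFDeriv_comp_add_clm_le {E F : Type*} [NormedAddCommGroup E] [NormedSpace ℝ E]
    [NormedAddCommGroup F] [NormedSpace ℝ F] {f : F → ℝ} (hf : ContDiff ℝ ∞ f) (L : E →L[ℝ] F)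
    (a : F) (j : ℕ) (x : E) :
    ‖iteratedFDeriv ℝ j (fun x => f (a + L x)) x‖ ≤ ‖iteratedFDeriv ℝ j f (a + L x)‖ * ‖L‖ ^ j := by
  have hg : ContDiff ℝ ∞ (fun y => f (a + y)) := hf.comp (contDiff_const.add contDiff_id)
  have h := L.iteratedFDeriv_comp_right (i := j) hg x (by exact_mod_cast le_top)
  rw [show (fun x => f (a + L x)) = (fun y => f (a + y)) ∘ L from rfl, h]
  refine (ContinuousMultilinearMap.norm_compContinuousLinearMap_le _ _).trans ?_
  rw [iteratedFDeriv_comp_add_left]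
  simp

/-! ### The Japanese bracket -/

/-- The weight `1 + ‖z‖`. -/
def br {E : Type*} [NormedAddCommGroup E] (z : E) : ℝ := 1 + ‖z‖

section br
variable {E : Type*} [NormedAddCommGroup E]

theorem one_le_br (z : E) : 1 ≤ br z := by unfold br; linarith [norm_nonneg z]
theorem br_pos (z : E) : 0 < br z := lt_of_lt_of_le one_pos (one_le_br z)
theorem br_ne_zero (z : E) : br z ≠ 0 := (br_pos z).ne'
theorem br_sub_comm (z w : E) : br (z - w) = br (w - z) := by simp [br, norm_sub_rev]
theorem br_le_mul (a b : E) : br a ≤ br b * br (a - b) := by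
  unfold br
  have : ‖a‖ ≤ ‖b‖ + ‖a - b‖ := by simpa using norm_add_le b (a - b)
  nlinarith [norm_nonneg b, norm_nonneg (a - b)]
theorem br_le_mul' (a b : E) : br a ≤ br b * br (b - a) := br_sub_comm a b ▸ br_le_mul a b
theorem inv_br_pow_pos (z : E) (k : ℕ) : 0 < (br z ^ k)⁻¹ := inv_pos.2 (pow_pos (br_pos z) k)
theorem inv_br_pow_le_one (z : E) (k : ℕ) : (br z ^ k)⁻¹ ≤ 1 :=
  inv_le_one_of_one_le₀ (one_le_pow₀ (one_le_br z))
theorem inv_br_pow_anti (z : E) {k l : ℕ} (h : k ≤ l) : (br z ^ l)⁻¹ ≤ (br z ^ k)⁻¹ :=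
  inv_anti₀ (pow_pos (br_pos z) k) (pow_le_pow_right₀ (one_le_br z) h)
/-- Peetre's inequality. -/
theorem inv_br_le (a b : E) (k : ℕ) : (br b ^ k)⁻¹ ≤ br (a - b) ^ k * (br a ^ k)⁻¹ := by
  rw [← div_eq_mul_inv, le_div_iff₀ (pow_pos (br_pos a) k), inv_mul_le_iff₀ (pow_pos (br_pos b) k),
    ← mul_pow]
  exact pow_le_pow_left₀ (br_pos a).le (br_le_mul a b) k
@[fun_prop] theorem continuous_br_comp {X : Type*} [TopologicalSpace X] {f : X → E}
    (hf : Continuous f) : Continuous (fun x => br (f x)) := by unfold br; fun_prop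
theorem continuous_inv_br_pow (k : ℕ) : Continuous (fun z : E => (br z ^ k)⁻¹) :=
  ((continuous_br_comp continuous_id).pow k).inv₀ fun z => pow_ne_zero _ (br_ne_zero z)
end br

theorem br_real (x : ℝ) : br x = 1 + |x| := rfl
theorem br_fst_le (z : ℝ × ℝ) : br z.1 ≤ br z := by unfold br; gcongr; exact norm_fst_le z
theorem br_snd_le (z : ℝ × ℝ) : br z.2 ≤ br z := by unfold br; gcongr; exact norm_snd_le z
theorem br_le_mul_br (z : ℝ × ℝ) : br z ≤ br z.1 * br z.2 := by
  unfold br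
  rw [Prod.norm_def]
  rcases max_cases ‖z.1‖ ‖z.2‖ with ⟨h, _⟩ | ⟨h, _⟩ <;> rw [h] <;>
    nlinarith [norm_nonneg z.1, norm_nonneg z.2, mul_nonneg (norm_nonneg z.1) (norm_nonneg z.2)]

/-- Three exceeds the dimension of phase space. The reserve of three powers reappears in all
estimates of phase space integrals below. -/
theorem integrable_inv_br_pow {k : ℕ} (hk : 3 ≤ k) : Integrable (fun z : ℝ × ℝ => (br z ^ k)⁻¹) := by
  have h := integrable_one_add_norm (E := ℝ × ℝ) (μ := volume) (r := k) (by
    simp; exact_mod_cast hk)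
  refine h.congr (ae_of_all _ fun z => ?_)
  simp only [br]
  rw [Real.rpow_neg (by positivity), Real.rpow_natCast]

theorem integrable_inv_br_pow_real {k : ℕ} (hk : 2 ≤ k) : Integrable (fun z : ℝ => (br z ^ k)⁻¹) := by
  have h := integrable_one_add_norm (E := ℝ) (μ := volume) (r := k) (by
    simp; exact_mod_cast hk)
  refine h.congr (ae_of_all _ fun z => ?_)
  simp only [br]
  rw [Real.rpow_neg (by positivity), Real.rpow_natCast]

theorem exists_norm_gram_le (k : ℕ) :
    ∃ K : ℝ, 0 < K ∧ ∀ a b : ℝ × ℝ, ‖gram a b‖ ≤ K * (br (a - b) ^ k)⁻¹ := by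
  obtain ⟨K, hK0, hK⟩ := exists_poly_mul_gauss_le k
  refine ⟨K, hK0, fun a b => ?_⟩
  rw [← div_eq_mul_inv, le_div_iff₀ (pow_pos (br_pos _) k), norm_gram]
  refine le_trans ?_ (hK ‖a - b‖)
  rw [abs_norm, mul_comm (rexp _), br]
  refine mul_le_mul_of_nonneg_left (Real.exp_le_exp.2 ?_) (by positivity)
  rw [neg_mul, neg_mul, neg_le_neg_iff]
  refine mul_le_mul_of_nonneg_left ?_ (by positivity)
  rw [Prod.norm_def]
  rcases max_cases ‖(a - b).1‖ ‖(a - b).2‖ with ⟨h, _⟩ | ⟨h, _⟩ <;> rw [h] <;>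
    simp only [Real.norm_eq_abs, sq_abs, Prod.fst_sub, Prod.snd_sub]
  · nlinarith [sq_nonneg (a.2 - b.2)]
  · nlinarith [sq_nonneg (a.1 - b.1)]

theorem exists_norm_gs_le (k : ℕ) :
    ∃ K : ℝ, 0 < K ∧ ∀ (z : ℝ × ℝ) (x : ℝ), ‖gs z x‖ ≤ K * (br (x - z.1) ^ k)⁻¹ := by
  obtain ⟨K, hK0, hK⟩ := exists_poly_mul_gauss_le' Real.pi_pos k
  refine ⟨2 * K, by positivity, fun z x => ?_⟩
  rw [← div_eq_mul_inv, le_div_iff₀ (pow_pos (br_pos _) k)]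
  calc ‖gs z x‖ * br (x - z.1) ^ k ≤ (2 * rexp (-π * (x - z.1) ^ 2)) * br (x - z.1) ^ k :=
        mul_le_mul_of_nonneg_right (norm_gs_le z x) (pow_pos (br_pos _) k).le
    _ = 2 * ((1 + |x - z.1|) ^ k * rexp (-π * (x - z.1) ^ 2)) := by rw [br_real]; ring
    _ ≤ 2 * K := by gcongr; exact hK _

/-! ### Fourier integrals with a Gaussian weight in two variables -/

theorem integrable_bounded_mul_gauss {b : ℝ} (hb : 0 < b) {c : ℝ × ℝ → ℝ} (hc : Continuous c) {A : ℝ}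
    {N : ℕ} (hA : ∀ ζ, |c ζ| ≤ A * br ζ ^ N) :
    Integrable (fun ζ : ℝ × ℝ => c ζ * (rexp (-b * ζ.1 ^ 2) * rexp (-b * ζ.2 ^ 2))) := by
  have hA0 : 0 ≤ A := by
    have := (abs_nonneg _).trans (hA 0); simpa [br] using this
  obtain ⟨K, hK0, hK⟩ := exists_poly_mul_gauss_le' (half_pos hb) N
  have hi := (integrable_exp_neg_mul_sq (half_pos hb)).mul_prod (integrable_exp_neg_mul_sq (half_pos hb))
  refine (hi.const_mul (A * K * K)).mono' (by fun_prop) (ae_of_all _ fun ζ => ?_)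
  rw [norm_mul, Real.norm_eq_abs, Real.norm_of_nonneg (by positivity)]
  have e : ∀ t : ℝ, rexp (-b * t ^ 2) = rexp (-(b / 2) * t ^ 2) * rexp (-(b / 2) * t ^ 2) := fun t => by
    rw [← Real.exp_add]; congr 1; ring
  calc |c ζ| * (rexp (-b * ζ.1 ^ 2) * rexp (-b * ζ.2 ^ 2))
      ≤ (A * (br ζ.1 * br ζ.2) ^ N) * (rexp (-b * ζ.1 ^ 2) * rexp (-b * ζ.2 ^ 2)) := by
        gcongr
        refine (hA ζ).trans ?_
        gcongr
        · exact (br_pos _).le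
        · exact br_le_mul_br ζ
    _ = A * ((1 + |ζ.1|) ^ N * rexp (-(b / 2) * ζ.1 ^ 2)) * ((1 + |ζ.2|) ^ N * rexp (-(b / 2) * ζ.2 ^ 2)) *
        (rexp (-(b / 2) * ζ.1 ^ 2) * rexp (-(b / 2) * ζ.2 ^ 2)) := by
        rw [e ζ.1, e ζ.2, mul_pow, br_real, br_real]; ring
    _ ≤ A * K * K * (rexp (-(b / 2) * ζ.1 ^ 2) * rexp (-(b / 2) * ζ.2 ^ 2)) := by
        gcongr
        · exact hK _
        · exact hK _

/-- Integration by parts in the first variable only, with the second as a parameter; half of the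
Gaussian in the second variable absorbs the growth there. -/
theorem exists_gauss_fourier_two_le_aux {b : ℝ} (hb : 0 < b) (k N : ℕ) :
    ∃ K : ℝ, 0 < K ∧ ∀ (c : ℝ × ℝ → ℝ) (A : ℝ), ContDiff ℝ ∞ c →
      (∀ j ≤ k, ∀ ζ, ‖iteratedFDeriv ℝ j c ζ‖ ≤ A * br ζ ^ N) → ∀ κ : ℝ × ℝ,
      ‖∫ ζ : ℝ × ℝ, ((c ζ * (rexp (-b * ζ.1 ^ 2) * rexp (-b * ζ.2 ^ 2)) : ℝ) : ℂ) *
        (cis (-(2 * π * (ζ.1 * κ.1))) * cis (-(2 * π * (ζ.2 * κ.2))))‖ ≤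
        K * A * (br κ.1 ^ k)⁻¹ := by
  obtain ⟨K, hK0, hK⟩ := exists_gauss_fourier_le hb k N
  obtain ⟨K2, hK20, hK2⟩ := exists_poly_mul_gauss_le' (half_pos hb) N
  set I : ℝ := ∫ t : ℝ, rexp (-(b / 2) * t ^ 2) with hI
  have hI0 : 0 ≤ I := integral_nonneg fun t => (Real.exp_pos _).le
  refine ⟨K * K2 * (I + 1), by positivity, fun c A hc hA κ => ?_⟩
  have hA0 : 0 ≤ A := by
    have := (norm_nonneg _).trans (hA 0 (Nat.zero_le _) 0); simpa [br] using this
  have hint : Integrable (fun ζ : ℝ × ℝ => ((c ζ * (rexp (-b * ζ.1 ^ 2) * rexp (-b * ζ.2 ^ 2)) : ℝ) : ℂ) *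
      (cis (-(2 * π * (ζ.1 * κ.1))) * cis (-(2 * π * (ζ.2 * κ.2))))) := by
    refine Integrable.mul_bdd (c := 1) ?_ ?_ (ae_of_all _ fun ζ => by simp)
    · exact (integrable_bounded_mul_gauss hb hc.continuous (fun ζ => by
        simpa using hA 0 (Nat.zero_le _) ζ)).ofReal
    · exact (by fun_prop : Continuous fun ζ : ℝ × ℝ =>
        cis (-(2 * π * (ζ.1 * κ.1))) * cis (-(2 * π * (ζ.2 * κ.2)))).aestronglyMeasurable
  rw [Measure.volume_eq_prod] at hint ⊢
  rw [integral_prod_symm _ hint]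
  have key : ∀ y : ℝ, ‖∫ x : ℝ, ((c (x, y) * (rexp (-b * x ^ 2) * rexp (-b * y ^ 2)) : ℝ) : ℂ) *
      (cis (-(2 * π * (x * κ.1))) * cis (-(2 * π * (y * κ.2))))‖ ≤
      K * (A * K2 * rexp (-(b / 2) * y ^ 2)) * (br κ.1 ^ k)⁻¹ := by
    intro y
    have e1 : ∀ x : ℝ, ((c (x, y) * (rexp (-b * x ^ 2) * rexp (-b * y ^ 2)) : ℝ) : ℂ) *
      (cis (-(2 * π * (x * κ.1))) * cis (-(2 * π * (y * κ.2)))) =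
      ((rexp (-b * y ^ 2) : ℂ) * cis (-(2 * π * (y * κ.2)))) *
        (((c (x, y) * rexp (-b * x ^ 2) : ℝ) : ℂ) * cis (-(2 * π * (x * κ.1)))) := by
      intro x; push_cast; ring
    simp_rw [e1]
    rw [integral_const_mul, norm_mul, norm_mul, norm_cis, mul_one,
      Complex.norm_real, Real.norm_of_nonneg (Real.exp_pos _).le]
    have hq : ContDiff ℝ ∞ (fun x : ℝ => c (x, y)) := hc.comp (contDiff_id.prodMk contDiff_const)
    have := hK (fun x => c (x, y)) (A * (1 + |y|) ^ N) hq (fun j hj t => ?_) κ.1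
    · calc _ ≤ rexp (-b * y ^ 2) * (K * (A * (1 + |y|) ^ N) * ((1 + |κ.1|) ^ k)⁻¹) := by gcongr
        _ = K * (A * ((1 + |y|) ^ N * rexp (-(b / 2) * y ^ 2)) * rexp (-(b / 2) * y ^ 2)) *
            (br κ.1 ^ k)⁻¹ := by
          rw [show -b * y ^ 2 = -(b / 2) * y ^ 2 + -(b / 2) * y ^ 2 by ring, Real.exp_add, br_real]
          ring
        _ ≤ _ := by
          gcongr
          · exact (inv_br_pow_pos _ _).le
          · exact hK2 y
    · have h1 := norm_iteratedFDeriv_comp_add_clm_le hc (ContinuousLinearMap.inl ℝ ℝ ℝ) (0, y) j t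
      simp only [ContinuousLinearMap.inl_apply, Prod.mk_add_mk, zero_add, add_zero] at h1
      refine h1.trans ?_
      calc _ ≤ (A * br (t, y) ^ N) * 1 := by
            gcongr
            · have := br_pos (t, y); positivity
            · exact hA j hj _
            · exact pow_le_one₀ (norm_nonneg _) (ContinuousLinearMap.norm_inl_le_one ℝ ℝ ℝ)
        _ ≤ A * (1 + |y|) ^ N * (1 + |t|) ^ N := by
            rw [mul_one, mul_assoc, ← mul_pow]
            gcongr
            · exact (br_pos _).le
            · rw [mul_comm]; exact br_le_mul_br (t, y)
  refine (norm_integral_le_integral_norm _).trans ?_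
  calc _ ≤ ∫ y : ℝ, K * (A * K2 * rexp (-(b / 2) * y ^ 2)) * (br κ.1 ^ k)⁻¹ := by
        refine integral_mono_of_nonneg (ae_of_all _ fun _ => norm_nonneg _) ?_ (ae_of_all _ key)
        exact (((integrable_exp_neg_mul_sq (half_pos hb)).const_mul _).const_mul _).mul_const _
    _ = K * K2 * I * A * (br κ.1 ^ k)⁻¹ := by
        rw [integral_mul_const, integral_const_mul, integral_const_mul, ← hI]; ring
    _ ≤ _ := by
        gcongr
        · exact (inv_br_pow_pos _ _).le
        · linarith

theorem exists_gauss_fourier_two_le {b : ℝ} (hb : 0 < b) (k N : ℕ) :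
    ∃ K : ℝ, 0 < K ∧ ∀ (c : ℝ × ℝ → ℝ) (A : ℝ), ContDiff ℝ ∞ c →
      (∀ j ≤ k, ∀ ζ, ‖iteratedFDeriv ℝ j c ζ‖ ≤ A * br ζ ^ N) → ∀ κ : ℝ × ℝ,
      ‖∫ ζ : ℝ × ℝ, ((c ζ * (rexp (-b * ζ.1 ^ 2) * rexp (-b * ζ.2 ^ 2)) : ℝ) : ℂ) *
        (cis (-(2 * π * (ζ.1 * κ.1))) * cis (-(2 * π * (ζ.2 * κ.2))))‖ ≤
        K * A * (br κ ^ k)⁻¹ := by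
  obtain ⟨K, hK0, hK⟩ := exists_gauss_fourier_two_le_aux hb k N
  refine ⟨K, hK0, fun c A hc hA κ => ?_⟩
  -- In the sup norm `br κ` is the bracket of the larger coordinate, and swapping the variables
  -- makes that coordinate the first.
  rcases le_total ‖κ.2‖ ‖κ.1‖ with h | h
  · have e : br κ = br κ.1 := by rw [br, br, Prod.norm_def, max_eq_left h]
    rw [e]; exact hK c A hc hA κ
  · have e : br κ = br κ.2 := by rw [br, br, Prod.norm_def, max_eq_right h]
    have hs := hK (fun ζ => c ζ.swap) A (hc.comp (contDiff_snd.prodMk contDiff_fst)) (fun j hj ζ => ?_)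
      κ.swap
    · rw [e]
      rw [Measure.volume_eq_prod] at hs ⊢
      rw [← integral_prod_swap]
      refine le_trans (le_of_eq ?_) hs
      congr 2
      ext ζ
      simp only [Prod.fst_swap, Prod.snd_swap]
      rw [mul_comm (rexp _) (rexp _), mul_comm (cis _) (cis _)]
    · have h1 := norm_iteratedFDeriv_comp_add_clm_le hc
        ((ContinuousLinearEquiv.prodComm ℝ ℝ ℝ : (ℝ × ℝ) ≃L[ℝ] ℝ × ℝ) : (ℝ × ℝ) →L[ℝ] ℝ × ℝ) 0 j ζ
      simp only [zero_add] at h1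
      refine h1.trans ?_
      have h2 : ‖((ContinuousLinearEquiv.prodComm ℝ ℝ ℝ : (ℝ × ℝ) ≃L[ℝ] ℝ × ℝ) :
          (ℝ × ℝ) →L[ℝ] ℝ × ℝ)‖ ≤ 1 :=
        ContinuousLinearMap.opNorm_le_bound _ zero_le_one fun x => by
          simp [Prod.norm_def, max_comm]
      calc _ ≤ (A * br ζ.swap ^ N) * 1 := by
            gcongr
            · have := br_pos ζ.swap
              have := (norm_nonneg _).trans (hA 0 (Nat.zero_le _) 0)
              have : 0 ≤ A := by simpa [br] using this
              positivity
            · exact hA j hj _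
            · exact pow_le_one₀ (norm_nonneg _) h2
        _ = A * br ζ ^ N := by
            rw [mul_one]; congr 2
            simp [br, Prod.norm_def, max_comm]

/-! ### Matrix elements of Weyl operators between coherent states -/

/-- The matrix element `(Op(c) g_z | g_w)` of the Weyl quantization of `c`, with `2πh = 1`. -/
def wm (c : ℝ × ℝ → ℝ) (z w : ℝ × ℝ) : ℂ :=
  2 * ∫ ζ : ℝ × ℝ, (c ζ : ℂ) * (cis (2 * π * (z.2 * ζ.1 - z.1 * ζ.2)) * gram ((2 : ℝ) • ζ - z) w)

/-- Tempered weights on phase space. -/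
structure IsWeight (C : ℝ) (N : ℕ) (𝔴 : ℝ × ℝ → ℝ) : Prop where
  nonneg : ∀ z, 0 ≤ 𝔴 z
  le : ∀ z w, 𝔴 z ≤ C * br (z - w) ^ N * 𝔴 w

/-- Smooth functions all of whose derivatives are bounded by the weight `𝔴`. -/
structure HasSymbolBounds (B : ℕ → ℝ) (𝔴 c : ℝ × ℝ → ℝ) : Prop where
  smooth : ContDiff ℝ ∞ c
  bound : ∀ k z, ‖iteratedFDeriv ℝ k c z‖ ≤ B k * 𝔴 z

/-- In `ζ` the Gaussian is centred at the midpoint of `z` and `w`. After this shift the matrix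
element is a Gaussian Fourier integral of the symbol near the midpoint, at a frequency which is `z -
w` turned by a right angle; decay in `z - w` comes from derivatives of `c`. -/
theorem wm_eq (c : ℝ × ℝ → ℝ) (z w : ℝ × ℝ) :
    wm c z w = 2 * (cis (π * (z.2 * w.1 - z.1 * w.2)) * ∫ ζ : ℝ × ℝ,
      ((c ((1 / 2 : ℝ) • (z + w) + ζ) *
        (rexp (-(2 * π) * ζ.1 ^ 2) * rexp (-(2 * π) * ζ.2 ^ 2)) : ℝ) : ℂ) *
        (cis (-(2 * π * (ζ.1 * (w.2 - z.2)))) * cis (-(2 * π * (ζ.2 * (z.1 - w.1)))))) := by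
  rw [wm, ← integral_add_left_eq_self _ ((1 / 2 : ℝ) • (z + w)), ← integral_const_mul (cis _)]
  congr 2; ext ζ
  simp only [gram, Prod.smul_fst, Prod.smul_snd, Prod.fst_add, Prod.snd_add, Prod.fst_sub,
    Prod.snd_sub, smul_eq_mul]
  have h1 : cis (2 * π * (z.2 * (1 / 2 * (z.1 + w.1) + ζ.1) - z.1 * (1 / 2 * (z.2 + w.2) + ζ.2))) *
      cis (π * ((2 * (1 / 2 * (z.2 + w.2) + ζ.2) - z.2) * w.1 -
        (2 * (1 / 2 * (z.1 + w.1) + ζ.1) - z.1) * w.2)) =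
      cis (π * (z.2 * w.1 - z.1 * w.2)) *
      (cis (-(2 * π * (ζ.1 * (w.2 - z.2)))) * cis (-(2 * π * (ζ.2 * (z.1 - w.1))))) := by
    rw [← cis_add, ← cis_add, ← cis_add]; congr 1; ring
  have h2 : rexp (-(π / 2) * ((2 * (1 / 2 * (z.1 + w.1) + ζ.1) - z.1 - w.1) ^ 2 +
      (2 * (1 / 2 * (z.2 + w.2) + ζ.2) - z.2 - w.2) ^ 2)) =
      rexp (-(2 * π) * ζ.1 ^ 2) * rexp (-(2 * π) * ζ.2 ^ 2) := by
    rw [← Real.exp_add]; congr 1; ring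
  rw [mul_left_comm (cis _) (_ : ℂ) (cis _), h1, h2]
  push_cast
  ring

theorem conj_wm (c : ℝ × ℝ → ℝ) (z w : ℝ × ℝ) : conj (wm c z w) = wm c w z := by
  rw [wm_eq, wm_eq, map_mul, map_mul, conj_cis, ← integral_conj, add_comm w z]
  simp only [map_ofNat]
  congr 2
  · congr 1; ring
  · congr 1; ext ζ
    simp only [map_mul, Complex.conj_ofReal, conj_cis]
    congr 3 <;> ring

theorem wm_one : wm (fun _ => 1) = gram := by
  ext z w
  rw [wm_eq]
  have e : ∀ ζ : ℝ × ℝ, ((1 * (rexp (-(2 * π) * ζ.1 ^ 2) * rexp (-(2 * π) * ζ.2 ^ 2)) : ℝ) : ℂ) *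
        (cis (-(2 * π * (ζ.1 * (w.2 - z.2)))) * cis (-(2 * π * (ζ.2 * (z.1 - w.1))))) =
      ((rexp (-(2 * π) * ζ.1 ^ 2) : ℂ) * cis (2 * π * ((z.2 - w.2) * ζ.1))) *
      ((rexp (-(2 * π) * ζ.2 ^ 2) : ℂ) * cis (2 * π * ((w.1 - z.1) * ζ.2))) := by
    intro ζ
    rw [show -(2 * π * (ζ.1 * (w.2 - z.2))) = 2 * π * ((z.2 - w.2) * ζ.1) by ring,
      show -(2 * π * (ζ.2 * (z.1 - w.1))) = 2 * π * ((w.1 - z.1) * ζ.2) by ring]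
    push_cast; ring
  simp_rw [e]
  rw [Measure.volume_eq_prod, integral_prod_mul
    (f := fun t : ℝ => (rexp (-(2 * π) * t ^ 2) : ℂ) * cis (2 * π * ((z.2 - w.2) * t)))
    (g := fun t : ℝ => (rexp (-(2 * π) * t ^ 2) : ℂ) * cis (2 * π * ((w.1 - z.1) * t))),
    integral_gauss_cis, integral_gauss_cis, gram]
  have h2 : ((√2 : ℝ) : ℂ)⁻¹ * ((√2 : ℝ) : ℂ)⁻¹ * 2 = 1 := by
    rw [← mul_inv, ← Complex.ofReal_mul, Real.mul_self_sqrt (by norm_num)]; norm_num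
  rw [mul_add, Real.exp_add, show (w.1 - z.1) ^ 2 = (z.1 - w.1) ^ 2 by ring]
  push_cast
  linear_combination (Complex.exp (-(↑π / 2) * (↑z.1 - ↑w.1) ^ 2) *
    cis (π * (z.2 * w.1 - z.1 * w.2)) * Complex.exp (-(↑π / 2) * (↑z.2 - ↑w.2) ^ 2)) * h2

theorem HasSymbolBounds.norm_le {B : ℕ → ℝ} {𝔴 c : ℝ × ℝ → ℝ} (h : HasSymbolBounds B 𝔴 c)
    (z : ℝ × ℝ) : |c z| ≤ B 0 * 𝔴 z := by simpa using h.bound 0 z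

/-- Off-diagonal decay of the matrix elements, with constants that only depend on the constants of
the weight and of the symbol. -/
theorem exists_norm_wm_le (C : ℝ) (N : ℕ) (B : ℕ → ℝ) (k : ℕ) :
    ∃ K : ℝ, 0 < K ∧ ∀ 𝔴 c, IsWeight C N 𝔴 → HasSymbolBounds B 𝔴 c → ∀ z w,
      ‖wm c z w‖ ≤ K * 𝔴 z * (br (z - w) ^ k)⁻¹ := by
  -- `N` extra derivatives pay for moving the weight from the midpoint to `z`. The last argument `N`
  -- is the growth of the weight in `ζ`, which the Gaussian absorbs.
  obtain ⟨K, hK0, hK⟩ := exists_gauss_fourier_two_le (b := 2 * π) (by positivity) (k + N) N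
  set Bs : ℝ := ∑ j ∈ Finset.range (k + N + 1), |B j| with hBs
  have hBs0 : 0 ≤ Bs := Finset.sum_nonneg fun _ _ => abs_nonneg _
  refine ⟨2 * K * Bs * |C| * |C| + 1, by positivity, fun 𝔴 c hw hc z w => ?_⟩
  set m : ℝ × ℝ := (1 / 2 : ℝ) • (z + w) with hm
  have hwm := hw.nonneg m
  have hwz := hw.nonneg z
  have hlin := hK (fun ζ => c (m + ζ)) (Bs * (|C| * 𝔴 m))
    (hc.smooth.comp (contDiff_const.add contDiff_id)) (fun j hj ζ => ?_) (w.2 - z.2, z.1 - w.1)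
  · have hbr : br ((w.2 - z.2, z.1 - w.1) : ℝ × ℝ) = br (z - w) := by
      simp only [br, Prod.norm_def, Prod.fst_sub, Prod.snd_sub, max_comm, norm_sub_rev]
    rw [hbr] at hlin
    rw [wm_eq, norm_mul, norm_mul, norm_cis, one_mul, ← hm]
    have hp := br_pos (z - w)
    have hmz : 𝔴 m ≤ |C| * br (z - w) ^ N * 𝔴 z := by
      have h1 : br (m - z) ≤ br (z - w) := by
        have : m - z = (1 / 2 : ℝ) • (w - z) := by
          rw [hm]; ext <;> simp <;> ring
        rw [this, br, br, norm_smul, norm_sub_rev]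
        norm_num
        linarith [norm_nonneg (z - w)]
      have hp' := br_pos (m - z)
      calc _ ≤ C * br (m - z) ^ N * 𝔴 z := hw.le m z
        _ ≤ |C| * br (z - w) ^ N * 𝔴 z := by
          gcongr
          exact le_abs_self C
    calc _ ≤ ‖(2 : ℂ)‖ * (K * (Bs * (|C| * 𝔴 m)) * (br (z - w) ^ (k + N))⁻¹) := by
          gcongr
      _ ≤ ‖(2 : ℂ)‖ * (K * (Bs * (|C| * (|C| * br (z - w) ^ N * 𝔴 z))) *
            (br (z - w) ^ (k + N))⁻¹) := by gcongr
      _ = 2 * K * Bs * |C| * |C| * 𝔴 z * (br (z - w) ^ k)⁻¹ := by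
          rw [pow_add]
          simp only [Complex.norm_ofNat]
          field_simp
      _ ≤ _ := by
          gcongr
          linarith
  · rw [iteratedFDeriv_comp_add_left]
    have hp := br_pos ζ
    have h1 : B j ≤ Bs := (le_abs_self _).trans
      (Finset.single_le_sum (f := fun j => |B j|) (fun _ _ => abs_nonneg _)
        (Finset.mem_range.2 (by omega)))
    have h2 : 𝔴 (m + ζ) ≤ |C| * br ζ ^ N * 𝔴 m := by
      have := hw.le (m + ζ) m
      rw [add_sub_cancel_left] at this
      refine this.trans ?_
      gcongr
      exact le_abs_self C
    calc _ ≤ B j * 𝔴 (m + ζ) := hc.bound j _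
      _ ≤ Bs * (|C| * br ζ ^ N * 𝔴 m) :=
          mul_le_mul h1 h2 (hw.nonneg _) hBs0
      _ = _ := by ring

theorem integrable_wm_integrand {c : ℝ × ℝ → ℝ} (hc : Continuous c) {A : ℝ} {N : ℕ}
    (hA : ∀ ζ, |c ζ| ≤ A * br ζ ^ N) (z w w' : ℝ × ℝ) :
    Integrable (fun q : (ℝ × ℝ) × (ℝ × ℝ) => (c q.2 : ℂ) *
      (cis (2 * π * (z.2 * q.2.1 - z.1 * q.2.2)) * gram ((2 : ℝ) • q.2 - z) q.1) * gram q.1 w') ∧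
    Integrable (fun ζ : ℝ × ℝ => (c ζ : ℂ) *
      (cis (2 * π * (z.2 * ζ.1 - z.1 * ζ.2)) * gram ((2 : ℝ) • ζ - z) w)) := by
  have hA0 : 0 ≤ A := by
    have := (abs_nonneg _).trans (hA 0); simpa [br] using this
  -- `N` powers absorb the growth of `c` and three give integrability in `ζ`. The price is a growth
  -- of order `N + 3` in the second argument, met by the exponent `N + 6` when that variable is
  -- integrated as well.
  obtain ⟨K, hK0, hK⟩ := exists_norm_gram_le (N + 3)
  obtain ⟨K', hK0', hK'⟩ := exists_norm_gram_le (N + 6)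
  have hz := br_pos z
  have hbd : ∀ ζ v : ℝ × ℝ, ‖(c ζ : ℂ) *
      (cis (2 * π * (z.2 * ζ.1 - z.1 * ζ.2)) * gram ((2 : ℝ) • ζ - z) v)‖ ≤
      A * K * br z ^ (N + 3) * (br ζ ^ 3)⁻¹ * br v ^ (N + 3) := by
    intro ζ v
    have hζ := br_pos ζ
    have hv := br_pos v
    rw [norm_mul, norm_mul, norm_cis, one_mul, Complex.norm_real, Real.norm_eq_abs]
    have h1 : ‖gram ((2 : ℝ) • ζ - z) v‖ ≤ K * ((br z * br v) ^ (N + 3) * (br ζ ^ (N + 3))⁻¹) := by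
      refine (hK _ _).trans ?_
      gcongr
      have h3 : br ζ ≤ br (z + v) * br ((2 : ℝ) • ζ - z - v) := by
        have h4 : br ζ ≤ br ((2 : ℝ) • ζ) := by
          simp only [br, norm_smul]; norm_num; linarith [norm_nonneg ζ]
        refine h4.trans ?_
        have := br_le_mul ((2 : ℝ) • ζ) (z + v)
        rwa [← sub_sub] at this
      have h5 : br (z + v) ≤ br z * br v := by
        have := br_le_mul (z + v) z
        rwa [add_sub_cancel_left] at this
      have hd := br_pos ((2 : ℝ) • ζ - z - v)
      rw [← div_eq_mul_inv, le_div_iff₀ (by positivity), inv_mul_le_iff₀ (by positivity), ← mul_pow]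
      gcongr
      calc br ζ ≤ br (z + v) * br ((2 : ℝ) • ζ - z - v) := h3
        _ ≤ (br z * br v) * br ((2 : ℝ) • ζ - z - v) := by gcongr
        _ = _ := mul_comm _ _
    calc _ ≤ (A * br ζ ^ N) * (K * ((br z * br v) ^ (N + 3) * (br ζ ^ (N + 3))⁻¹)) := by
          gcongr; exact hA ζ
      _ = _ := by
          rw [mul_pow, pow_add (br ζ)]; field_simp
  constructor
  · have hi := (integrable_inv_br_pow (k := 3) le_rfl).mul_prod
      (integrable_inv_br_pow (k := 3) le_rfl)
    have hcont : Continuous (fun q : (ℝ × ℝ) × (ℝ × ℝ) => (c q.2 : ℂ) *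
      (cis (2 * π * (z.2 * q.2.1 - z.1 * q.2.2)) * gram ((2 : ℝ) • q.2 - z) q.1) * gram q.1 w') := by
      fun_prop
    refine (hi.const_mul (A * K * br z ^ (N + 3) * K' * br w' ^ (N + 6))).mono'
      hcont.aestronglyMeasurable (ae_of_all _ fun q => ?_)
    rw [norm_mul]
    have h1 := br_pos q.1
    have h2 := br_pos q.2
    have h3 := br_pos w'
    have h4 := inv_br_le q.1 (q.1 - w') (N + 6)
    rw [sub_sub_cancel] at h4
    calc _ ≤ (A * K * br z ^ (N + 3) * (br q.2 ^ 3)⁻¹ * br q.1 ^ (N + 3)) *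
          (K' * (br w' ^ (N + 6) * (br q.1 ^ (N + 6))⁻¹)) := by
          gcongr
          · exact hbd _ _
          · exact (hK' _ _).trans (by gcongr)
      _ = _ := by
          rw [show N + 6 = (N + 3) + 3 by ring, pow_add (br q.1) (N + 3) 3]; field_simp
  · have hcont : Continuous (fun ζ : ℝ × ℝ => (c ζ : ℂ) *
      (cis (2 * π * (z.2 * ζ.1 - z.1 * ζ.2)) * gram ((2 : ℝ) • ζ - z) w)) := by
      fun_prop
    refine ((integrable_inv_br_pow (k := 3) le_rfl).const_mul
      (A * K * br z ^ (N + 3) * br w ^ (N + 3))).mono'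
      hcont.aestronglyMeasurable (ae_of_all _ fun ζ => (hbd ζ w).trans_eq (by ring))

theorem integral_gram_mul_gram (a b : ℝ × ℝ) : ∫ w, gram a w * gram w b = gram a b := by
  have h := integral_bt_mul_conj_bt (memLp_gs a) (memLp_gs b)
  simp_rw [bt_gs, conj_gram] at h
  rw [h, integral_gs_mul_conj_gs]

/-- In its second argument `wm c z` is a superposition of functions `gram b`, each of which is
reproduced by `gram`. -/
theorem integral_wm_mul_gram {c : ℝ × ℝ → ℝ} (hc : Continuous c) {A : ℝ} {N : ℕ}
    (hA : ∀ ζ, |c ζ| ≤ A * br ζ ^ N) (z w' : ℝ × ℝ) :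
    ∫ w, wm c z w * gram w w' = wm c z w' := by
  have hi := (integrable_wm_integrand hc hA z 0 w').1
  simp only [wm, mul_assoc, ← integral_mul_const, integral_const_mul]
  congr 1
  rw [Measure.volume_eq_prod] at hi
  have hs := integral_integral_swap (f := fun w ζ : ℝ × ℝ => (c ζ : ℂ) *
      (cis (2 * π * (z.2 * ζ.1 - z.1 * ζ.2)) * gram ((2 : ℝ) • ζ - z) w) * gram w w') hi
  simp only [mul_assoc] at hs
  rw [hs]
  simp_rw [integral_const_mul, integral_gram_mul_gram]

theorem stronglyMeasurable_wm {c : ℝ × ℝ → ℝ} (hc : Continuous c) :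
    StronglyMeasurable (fun q : (ℝ × ℝ) × (ℝ × ℝ) => wm c q.1 q.2) := by
  unfold wm
  refine StronglyMeasurable.const_mul ?_ _
  refine StronglyMeasurable.integral_prod_right' (f := fun r : ((ℝ × ℝ) × (ℝ × ℝ)) × (ℝ × ℝ) =>
    (c r.2 : ℂ) * (cis (2 * π * (r.1.1.2 * r.2.1 - r.1.1.1 * r.2.2)) *
      gram ((2 : ℝ) • r.2 - r.1.1) r.1.2)) ?_
  exact (by fun_prop : Continuous fun r : ((ℝ × ℝ) × (ℝ × ℝ)) × (ℝ × ℝ) =>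
    (c r.2 : ℂ) * (cis (2 * π * (r.1.1.2 * r.2.1 - r.1.1.1 * r.2.2)) *
      gram ((2 : ℝ) • r.2 - r.1.1) r.1.2)).stronglyMeasurable

theorem wm_sub {c d : ℝ × ℝ → ℝ} (hc : Continuous c) (hd : Continuous d) {A A' : ℝ} {N N' : ℕ}
    (hA : ∀ ζ, |c ζ| ≤ A * br ζ ^ N) (hA' : ∀ ζ, |d ζ| ≤ A' * br ζ ^ N') (z w : ℝ × ℝ) :
    wm (fun ζ => c ζ - d ζ) z w = wm c z w - wm d z w := by
  rw [wm, wm, wm, ← mul_sub, ← integral_sub (integrable_wm_integrand hc hA z w 0).2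
    (integrable_wm_integrand hd hA' z w 0).2]
  congr 2; ext ζ; push_cast; ring

theorem wm_const_mul (a : ℝ) (c : ℝ × ℝ → ℝ) (z w : ℝ × ℝ) :
    wm (fun ζ => a * c ζ) z w = a * wm c z w := by
  rw [wm, wm, mul_left_comm, ← integral_const_mul (a : ℂ)]
  congr 2; ext ζ; push_cast; ring

/-! ### Covariance under the quarter turn of phase space. -/

/-- The rotation `(x, ξ) ↦ (ξ, -x)` of phase space. -/
def rot (z : ℝ × ℝ) : ℝ × ℝ := (z.2, -z.1)

theorem measurePreserving_rot : MeasurePreserving rot := by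
  have h1 : MeasurePreserving (Prod.swap : ℝ × ℝ → ℝ × ℝ) := Measure.measurePreserving_swap
  have h2 : MeasurePreserving (Prod.map id Neg.neg : ℝ × ℝ → ℝ × ℝ) :=
    (MeasurePreserving.id (volume : Measure ℝ)).prod (Measure.measurePreserving_neg volume)
  exact h2.comp h1

theorem measurableEmbedding_rot : MeasurableEmbedding rot := by
  refine (Topology.IsClosedEmbedding.measurableEmbedding ?_)
  refine Topology.IsClosedEmbedding.of_continuous_injective_isClosedMap (by unfold rot; fun_prop) ?_ ?_
  · intro z w h
    simp only [rot, Prod.mk.injEq, neg_inj] at h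
    exact Prod.ext h.2 h.1
  · let e : (ℝ × ℝ) ≃ₜ (ℝ × ℝ) :=
      ⟨⟨rot, fun z => (-z.2, z.1), fun z => by simp [rot], fun z => by simp [rot]⟩,
        by unfold rot; fun_prop, by fun_prop⟩
    exact e.isClosedMap

theorem gram_rot (a b : ℝ × ℝ) : gram (rot a) (rot b) = gram a b := by
  simp only [gram, rot]
  congr 3 <;> ring

/-- The quarter turn preserves Lebesgue measure, the symplectic form and `gram`, and these are all
that enters the formula for `wm`. This gives the covariance of Weyl quantization under the Fourier
transform. -/
theorem wm_rot (c : ℝ × ℝ → ℝ) (z w : ℝ × ℝ) :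
    wm (fourierSymbol c) (rot z) (rot w) = wm c z w := by
  rw [wm, wm, ← measurePreserving_rot.integral_comp measurableEmbedding_rot]
  congr 2; ext ζ
  have h1 : (2 : ℝ) • rot ζ - rot z = rot ((2 : ℝ) • ζ - z) := by
    simp only [rot]; ext <;> simp; ring
  rw [h1, gram_rot]
  simp only [rot, fourierSymbol, neg_neg]
  congr 3; ring

/-! ### Weyl operators on coherent states -/

/-- The Weyl quantization for `2πh = 1`. -/
def nW (c : ℝ × ℝ → ℝ) (f : ℝ → ℂ) (x : ℝ) : ℂ :=
  ∫ η : ℝ, ∫ y : ℝ, cis (2 * π * ((x - y) * η)) * c ((x + y) / 2, η) * f y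

/-- Smooth functions all of whose derivatives are `O((1 + ‖z‖) ^ N)`. -/
def IsTemperate (N : ℕ) (p : ℝ × ℝ → ℝ) : Prop :=
  ∃ B : ℕ → ℝ, HasSymbolBounds B (fun z => br z ^ N) p

theorem isWeight_br_pow (N : ℕ) : IsWeight 1 N (fun z => br z ^ N) where
  nonneg z := (pow_pos (br_pos z) N).le
  le z w := by
    rw [one_mul, mul_comm, ← mul_pow]
    exact pow_le_pow_left₀ (br_pos z).le (br_le_mul z w) N

theorem IsTemperate.continuous {N : ℕ} {p : ℝ × ℝ → ℝ} (hp : IsTemperate N p) : Continuous p :=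
  hp.choose_spec.smooth.continuous

theorem IsTemperate.exists_le {N : ℕ} {p : ℝ × ℝ → ℝ} (hp : IsTemperate N p) :
    ∃ A : ℝ, 0 ≤ A ∧ ∀ ζ, |p ζ| ≤ A * br ζ ^ N := by
  obtain ⟨B, hB⟩ := hp
  refine ⟨B 0, ?_, hB.norm_le⟩
  have := (abs_nonneg _).trans (hB.norm_le 0); simpa [br] using this

/-- The `y`-integral is a Fourier integral with Gaussian weight at frequency `η - z.2`. Of its `N +
2` powers of decay, `N` compensate the growth of the symbol in `η` and two make the outer integral
converge. -/
theorem exists_norm_inner_integral_gs_le {N : ℕ} {p : ℝ × ℝ → ℝ} (hp : IsTemperate N p) :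
    ∃ (K : ℝ) (M : ℕ), 0 < K ∧ ∀ (z : ℝ × ℝ) (x η : ℝ),
      ‖∫ y : ℝ, cis (2 * π * ((x - y) * η)) * p ((x + y) / 2, η) * gs z y‖ ≤
        K * br z ^ M * br x ^ N * (br η ^ 2)⁻¹ := by
  obtain ⟨B, hB⟩ := hp
  obtain ⟨K, hK0, hK⟩ := exists_gauss_fourier_le Real.pi_pos (N + 2) N
  set Bs : ℝ := ∑ j ∈ Finset.range (N + 3), |B j| with hBs
  have hBs0 : 0 ≤ Bs := Finset.sum_nonneg fun _ _ => abs_nonneg _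
  refine ⟨2 * (K * Bs) + 1, N + (N + 2), by positivity, fun z x η => ?_⟩
  have hz := br_pos z
  have hx := br_pos x
  have hη := br_pos η
  have e1 : ∀ t : ℝ, cis (2 * π * ((x - (t + z.1)) * η)) * p ((x + (t + z.1)) / 2, η) * gs z (t + z.1) =
      (((2 ^ (1 / 4 : ℝ) : ℝ) : ℂ) * cis (2 * π * ((x - z.1) * η + z.2 * z.1 / 2))) *
      (((p ((x + z.1) / 2 + t / 2, η) * rexp (-π * t ^ 2) : ℝ) : ℂ) *
        cis (-(2 * π * (t * (η - z.2))))) := by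
    intro t
    have h1 : cis (2 * π * ((x - (t + z.1)) * η)) * cis (2 * π * (z.2 * (t + z.1 - z.1 / 2))) =
        cis (2 * π * ((x - z.1) * η + z.2 * z.1 / 2)) * cis (-(2 * π * (t * (η - z.2)))) := by
      rw [← cis_add, ← cis_add]; congr 1; ring
    have h2 : (x + (t + z.1)) / 2 = (x + z.1) / 2 + t / 2 := by ring
    rw [gs, add_sub_cancel_right, h2]
    push_cast
    linear_combination (((2 ^ (1 / 4 : ℝ) : ℝ) : ℂ) * p ((x + z.1) / 2 + t / 2, η) *
      Complex.exp (-π * t ^ 2)) * h1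
  rw [← integral_add_right_eq_self _ z.1]
  simp_rw [e1]
  rw [integral_const_mul, norm_mul, norm_mul, norm_cis, mul_one, Complex.norm_real,
    Real.norm_of_nonneg (by positivity)]
  have h24 : (2 : ℝ) ^ (1 / 4 : ℝ) ≤ 2 := by
    calc (2 : ℝ) ^ (1 / 4 : ℝ) ≤ 2 ^ (1 : ℝ) := by
          apply Real.rpow_le_rpow_of_exponent_le <;> norm_num
      _ = 2 := by simp
  set a : ℝ × ℝ := ((x + z.1) / 2, η)
  let L : ℝ →L[ℝ] ℝ × ℝ := (1 / 2 : ℝ) • ContinuousLinearMap.inl ℝ ℝ ℝ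
  have hL : ∀ t, a + L t = ((x + z.1) / 2 + t / 2, η) := fun t => by
    simp [L, a]; ring
  have hLn : ‖L‖ ≤ 1 := by
    have := ContinuousLinearMap.norm_inl_le_one ℝ ℝ ℝ
    simp only [L, norm_smul]; norm_num; linarith
  have hbr : ∀ t, br (a + L t) ≤ br x * br z * br η * br t := by
    intro t
    rw [hL]
    have h1 : br ((x + z.1) / 2 + t / 2) ≤ br x * br z * br t := by
      have hz1 : |z.1| ≤ ‖z‖ := norm_fst_le z
      have : |(x + z.1) / 2 + t / 2| ≤ |x| + |z.1| + |t| := by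
        rw [abs_le]; constructor <;>
          linarith [le_abs_self x, neg_abs_le x, le_abs_self z.1, neg_abs_le z.1, le_abs_self t,
            neg_abs_le t, abs_nonneg x, abs_nonneg z.1, abs_nonneg t]
      simp only [br, Real.norm_eq_abs]
      have h1 := abs_nonneg x
      have h2 := norm_nonneg z
      have h3 := abs_nonneg t
      nlinarith [mul_nonneg h1 h2, mul_nonneg (mul_nonneg h1 h2) h3, mul_nonneg h1 h3,
        mul_nonneg h2 h3]
    calc _ ≤ br ((x + z.1) / 2 + t / 2) * br η := br_le_mul_br _
      _ ≤ (br x * br z * br t) * br η := by gcongr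
      _ = _ := by ring
  have hq := hK (fun t => p ((x + z.1) / 2 + t / 2, η)) (Bs * (br x * br z * br η) ^ N)
    (hB.smooth.comp (by fun_prop)) (fun j hj t => ?_) (η - z.2)
  · have h5 : ((1 + |η - z.2|) ^ (N + 2))⁻¹ ≤ br z ^ (N + 2) * (br η ^ (N + 2))⁻¹ := by
      have := inv_br_le η (η - z.2) (N + 2)
      rw [sub_sub_cancel] at this
      refine this.trans ?_
      gcongr
      · exact (br_pos _).le
      · exact br_snd_le z
    calc _ ≤ 2 * (K * (Bs * (br x * br z * br η) ^ N) * ((1 + |η - z.2|) ^ (N + 2))⁻¹) := by gcongr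
      _ ≤ 2 * (K * (Bs * (br x * br z * br η) ^ N) * (br z ^ (N + 2) * (br η ^ (N + 2))⁻¹)) := by
        gcongr
      _ = 2 * (K * Bs) * br z ^ (N + (N + 2)) * br x ^ N * (br η ^ 2)⁻¹ := by
        rw [pow_add (br η), mul_pow, mul_pow, pow_add (br z) N (N + 2)]; field_simp
      _ ≤ _ := by
        gcongr; linarith
  · have h1 := norm_iteratedFDeriv_comp_add_clm_le hB.smooth L a j t
    simp only [hL] at h1
    refine h1.trans ?_
    rw [← hL]
    have h1 : B j ≤ Bs := (le_abs_self _).trans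
      (Finset.single_le_sum (f := fun j => |B j|) (fun _ _ => abs_nonneg _)
        (Finset.mem_range.2 (by omega)))
    have h2 := br_pos (a + L t)
    calc _ ≤ (Bs * (br x * br z * br η * br t) ^ N) * 1 := by
          have h3 := br_pos t
          refine mul_le_mul ((hB.bound j _).trans ?_) (pow_le_one₀ (norm_nonneg _) hLn)
            (by positivity) (by positivity)
          exact mul_le_mul h1 (pow_le_pow_left₀ h2.le (hbr t) N) (by positivity) hBs0
      _ = _ := by rw [mul_one, mul_pow _ (br t), br_real t]; ring

theorem stronglyMeasurable_inner_integral {X : Type*} [TopologicalSpace X] [MeasurableSpace X]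
    [OpensMeasurableSpace X] [SecondCountableTopology X]
    {p : ℝ × ℝ → ℝ} (hp : Continuous p) {ψ : X → ℝ → ℂ}
    (hψ : Continuous fun q : X × ℝ => ψ q.1 q.2) :
    StronglyMeasurable (fun q : (X × ℝ) × ℝ =>
      ∫ y : ℝ, cis (2 * π * ((q.1.2 - y) * q.2)) * p ((q.1.2 + y) / 2, q.2) * ψ q.1.1 y) := by
  refine StronglyMeasurable.integral_prod_right' (f := fun r : ((X × ℝ) × ℝ) × ℝ =>
    cis (2 * π * ((r.1.1.2 - r.2) * r.1.2)) * p ((r.1.1.2 + r.2) / 2, r.1.2) * ψ r.1.1.1 r.2) ?_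
  have hψ' : Continuous fun r : ((X × ℝ) × ℝ) × ℝ => ψ r.1.1.1 r.2 :=
    hψ.comp (by fun_prop : Continuous fun r : ((X × ℝ) × ℝ) × ℝ => (r.1.1.1, r.2))
  exact (by fun_prop : Continuous fun r : ((X × ℝ) × ℝ) × ℝ =>
    cis (2 * π * ((r.1.1.2 - r.2) * r.1.2)) * p ((r.1.1.2 + r.2) / 2, r.1.2) *
      ψ r.1.1.1 r.2).stronglyMeasurable

theorem stronglyMeasurable_nW_gs {p : ℝ × ℝ → ℝ} (hp : Continuous p) :
    StronglyMeasurable (fun q : (ℝ × ℝ) × ℝ => nW p (gs q.1) q.2) :=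
  StronglyMeasurable.integral_prod_right'
    (f := fun q : ((ℝ × ℝ) × ℝ) × ℝ =>
      ∫ y : ℝ, cis (2 * π * ((q.1.2 - y) * q.2)) * p ((q.1.2 + y) / 2, q.2) * gs q.1.1 y)
    (stronglyMeasurable_inner_integral hp continuous_gs)

theorem integrable_inner_integral_gs {N : ℕ} {p : ℝ × ℝ → ℝ} (hp : IsTemperate N p) (z : ℝ × ℝ) (x : ℝ) :
    Integrable (fun η => ∫ y : ℝ, cis (2 * π * ((x - y) * η)) * p ((x + y) / 2, η) * gs z y) := by
  obtain ⟨K, M, hK0, hK⟩ := exists_norm_inner_integral_gs_le hp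
  refine ((integrable_inv_br_pow_real (k := 2) le_rfl).const_mul (K * br z ^ M * br x ^ N)).mono' ?_
    (ae_of_all _ fun η => hK z x η)
  exact ((stronglyMeasurable_inner_integral hp.continuous continuous_gs).comp_measurable
    (by fun_prop : Measurable fun η : ℝ => ((z, x), η))).aestronglyMeasurable

theorem exists_norm_nW_gs_le {N : ℕ} {p : ℝ × ℝ → ℝ} (hp : IsTemperate N p) :
    ∃ (K : ℝ) (M : ℕ), 0 < K ∧ ∀ (z : ℝ × ℝ) (x : ℝ), ‖nW p (gs z) x‖ ≤ K * br z ^ M * br x ^ N := by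
  obtain ⟨K, M, hK0, hK⟩ := exists_norm_inner_integral_gs_le hp
  have hI : 0 ≤ ∫ η : ℝ, (br η ^ 2)⁻¹ := integral_nonneg fun η => (inv_br_pow_pos η 2).le
  refine ⟨K * ((∫ η : ℝ, (br η ^ 2)⁻¹) + 1), M, by positivity, fun z x => ?_⟩
  have hz := br_pos z
  have hx := br_pos x
  calc ‖nW p (gs z) x‖ ≤ ∫ η : ℝ, K * br z ^ M * br x ^ N * (br η ^ 2)⁻¹ := by
        refine norm_integral_le_of_norm_le ?_ (ae_of_all _ fun η => hK z x η)
        exact (integrable_inv_br_pow_real (k := 2) le_rfl).const_mul _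
    _ = K * (∫ η : ℝ, (br η ^ 2)⁻¹) * br z ^ M * br x ^ N := by rw [integral_const_mul]; ring
    _ ≤ _ := by gcongr; linarith

/-- Reflection of a coherent state at the phase space point `(X, η)`. -/
theorem cis_mul_gs_reflect (z : ℝ × ℝ) (X η x : ℝ) :
    cis (2 * π * ((x - (2 * X - x)) * η)) * gs z (2 * X - x) =
      cis (2 * π * (z.2 * X - z.1 * η)) * gs ((2 : ℝ) • (X, η) - z) x := by
  simp only [gs, Prod.fst_sub, Prod.snd_sub, Prod.smul_mk, smul_eq_mul]
  rw [mul_left_comm, ← cis_add, mul_left_comm (cis (2 * π * (z.2 * X - z.1 * η))), ← cis_add]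
  congr 2
  · congr 2; ring_nf
  · ring

/-- The substitution `y = 2X - x` exhibits a Weyl operator as a superposition of reflections at the
points `(X, η)`. Its Jacobian is the factor 2 in `wm`. -/
theorem inner_integral_gs_eq (p : ℝ × ℝ → ℝ) (z : ℝ × ℝ) (x η : ℝ) :
    ∫ y : ℝ, cis (2 * π * ((x - y) * η)) * p ((x + y) / 2, η) * gs z y =
      2 * ∫ X : ℝ, (p (X, η) : ℂ) * (cis (2 * π * (z.2 * X - z.1 * η)) *
        gs ((2 : ℝ) • (X, η) - z) x) := by
  have h1 := integral_sub_right_eq_self (μ := volume) (fun y : ℝ => cis (2 * π * ((x - y) * η)) *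
    p ((x + y) / 2, η) * gs z y) x
  have h2 := Measure.integral_comp_mul_left (fun y : ℝ => cis (2 * π * ((x - (y - x)) * η)) *
    p ((x + (y - x)) / 2, η) * gs z (y - x)) 2
  rw [← h1]
  have h3 : ∫ y : ℝ, cis (2 * π * ((x - (y - x)) * η)) * p ((x + (y - x)) / 2, η) * gs z (y - x) =
      2 * ∫ X : ℝ, cis (2 * π * ((x - (2 * X - x)) * η)) * p ((x + (2 * X - x)) / 2, η) *
        gs z (2 * X - x) := by
    rw [h2]
    rw [abs_of_pos (by norm_num), ← Complex.real_smul.symm, ]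
    simp
  rw [h3]
  congr 2; ext X
  rw [← cis_mul_gs_reflect, show (x + (2 * X - x)) / 2 = X by ring]
  ring

theorem integrable_pairing_aux {N : ℕ} {p : ℝ × ℝ → ℝ} (hp : IsTemperate N p) (z w : ℝ × ℝ) (η : ℝ) :
    Integrable (fun q : ℝ × ℝ => ((p (q.2, η) : ℂ) * (cis (2 * π * (z.2 * q.2 - z.1 * η)) *
        gs ((2 : ℝ) • (q.2, η) - z) q.1)) * conj (gs w q.1)) := by
  obtain ⟨A, hA0, hA⟩ := hp.exists_le
  obtain ⟨K, hK0, hK⟩ := exists_norm_gs_le (N + 2)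
  obtain ⟨K', hK0', hK'⟩ := exists_norm_gs_le (N + 4)
  have hi := (integrable_inv_br_pow_real (k := 2) le_rfl).mul_prod
    (integrable_inv_br_pow_real (k := 2) le_rfl)
  have hpc := hp.continuous
  have hcont : Continuous (fun q : ℝ × ℝ => ((p (q.2, η) : ℂ) * (cis (2 * π * (z.2 * q.2 - z.1 * η)) *
        gs ((2 : ℝ) • (q.2, η) - z) q.1)) * conj (gs w q.1)) := by fun_prop
  have hz := br_pos z.1
  have hw := br_pos w.1
  have hη := br_pos η
  refine (hi.const_mul (A * br η ^ N * K * br z.1 ^ (N + 2) * K' * br w.1 ^ (N + 4))).mono'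
    hcont.aestronglyMeasurable (ae_of_all _ fun q => ?_)
  obtain ⟨x, X⟩ := q
  simp only [norm_mul, norm_cis, one_mul, RCLike.norm_conj, Complex.norm_real, Real.norm_eq_abs]
  have hX := br_pos X
  have hx := br_pos x
  have h1 : |p (X, η)| ≤ A * (br X * br η) ^ N := by
    refine (hA _).trans ?_
    gcongr
    · exact (br_pos _).le
    · exact br_le_mul_br (X, η)
  have h2 : ‖gs ((2 : ℝ) • (X, η) - z) x‖ ≤ K * ((br x * br z.1) ^ (N + 2) * (br X ^ (N + 2))⁻¹) := by
    refine (hK _ _).trans ?_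
    gcongr
    simp only [Prod.fst_sub, Prod.smul_mk, smul_eq_mul]
    have h3 : br X ≤ br x * br z.1 * br (x - (2 * X - z.1)) := by
      have h4 : br X ≤ br (2 * X) := by
        simp only [br, norm_mul]; norm_num; linarith [abs_nonneg X]
      have h5 := br_le_mul' (2 * X) (x + z.1)
      have h6 := br_le_mul (x + z.1) x
      rw [add_sub_cancel_left] at h6
      rw [show x + z.1 - 2 * X = x - (2 * X - z.1) by ring] at h5
      have h7 := br_pos (x - (2 * X - z.1))
      calc br X ≤ br (x + z.1) * br (x - (2 * X - z.1)) := h4.trans h5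
        _ ≤ _ := by gcongr
    have h7 := br_pos (x - (2 * X - z.1))
    rw [← div_eq_mul_inv, le_div_iff₀ (by positivity), inv_mul_le_iff₀ (by positivity), ← mul_pow]
    gcongr
    linarith
  have h3 : ‖gs w x‖ ≤ K' * (br w.1 ^ (N + 4) * (br x ^ (N + 4))⁻¹) := by
    refine (hK' _ _).trans ?_
    have := inv_br_le x (x - w.1) (N + 4)
    rw [sub_sub_cancel] at this
    gcongr
  calc _ ≤ (A * (br X * br η) ^ N) * (K * ((br x * br z.1) ^ (N + 2) * (br X ^ (N + 2))⁻¹)) *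
        (K' * (br w.1 ^ (N + 4) * (br x ^ (N + 4))⁻¹)) := by gcongr
    _ = _ := by
      rw [mul_pow, mul_pow, show N + 4 = (N + 2) + 2 by ring, pow_add (br x) (N + 2) 2,
        pow_add (br X)]
      field_simp

/-- `wm` computes the matrix elements of the Weyl quantization. -/
theorem bt_nW_gs {N : ℕ} {p : ℝ × ℝ → ℝ} (hp : IsTemperate N p) (z : ℝ × ℝ) :
    bt (nW p (gs z)) = wm p z := by
  ext w
  obtain ⟨K, M, hK0, hK⟩ := exists_norm_inner_integral_gs_le hp
  obtain ⟨K', hK0', hK'⟩ := exists_norm_gs_le (N + 2)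
  obtain ⟨A, hA0, hA⟩ := hp.exists_le
  -- The double integral over `(y, η)` need not converge absolutely. Therefore `x` is interchanged
  -- with `η` while the `y`-integral is kept together, and then with `X` at fixed `η`.
  have hsw : Integrable (fun q : ℝ × ℝ => (∫ y : ℝ, cis (2 * π * ((q.1 - y) * q.2)) *
      p ((q.1 + y) / 2, q.2) * gs z y) * conj (gs w q.1)) := by
    have hi := (integrable_inv_br_pow_real (k := 2) le_rfl).mul_prod
      (integrable_inv_br_pow_real (k := 2) le_rfl)
    have hw := br_pos w.1
    have hz := br_pos z
    refine (hi.const_mul (K * br z ^ M * K' * br w.1 ^ (N + 2))).mono' ?_ (ae_of_all _ fun q => ?_)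
    · refine AEStronglyMeasurable.mul ?_ (by fun_prop : Continuous fun q : ℝ × ℝ =>
        conj (gs w q.1)).aestronglyMeasurable
      exact ((stronglyMeasurable_inner_integral hp.continuous continuous_gs).comp_measurable
        (by fun_prop : Measurable fun q : ℝ × ℝ => ((z, q.1), q.2))).aestronglyMeasurable
    · have h1 := br_pos q.1
      have h2 := br_pos q.2
      have h3 : ‖gs w q.1‖ ≤ K' * (br w.1 ^ (N + 2) * (br q.1 ^ (N + 2))⁻¹) := by
        refine (hK' _ _).trans ?_
        have := inv_br_le q.1 (q.1 - w.1) (N + 2)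
        rw [sub_sub_cancel] at this
        gcongr
      rw [norm_mul, RCLike.norm_conj]
      calc _ ≤ (K * br z ^ M * br q.1 ^ N * (br q.2 ^ 2)⁻¹) *
            (K' * (br w.1 ^ (N + 2) * (br q.1 ^ (N + 2))⁻¹)) := by
            gcongr; exact hK z q.1 q.2
        _ = _ := by rw [pow_add (br q.1)]; field_simp
  have step1 : bt (nW p (gs z)) w = ∫ η : ℝ, ∫ x : ℝ, (∫ y : ℝ, cis (2 * π * ((x - y) * η)) *
      p ((x + y) / 2, η) * gs z y) * conj (gs w x) := by
    rw [Measure.volume_eq_prod] at hsw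
    have := integral_integral_swap (f := fun x η : ℝ => (∫ y : ℝ, cis (2 * π * ((x - y) * η)) *
      p ((x + y) / 2, η) * gs z y) * conj (gs w x)) hsw
    rw [← this]
    simp only [bt, nW, integral_mul_const]
  have step2 : ∀ η : ℝ, ∫ x : ℝ, (∫ y : ℝ, cis (2 * π * ((x - y) * η)) *
      p ((x + y) / 2, η) * gs z y) * conj (gs w x) = 2 * ∫ X : ℝ, (p (X, η) : ℂ) *
        (cis (2 * π * (z.2 * X - z.1 * η)) * gram ((2 : ℝ) • (X, η) - z) w) := by
    intro η
    have hi := integrable_pairing_aux hp z w η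
    rw [Measure.volume_eq_prod] at hi
    have := integral_integral_swap (f := fun x X : ℝ => ((p (X, η) : ℂ) *
      (cis (2 * π * (z.2 * X - z.1 * η)) * gs ((2 : ℝ) • (X, η) - z) x)) * conj (gs w x)) hi
    simp_rw [inner_integral_gs_eq, mul_assoc (2 : ℂ), integral_const_mul, ← integral_mul_const]
    rw [this]
    simp_rw [mul_assoc, integral_const_mul, integral_gs_mul_conj_gs]
  rw [step1]
  simp_rw [step2]
  have hi := (integrable_wm_integrand hp.continuous hA z w 0).2
  rw [integral_const_mul, wm]
  rw [Measure.volume_eq_prod] at hi ⊢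
  rw [integral_prod_symm _ hi]

/-! ### Superpositions of coherent states -/

/-- Measurable functions on phase space of rapid decay. -/
structure RapidDecay (F : ℝ × ℝ → ℂ) : Prop where
  aesm : AEStronglyMeasurable F volume
  decay : ∀ k : ℕ, ∃ C : ℝ, 0 < C ∧ ∀ w, ‖F w‖ ≤ C * (br w ^ k)⁻¹

/-- The superposition of coherent states with density `F`. -/
def syn (F : ℝ × ℝ → ℂ) (x : ℝ) : ℂ := ∫ w, F w * gs w x

theorem RapidDecay.integrable_mul {F : ℝ × ℝ → ℂ} (hF : RapidDecay F) {G : ℝ × ℝ → ℂ}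
    (hG : AEStronglyMeasurable G volume) {C : ℝ} {N : ℕ} (hGC : ∀ w, ‖G w‖ ≤ C * br w ^ N) :
    Integrable (fun w => F w * G w) := by
  obtain ⟨K, hK0, hK⟩ := hF.decay (N + 3)
  refine ((integrable_inv_br_pow (k := 3) le_rfl).const_mul (K * C)).mono' (hF.aesm.mul hG)
    (ae_of_all _ fun w => ?_)
  have hw := br_pos w
  rw [norm_mul]
  calc _ ≤ (K * (br w ^ (N + 3))⁻¹) * (C * br w ^ N) := by
        gcongr
        · exact hK w
        · exact hGC w
    _ = _ := by rw [pow_add]; field_simp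

theorem norm_gs_le_decay (k : ℕ) : ∃ K : ℝ, 0 < K ∧ ∀ (w : ℝ × ℝ) (x : ℝ),
    ‖gs w x‖ ≤ K * br w ^ k * (br x ^ k)⁻¹ := by
  obtain ⟨K, hK0, hK⟩ := exists_norm_gs_le k
  refine ⟨K, hK0, fun w x => (hK w x).trans ?_⟩
  have h := inv_br_le x (x - w.1) k
  rw [sub_sub_cancel] at h
  rw [mul_assoc]
  have h1 := br_pos w.1
  have h2 := inv_br_pow_pos x k
  gcongr
  exact h.trans (by gcongr; exact br_fst_le w)

theorem exists_norm_syn_le {F : ℝ × ℝ → ℂ} (hF : RapidDecay F) (k : ℕ) :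
    ∃ C : ℝ, 0 < C ∧ ∀ x, ‖syn F x‖ ≤ C * (br x ^ k)⁻¹ := by
  obtain ⟨K, hK0, hK⟩ := norm_gs_le_decay k
  obtain ⟨C, hC0, hC⟩ := hF.decay (k + 3)
  have hI : 0 ≤ ∫ w : ℝ × ℝ, (br w ^ 3)⁻¹ := integral_nonneg fun w => (inv_br_pow_pos w 3).le
  refine ⟨C * K * ((∫ w : ℝ × ℝ, (br w ^ 3)⁻¹) + 1), by positivity, fun x => ?_⟩
  have hx := br_pos x
  calc ‖syn F x‖ ≤ ∫ w : ℝ × ℝ, C * K * (br x ^ k)⁻¹ * (br w ^ 3)⁻¹ := by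
        refine norm_integral_le_of_norm_le ((integrable_inv_br_pow (k := 3) le_rfl).const_mul _)
          (ae_of_all _ fun w => ?_)
        have hw := br_pos w
        rw [norm_mul]
        calc _ ≤ (C * (br w ^ (k + 3))⁻¹) * (K * br w ^ k * (br x ^ k)⁻¹) := by
              gcongr
              · exact hC w
              · exact hK w x
          _ = _ := by rw [pow_add (br w)]; field_simp
    _ = C * K * (∫ w : ℝ × ℝ, (br w ^ 3)⁻¹) * (br x ^ k)⁻¹ := by rw [integral_const_mul]; ring
    _ ≤ _ := by gcongr; linarith

theorem aestronglyMeasurable_syn {F : ℝ × ℝ → ℂ} (hF : AEStronglyMeasurable F volume) :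
    AEStronglyMeasurable (syn F) volume := by
  unfold syn
  refine AEStronglyMeasurable.integral_prod_right' (f := fun q : ℝ × (ℝ × ℝ) => F q.2 * gs q.2 q.1) ?_
  exact hF.comp_snd.mul (by fun_prop : Continuous fun q : ℝ × (ℝ × ℝ) => gs q.2 q.1).aestronglyMeasurable

theorem memLp_of_norm_le {f : ℝ → ℂ} (hf : AEStronglyMeasurable f volume) {C : ℝ}
    (h : ∀ x, ‖f x‖ ≤ C * (br x ^ 2)⁻¹) : MemLp f 2 volume := by
  rw [memLp_two_iff_integrable_sq_norm hf]
  refine ((integrable_inv_br_pow_real (k := 4) (by norm_num)).const_mul (C ^ 2)).mono'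
    (hf.norm.pow 2) (ae_of_all _ fun x => ?_)
  rw [norm_pow, norm_norm]
  calc _ ≤ (C * (br x ^ 2)⁻¹) ^ 2 := by gcongr; exact h x
    _ = _ := by rw [mul_pow, inv_pow, ← pow_mul]

theorem memLp_syn {F : ℝ × ℝ → ℂ} (hF : RapidDecay F) : MemLp (syn F) 2 volume := by
  obtain ⟨C, _, hC⟩ := exists_norm_syn_le hF 2
  exact memLp_of_norm_le (aestronglyMeasurable_syn hF.aesm) hC

theorem memLp_inv_br_sq : MemLp (fun x : ℝ => (((br x ^ 2)⁻¹ : ℝ) : ℂ)) 2 volume := by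
  refine memLp_of_norm_le (C := 1) (Complex.continuous_ofReal.comp
    (continuous_inv_br_pow 2)).aestronglyMeasurable fun x => ?_
  rw [Complex.norm_real, Real.norm_of_nonneg (inv_br_pow_pos x 2).le, one_mul]

theorem integrable_syn_pairing {F : ℝ × ℝ → ℂ} (hF : RapidDecay F) {v : ℝ → ℂ} (hv : MemLp v 2 volume) :
    Integrable (fun q : ℝ × (ℝ × ℝ) => F q.2 * gs q.2 q.1 * conj (v q.1)) := by
  obtain ⟨K, hK0, hK⟩ := norm_gs_le_decay 2
  obtain ⟨C, hC0, hC⟩ := hF.decay 5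
  have hi := ((integrable_mul_of_memLp memLp_inv_br_sq hv).norm).mul_prod
    (integrable_inv_br_pow (k := 3) le_rfl)
  refine (hi.const_mul (C * K)).mono' ?_ (ae_of_all _ fun q => ?_)
  · refine AEStronglyMeasurable.mul (AEStronglyMeasurable.mul ?_ ?_) ?_
    · exact hF.aesm.comp_snd
    · exact (by fun_prop : Continuous fun q : ℝ × (ℝ × ℝ) => gs q.2 q.1).aestronglyMeasurable
    · exact (memLp_conj hv).1.comp_fst
  · have hw := br_pos q.2
    have hx := br_pos q.1
    simp only [norm_mul, RCLike.norm_conj, Complex.norm_real, norm_inv, norm_pow,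
      Real.norm_of_nonneg hx.le]
    calc _ ≤ (C * (br q.2 ^ 5)⁻¹) * (K * br q.2 ^ 2 * (br q.1 ^ 2)⁻¹) * ‖v q.1‖ := by
          gcongr
          · exact hC _
          · exact hK _ _
      _ = _ := by field_simp

theorem integral_syn_mul_conj {F : ℝ × ℝ → ℂ} (hF : RapidDecay F) {v : ℝ → ℂ} (hv : MemLp v 2 volume) :
    ∫ x, syn F x * conj (v x) = ∫ w, F w * conj (bt v w) := by
  have hi := integrable_syn_pairing hF hv
  rw [Measure.volume_eq_prod] at hi
  have hs := integral_integral_swap (f := fun (x : ℝ) (w : ℝ × ℝ) => F w * gs w x * conj (v x)) hi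
  simp only [syn, ← integral_mul_const]
  rw [hs]
  congr 1; ext w
  simp_rw [mul_assoc, integral_const_mul]
  rw [bt, ← integral_conj]
  congr 2; ext x; simp [mul_comm]

theorem bt_syn {F : ℝ × ℝ → ℂ} (hF : RapidDecay F) (w : ℝ × ℝ) :
    bt (syn F) w = ∫ z, F z * gram z w := by
  rw [bt, integral_syn_mul_conj hF (memLp_gs w), bt_gs]
  simp_rw [conj_gram]

theorem integral_bt_mul_gram {f : ℝ → ℂ} (hf : MemLp f 2 volume) (w : ℝ × ℝ) :
    ∫ z, bt f z * gram z w = bt f w := by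
  have := integral_bt_mul_conj_bt hf (memLp_gs w)
  rw [bt_gs] at this
  simp only [conj_gram] at this
  exact this

theorem bt_sub {f g : ℝ → ℂ} (hf : MemLp f 2 volume) (hg : MemLp g 2 volume) :
    bt (fun x => f x - g x) = fun z => bt f z - bt g z := by
  ext z
  simp only [bt, sub_mul]
  exact integral_sub (integrable_mul_conj hf (memLp_gs z)) (integrable_mul_conj hg (memLp_gs z))

theorem ae_eq_of_bt_eq_of_memLp {f g : ℝ → ℂ} (hf : MemLp f 2 volume) (hg : MemLp g 2 volume)
    (h : bt f = bt g) : f =ᵐ[volume] g := by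
  have hfg : MemLp (fun x => f x - g x) 2 volume := hf.sub hg
  have h1 : lpNorm (fun x => f x - g x) 2 volume = 0 := by
    rw [← lpNorm_bt hfg, bt_sub hf hg, h]
    simp
  have h2 := (lpNorm_eq_zero hfg (by norm_num)).1 h1
  filter_upwards [h2] with x hx
  exact sub_eq_zero.1 hx

/-- Inversion of the Bargmann transform; rapid decay makes the superposition an absolutely
convergent integral at every point. -/
theorem ae_eq_syn_bt {f : ℝ → ℂ} (hf : MemLp f 2 volume) (hF : RapidDecay (bt f)) :
    f =ᵐ[volume] syn (bt f) := by
  refine ae_eq_of_bt_eq_of_memLp hf (memLp_syn hF) ?_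
  ext w
  rw [bt_syn hF, integral_bt_mul_gram hf]

/-! ### Weyl operators on superpositions of coherent states -/

theorem IsTemperate.exists_norm_wm_le {N : ℕ} {p : ℝ × ℝ → ℝ} (hp : IsTemperate N p) (k : ℕ) :
    ∃ K : ℝ, 0 < K ∧ ∀ z w, ‖wm p z w‖ ≤ K * br z ^ N * (br (z - w) ^ k)⁻¹ := by
  obtain ⟨B, hB⟩ := hp
  obtain ⟨K, hK0, hK⟩ := _root_.exists_norm_wm_le 1 N B k
  exact ⟨K, hK0, hK _ p (isWeight_br_pow N) hB⟩

theorem IsTemperate.exists_norm_wm_le' {N : ℕ} {p : ℝ × ℝ → ℝ} (hp : IsTemperate N p) (k : ℕ) :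
    ∃ K : ℝ, 0 < K ∧ ∀ z w, ‖wm p z w‖ ≤ K * br z ^ (N + k) * (br w ^ k)⁻¹ := by
  obtain ⟨K, hK0, hK⟩ := hp.exists_norm_wm_le k
  refine ⟨K, hK0, fun z w => (hK z w).trans ?_⟩
  have h := inv_br_le w (w - z) k
  rw [sub_sub_cancel, br_sub_comm w z] at h
  have h1 := br_pos z
  have h2 := br_pos w
  rw [pow_add, mul_assoc, mul_assoc, mul_assoc]
  gcongr

/-- The action of the kernel `wm p` on functions on phase space. -/
def wact (p : ℝ × ℝ → ℝ) (F : ℝ × ℝ → ℂ) (w : ℝ × ℝ) : ℂ := ∫ z, F z * wm p z w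

theorem aestronglyMeasurable_wact {p : ℝ × ℝ → ℝ} (hp : Continuous p) {F : ℝ × ℝ → ℂ}
    (hF : AEStronglyMeasurable F volume) : AEStronglyMeasurable (wact p F) volume := by
  unfold wact
  refine AEStronglyMeasurable.integral_prod_right'
    (f := fun q : (ℝ × ℝ) × (ℝ × ℝ) => F q.2 * wm p q.2 q.1) ?_
  exact hF.comp_snd.mul ((stronglyMeasurable_wm hp).comp_measurable measurable_swap).aestronglyMeasurable

theorem aesm_wm_left {p : ℝ × ℝ → ℝ} (hp : Continuous p) (w : ℝ × ℝ) :
    AEStronglyMeasurable (fun z => wm p z w) volume :=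
  ((stronglyMeasurable_wm hp).comp_measurable
    (by fun_prop : Measurable fun z : ℝ × ℝ => (z, w))).aestronglyMeasurable

theorem aesm_wm_right {p : ℝ × ℝ → ℝ} (hp : Continuous p) (z : ℝ × ℝ) :
    AEStronglyMeasurable (fun w => wm p z w) volume :=
  ((stronglyMeasurable_wm hp).comp_measurable
    (by fun_prop : Measurable fun w : ℝ × ℝ => (z, w))).aestronglyMeasurable

/-- The phase space form of the fact that `Op(p)` preserves Schwartz functions: off-diagonal decay
transports decay from `z` to `w`. -/
theorem rapidDecay_wact {N : ℕ} {p : ℝ × ℝ → ℝ} (hp : IsTemperate N p) {F : ℝ × ℝ → ℂ}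
    (hF : RapidDecay F) : RapidDecay (wact p F) where
  aesm := aestronglyMeasurable_wact hp.continuous hF.aesm
  decay k := by
    obtain ⟨K, hK0, hK⟩ := hp.exists_norm_wm_le' k
    obtain ⟨C, hC0, hC⟩ := hF.decay (N + k + 3)
    have hI : 0 ≤ ∫ w : ℝ × ℝ, (br w ^ 3)⁻¹ := integral_nonneg fun w => (inv_br_pow_pos w 3).le
    refine ⟨C * K * ((∫ w : ℝ × ℝ, (br w ^ 3)⁻¹) + 1), by positivity, fun w => ?_⟩
    have hw := br_pos w
    calc ‖wact p F w‖ ≤ ∫ z : ℝ × ℝ, C * K * (br w ^ k)⁻¹ * (br z ^ 3)⁻¹ := by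
          refine norm_integral_le_of_norm_le ((integrable_inv_br_pow (k := 3) le_rfl).const_mul _)
            (ae_of_all _ fun z => ?_)
          have hz := br_pos z
          rw [norm_mul]
          calc _ ≤ (C * (br z ^ (N + k + 3))⁻¹) * (K * br z ^ (N + k) * (br w ^ k)⁻¹) := by
                gcongr
                · exact hC z
                · exact hK z w
            _ = _ := by rw [pow_add (br z) (N + k)]; field_simp
      _ = C * K * (∫ w : ℝ × ℝ, (br w ^ 3)⁻¹) * (br w ^ k)⁻¹ := by rw [integral_const_mul]; ring
      _ ≤ _ := by gcongr; linarith

theorem wact_reproducing {N : ℕ} {p : ℝ × ℝ → ℝ} (hp : IsTemperate N p) {F : ℝ × ℝ → ℂ}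
    (hF : RapidDecay F) (w : ℝ × ℝ) : ∫ z, wact p F z * gram z w = wact p F w := by
  obtain ⟨A, hA0, hA⟩ := hp.exists_le
  obtain ⟨K, hK0, hK⟩ := hp.exists_norm_wm_le' 3
  obtain ⟨C, hC0, hC⟩ := hF.decay (N + 3 + 3)
  have hi : Integrable (fun q : (ℝ × ℝ) × (ℝ × ℝ) => F q.2 * wm p q.2 q.1 * gram q.1 w) := by
    have hi := (integrable_inv_br_pow (k := 3) le_rfl).mul_prod
      (integrable_inv_br_pow (k := 3) le_rfl)
    refine (hi.const_mul (C * K)).mono' ?_ (ae_of_all _ fun q => ?_)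
    · refine (hF.aesm.comp_snd.mul ((stronglyMeasurable_wm hp.continuous).comp_measurable
        measurable_swap).aestronglyMeasurable).mul ?_
      exact (by fun_prop : Continuous fun q : (ℝ × ℝ) × (ℝ × ℝ) => gram q.1 w).aestronglyMeasurable
    · have h1 := br_pos q.1
      have h2 := br_pos q.2
      have hg : ‖gram q.1 w‖ ≤ 1 := by
        rw [norm_gram, Real.exp_le_one_iff]
        have : 0 ≤ π / 2 * ((q.1.1 - w.1) ^ 2 + (q.1.2 - w.2) ^ 2) := by positivity
        linarith
      rw [norm_mul, norm_mul]
      calc _ ≤ (C * (br q.2 ^ (N + 3 + 3))⁻¹) * (K * br q.2 ^ (N + 3) * (br q.1 ^ 3)⁻¹) * 1 := by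
            gcongr
            · exact hC _
            · exact hK _ _
        _ = _ := by rw [pow_add (br q.2) (N + 3)]; field_simp
  rw [Measure.volume_eq_prod] at hi
  have hs := integral_integral_swap (f := fun v z : ℝ × ℝ => F z * wm p z v * gram v w) hi
  simp only [wact, ← integral_mul_const]
  rw [hs]
  simp_rw [mul_assoc, integral_const_mul, integral_wm_mul_gram hp.continuous hA]

/-- First of two interchanges with the superposition, at fixed `η`. The `η`-integral follows in
`nW_syn`, after the `y`-integral has produced decay in `η`. -/
theorem inner_integral_syn {N : ℕ} {p : ℝ × ℝ → ℝ} (hp : IsTemperate N p) {F : ℝ × ℝ → ℂ}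
    (hF : RapidDecay F) (x η : ℝ) :
    ∫ y : ℝ, cis (2 * π * ((x - y) * η)) * p ((x + y) / 2, η) * syn F y =
      ∫ z, F z * ∫ y : ℝ, cis (2 * π * ((x - y) * η)) * p ((x + y) / 2, η) * gs z y := by
  obtain ⟨A, hA0, hA⟩ := hp.exists_le
  obtain ⟨K, hK0, hK⟩ := norm_gs_le_decay (N + 2)
  obtain ⟨C, hC0, hC⟩ := hF.decay (N + 2 + 3)
  have hx := br_pos x
  have hη := br_pos η
  have hpc := hp.continuous
  have hi : Integrable (fun q : ℝ × (ℝ × ℝ) =>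
      F q.2 * (cis (2 * π * ((x - q.1) * η)) * p ((x + q.1) / 2, η) * gs q.2 q.1)) := by
    have hi := (integrable_inv_br_pow_real (k := 2) le_rfl).mul_prod
      (integrable_inv_br_pow (k := 3) le_rfl)
    refine (hi.const_mul (C * K * A * (br x * br η) ^ N)).mono' ?_ (ae_of_all _ fun q => ?_)
    · refine hF.aesm.comp_snd.mul ?_
      exact (by fun_prop : Continuous fun q : ℝ × (ℝ × ℝ) =>
        cis (2 * π * ((x - q.1) * η)) * p ((x + q.1) / 2, η) * gs q.2 q.1).aestronglyMeasurable
    · have h1 := br_pos q.1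
      have h2 := br_pos q.2
      have h3 : |p ((x + q.1) / 2, η)| ≤ A * (br x * br η * br q.1) ^ N := by
        refine (hA _).trans ?_
        gcongr
        · exact (br_pos _).le
        · refine (br_le_mul_br _).trans ?_
          have : br ((x + q.1) / 2) ≤ br x * br q.1 := by
            have h4 : |(x + q.1) / 2| ≤ |x| + |q.1| := by
              rw [abs_div, abs_of_pos (two_pos : (0:ℝ) < 2)]
              have := abs_add_le x q.1
              linarith [abs_nonneg x, abs_nonneg q.1]
            simp only [br_real]
            nlinarith [abs_nonneg x, abs_nonneg q.1, mul_nonneg (abs_nonneg x) (abs_nonneg q.1)]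
          calc _ ≤ br x * br q.1 * br η := by gcongr
            _ = _ := by ring
      simp only [norm_mul, norm_cis, one_mul, Complex.norm_real, Real.norm_eq_abs]
      calc _ ≤ (C * (br q.2 ^ (N + 2 + 3))⁻¹) * ((A * (br x * br η * br q.1) ^ N) *
            (K * br q.2 ^ (N + 2) * (br q.1 ^ (N + 2))⁻¹)) := by
            gcongr
            · exact hC _
            · exact hK _ _
        _ = _ := by
            rw [pow_add (br q.2) (N + 2) 3, pow_add (br q.1) N 2, mul_pow _ (br q.1)]; field_simp
  rw [Measure.volume_eq_prod] at hi
  have hs := integral_integral_swap (f := fun (y : ℝ) (z : ℝ × ℝ) =>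
    F z * (cis (2 * π * ((x - y) * η)) * p ((x + y) / 2, η) * gs z y)) hi
  simp only [syn, ← integral_const_mul]
  rw [← hs]
  congr 1; ext y; congr 1; ext z; ring

theorem nW_syn {N : ℕ} {p : ℝ × ℝ → ℝ} (hp : IsTemperate N p) {F : ℝ × ℝ → ℂ}
    (hF : RapidDecay F) (x : ℝ) : nW p (syn F) x = ∫ z, F z * nW p (gs z) x := by
  obtain ⟨K, M, hK0, hK⟩ := exists_norm_inner_integral_gs_le hp
  obtain ⟨C, hC0, hC⟩ := hF.decay (M + 3)
  have hx := br_pos x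
  have hi : Integrable (fun q : ℝ × (ℝ × ℝ) =>
      F q.2 * ∫ y : ℝ, cis (2 * π * ((x - y) * q.1)) * p ((x + y) / 2, q.1) * gs q.2 y) := by
    have hi := (integrable_inv_br_pow_real (k := 2) le_rfl).mul_prod
      (integrable_inv_br_pow (k := 3) le_rfl)
    refine (hi.const_mul (C * K * br x ^ N)).mono' ?_ (ae_of_all _ fun q => ?_)
    · refine hF.aesm.comp_snd.mul ?_
      exact ((stronglyMeasurable_inner_integral hp.continuous continuous_gs).comp_measurable
        (by fun_prop : Measurable fun q : ℝ × (ℝ × ℝ) => ((q.2, x), q.1))).aestronglyMeasurable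
    · have h1 := br_pos q.1
      have h2 := br_pos q.2
      rw [norm_mul]
      calc _ ≤ (C * (br q.2 ^ (M + 3))⁻¹) * (K * br q.2 ^ M * br x ^ N * (br q.1 ^ 2)⁻¹) := by
            gcongr
            · exact hC _
            · exact hK _ _ _
        _ = _ := by rw [pow_add (br q.2)]; field_simp
  rw [Measure.volume_eq_prod] at hi
  have hs := integral_integral_swap (f := fun (η : ℝ) (z : ℝ × ℝ) =>
    F z * ∫ y : ℝ, cis (2 * π * ((x - y) * η)) * p ((x + y) / 2, η) * gs z y) hi
  simp only [nW, inner_integral_syn hp hF, ← integral_const_mul]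
  simp only [← integral_const_mul] at hs
  exact hs

theorem nW_congr_ae (p : ℝ × ℝ → ℝ) {f g : ℝ → ℂ} (h : f =ᵐ[volume] g) : nW p f = nW p g := by
  ext x
  unfold nW
  congr 1; ext η
  exact integral_congr_ae (h.mono fun y hy => by simp only [hy])

/-- A Weyl operator with temperate symbol acts on superpositions of coherent states through its
matrix elements. -/
theorem nW_syn_ae_eq {N : ℕ} {p : ℝ × ℝ → ℝ} (hp : IsTemperate N p) {F : ℝ × ℝ → ℂ}
    (hF : RapidDecay F) : nW p (syn F) =ᵐ[volume] syn (wact p F) := by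
  obtain ⟨K, M, hK0, hK⟩ := exists_norm_nW_gs_le hp
  obtain ⟨C, hC0, hC⟩ := hF.decay (M + 3)
  have hRD := rapidDecay_wact hp hF
  obtain ⟨C', hC0', hC'⟩ := exists_norm_syn_le hRD 0
  have hI : 0 ≤ ∫ w : ℝ × ℝ, (br w ^ 3)⁻¹ := integral_nonneg fun w => (inv_br_pow_pos w 3).le
  have hmeas : AEStronglyMeasurable (nW p (syn F)) volume := by
    rw [funext (nW_syn hp hF)]
    refine AEStronglyMeasurable.integral_prod_right'
      (f := fun q : ℝ × (ℝ × ℝ) => F q.2 * nW p (gs q.2) q.1) ?_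
    exact hF.aesm.comp_snd.mul ((stronglyMeasurable_nW_gs hp.continuous).comp_measurable
      measurable_swap).aestronglyMeasurable
  have hFK : ∀ (z : ℝ × ℝ) (x : ℝ), ‖F z * nW p (gs z) x‖ ≤ C * K * br x ^ N * (br z ^ 3)⁻¹ := by
    intro z x
    have hz := br_pos z
    have hx := br_pos x
    rw [norm_mul]
    calc _ ≤ (C * (br z ^ (M + 3))⁻¹) * (K * br z ^ M * br x ^ N) := by
          gcongr
          · exact hC z
          · exact hK z x
      _ = _ := by rw [pow_add (br z)]; field_simp
  have hbd : ∀ x, ‖nW p (syn F) x‖ ≤ C * K * (∫ w : ℝ × ℝ, (br w ^ 3)⁻¹) * (1 + |x|) ^ N := by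
    intro x
    rw [nW_syn hp hF]
    calc _ ≤ ∫ z : ℝ × ℝ, C * K * br x ^ N * (br z ^ 3)⁻¹ :=
          norm_integral_le_of_norm_le ((integrable_inv_br_pow (k := 3) le_rfl).const_mul _)
            (ae_of_all _ fun z => hFK z x)
      _ = _ := by rw [integral_const_mul, br_real]; ring
  -- The left side is so far known only to grow polynomially, hence uniqueness in that class is used
  -- instead of the isometry on `L²`.
  refine ae_eq_of_bt_eq hmeas (aestronglyMeasurable_syn hRD.aesm) hbd
    (C' := C') (N' := 0) (fun x => by simpa using hC' x) ?_
  ext w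
  rw [bt_syn hRD, wact_reproducing hp hF, bt]
  obtain ⟨K2, hK20, hK2⟩ := norm_gs_le_decay (N + 2)
  have hw := br_pos w
  have hi : Integrable (fun q : ℝ × (ℝ × ℝ) => F q.2 * nW p (gs q.2) q.1 * conj (gs w q.1)) := by
    have hi := (integrable_inv_br_pow_real (k := 2) le_rfl).mul_prod
      (integrable_inv_br_pow (k := 3) le_rfl)
    refine (hi.const_mul (C * K * K2 * br w ^ (N + 2))).mono' ?_ (ae_of_all _ fun q => ?_)
    · refine (hF.aesm.comp_snd.mul ((stronglyMeasurable_nW_gs hp.continuous).comp_measurable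
        measurable_swap).aestronglyMeasurable).mul ?_
      exact (by fun_prop : Continuous fun q : ℝ × (ℝ × ℝ) => conj (gs w q.1)).aestronglyMeasurable
    · have h1 := br_pos q.1
      have h2 := br_pos q.2
      rw [norm_mul, RCLike.norm_conj]
      calc _ ≤ (C * K * br q.1 ^ N * (br q.2 ^ 3)⁻¹) * (K2 * br w ^ (N + 2) * (br q.1 ^ (N + 2))⁻¹) := by
            gcongr
            · exact hFK _ _
            · exact hK2 _ _
        _ = _ := by rw [pow_add (br q.1)]; field_simp
  rw [Measure.volume_eq_prod] at hi
  have hs := integral_integral_swap (f := fun (x : ℝ) (z : ℝ × ℝ) =>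
    F z * nW p (gs z) x * conj (gs w x)) hi
  simp_rw [nW_syn hp hF, ← integral_mul_const]
  rw [hs, wact]
  congr 1; ext z
  simp_rw [mul_assoc, integral_const_mul]
  rw [← bt_nW_gs hp, bt]

/-! ### Compactly supported symbols -/

/-- Smooth functions of compact support on phase space. -/
structure IsBump (χ : ℝ × ℝ → ℝ) : Prop where
  smooth : ContDiff ℝ ∞ χ
  compact : HasCompactSupport χ

theorem isWeight_inv_br_pow (N : ℕ) : IsWeight 1 N (fun z => (br z ^ N)⁻¹) where
  nonneg z := (inv_br_pow_pos z N).le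
  le z w := by
    rw [one_mul, br_sub_comm]
    exact inv_br_le w z N

/-- On a compact support any positive continuous weight is comparable to a constant. In particular
arbitrarily fast decaying weights are admissible. -/
theorem IsBump.exists_hasSymbolBounds {χ : ℝ × ℝ → ℝ} (hχ : IsBump χ) {𝔴 : ℝ × ℝ → ℝ}
    (h𝔴 : Continuous 𝔴) (h0 : ∀ z, 0 < 𝔴 z) : ∃ B, HasSymbolBounds B 𝔴 χ := by
  have h : ∀ k : ℕ, ∃ B : ℝ, ∀ z, ‖iteratedFDeriv ℝ k χ z‖ ≤ B * 𝔴 z := by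
    intro k
    have hc : Continuous (fun z => (𝔴 z)⁻¹ • iteratedFDeriv ℝ k χ z) :=
      (h𝔴.inv₀ fun z => (h0 z).ne').smul (hχ.smooth.continuous_iteratedFDeriv (by exact_mod_cast le_top))
    obtain ⟨B, hB⟩ := hc.bounded_above_of_compact_support
      ((hχ.compact.iteratedFDeriv k).smul_left (f := fun z => (𝔴 z)⁻¹))
    refine ⟨B, fun z => ?_⟩
    have := hB z
    rw [norm_smul, norm_inv, Real.norm_of_nonneg (h0 z).le, inv_mul_le_iff₀ (h0 z)] at this
    rwa [mul_comm]
  choose B hB using h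
  exact ⟨B, hχ.smooth, hB⟩

theorem IsBump.isTemperate {χ : ℝ × ℝ → ℝ} (hχ : IsBump χ) (N : ℕ) : IsTemperate N χ :=
  hχ.exists_hasSymbolBounds (by fun_prop) fun z => pow_pos (br_pos z) N

theorem IsBump.exists_abs_le {χ : ℝ × ℝ → ℝ} (hχ : IsBump χ) (k : ℕ) :
    ∃ A : ℝ, 0 ≤ A ∧ ∀ z, |χ z| ≤ A * (br z ^ k)⁻¹ := by
  obtain ⟨B, hB⟩ := hχ.exists_hasSymbolBounds (continuous_inv_br_pow k) fun z => inv_br_pow_pos z k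
  refine ⟨B 0, ?_, hB.norm_le⟩
  have := (abs_nonneg _).trans (hB.norm_le 0); simpa [br] using this

/-- With the weight `br ^ (-2k)`, half of the decay stays at `z`, and the other half is carried to
`w` by the off-diagonal decay. -/
theorem IsBump.exists_norm_wm_le {χ : ℝ × ℝ → ℝ} (hχ : IsBump χ) (k : ℕ) :
    ∃ K : ℝ, 0 < K ∧ ∀ z w, ‖wm χ z w‖ ≤ K * (br z ^ k)⁻¹ * (br w ^ k)⁻¹ := by
  obtain ⟨B, hB⟩ := hχ.exists_hasSymbolBounds (continuous_inv_br_pow (k + k))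
    fun z => inv_br_pow_pos z (k + k)
  obtain ⟨K, hK0, hK⟩ := _root_.exists_norm_wm_le 1 (k + k) B k
  refine ⟨K, hK0, fun z w => (hK _ χ (isWeight_inv_br_pow _) hB z w).trans ?_⟩
  have h := inv_br_le w (w - z) k
  rw [sub_sub_cancel, br_sub_comm w z] at h
  have h1 := br_pos z
  have h2 := br_pos w
  calc _ ≤ K * (br z ^ (k + k))⁻¹ * (br z ^ k * (br w ^ k)⁻¹) := by gcongr
    _ = _ := by rw [pow_add]; field_simp

theorem IsBump.rapidDecay_wm {χ : ℝ × ℝ → ℝ} (hχ : IsBump χ) (z : ℝ × ℝ) : RapidDecay (wm χ z) where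
  aesm := aesm_wm_right hχ.smooth.continuous z
  decay k := by
    obtain ⟨K, hK0, hK⟩ := hχ.exists_norm_wm_le k
    refine ⟨K, hK0, fun w => (hK z w).trans ?_⟩
    have := inv_br_pow_pos w k
    gcongr
    exact mul_le_of_le_one_right hK0.le (inv_br_pow_le_one z k)

theorem continuous_syn {F : ℝ × ℝ → ℂ} (hF : RapidDecay F) : Continuous (syn F) := by
  obtain ⟨C, hC0, hC⟩ := hF.decay 3
  refine continuous_of_dominated (bound := fun w : ℝ × ℝ => C * (br w ^ 3)⁻¹ * 2) (fun x => ?_)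
    (fun x => ae_of_all _ fun w => ?_) ((integrable_inv_br_pow (k := 3) le_rfl).const_mul C |>.mul_const 2)
    (ae_of_all _ fun w => by fun_prop)
  · exact hF.aesm.mul (by fun_prop : Continuous fun w => gs w x).aestronglyMeasurable
  · rw [norm_mul]
    have := inv_br_pow_pos w 3
    gcongr
    · exact hC w
    · exact norm_gs_le_two w x

theorem IsBump.continuous_nW_gs {χ : ℝ × ℝ → ℝ} (hχ : IsBump χ) (z : ℝ × ℝ) :
    Continuous (nW χ (gs z)) := by
  obtain ⟨A, hA0, hA⟩ := hχ.exists_abs_le 2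
  have hχc := hχ.smooth.continuous
  have hb : ∀ x y η : ℝ, ‖cis (2 * π * ((x - y) * η)) * χ ((x + y) / 2, η) * gs z y‖ ≤
      A * (br η ^ 2)⁻¹ * ‖gs z y‖ := by
    intro x y η
    rw [norm_mul, norm_mul, norm_cis, one_mul, Complex.norm_real, Real.norm_eq_abs]
    have := br_pos η
    gcongr
    refine (hA _).trans ?_
    gcongr
    exact br_snd_le ((x + y) / 2, η)
  have hin : ∀ η, Continuous fun x : ℝ =>
      ∫ y : ℝ, cis (2 * π * ((x - y) * η)) * χ ((x + y) / 2, η) * gs z y := by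
    intro η
    refine continuous_of_dominated (bound := fun y => A * (br η ^ 2)⁻¹ * ‖gs z y‖) (fun x => ?_)
      (fun x => ae_of_all _ fun y => hb x y η) ((integrable_gs z).norm.const_mul _)
      (ae_of_all _ fun y => by fun_prop)
    exact (by fun_prop : Continuous fun y : ℝ =>
      cis (2 * π * ((x - y) * η)) * χ ((x + y) / 2, η) * gs z y).aestronglyMeasurable
  refine continuous_of_dominated (bound := fun η : ℝ => A * (∫ y, ‖gs z y‖) * (br η ^ 2)⁻¹) (fun x => ?_)
    (fun x => ae_of_all _ fun η => ?_) ((integrable_inv_br_pow_real (k := 2) le_rfl).const_mul _)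
    (ae_of_all _ fun η => hin η)
  · exact (integrable_inner_integral_gs (hχ.isTemperate 0) z x).aestronglyMeasurable
  · refine (norm_integral_le_of_norm_le ((integrable_gs z).norm.const_mul _)
      (ae_of_all _ fun y => hb x y η)).trans (le_of_eq ?_)
    rw [integral_const_mul]; ring

/-- Continuity of both sides upgrades almost everywhere to everywhere; this is needed because
`bt_nK` evaluates at a fixed point `x`. -/
theorem IsBump.nW_gs {χ : ℝ × ℝ → ℝ} (hχ : IsBump χ) (z : ℝ × ℝ) : nW χ (gs z) = syn (wm χ z) := by
  have hT := hχ.isTemperate 0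
  obtain ⟨K, M, hK0, hK⟩ := exists_norm_nW_gs_le hT
  obtain ⟨A, hA0, hA⟩ := hT.exists_le
  have hRD := hχ.rapidDecay_wm z
  obtain ⟨C, hC0, hC⟩ := exists_norm_syn_le hRD 0
  refine (Continuous.ae_eq_iff_eq volume (hχ.continuous_nW_gs z) (continuous_syn hRD)).1 ?_
  refine ae_eq_of_bt_eq (hχ.continuous_nW_gs z).aestronglyMeasurable
    (aestronglyMeasurable_syn hRD.aesm) (C := K * br z ^ M) (N := 0) (C' := C) (N' := 0)
    (fun x => by simpa using hK z x) (fun x => by simpa using hC x) ?_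
  ext w
  rw [bt_nW_gs hT, bt_syn hRD, integral_wm_mul_gram hT.continuous hA]

theorem IsBump.exists_norm_syn_wm_le {χ : ℝ × ℝ → ℝ} (hχ : IsBump χ) (k : ℕ) :
    ∃ K : ℝ, 0 < K ∧ ∀ z x, ‖syn (wm χ z) x‖ ≤ K * (br z ^ k)⁻¹ * (br x ^ k)⁻¹ := by
  obtain ⟨K, hK0, hK⟩ := hχ.exists_norm_wm_le (k + 3)
  obtain ⟨K', hK0', hK'⟩ := norm_gs_le_decay k
  have hI : 0 ≤ ∫ w : ℝ × ℝ, (br w ^ 3)⁻¹ := integral_nonneg fun w => (inv_br_pow_pos w 3).le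
  refine ⟨K * K' * ((∫ w : ℝ × ℝ, (br w ^ 3)⁻¹) + 1), by positivity, fun z x => ?_⟩
  have hx := br_pos x
  have hz := br_pos z
  calc ‖syn (wm χ z) x‖ ≤ ∫ w : ℝ × ℝ, K * K' * (br z ^ k)⁻¹ * (br x ^ k)⁻¹ * (br w ^ 3)⁻¹ := by
        refine norm_integral_le_of_norm_le ((integrable_inv_br_pow (k := 3) le_rfl).const_mul _)
          (ae_of_all _ fun w => ?_)
        have hw := br_pos w
        rw [norm_mul]
        calc _ ≤ (K * (br z ^ (k + 3))⁻¹ * (br w ^ (k + 3))⁻¹) * (K' * br w ^ k * (br x ^ k)⁻¹) := by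
              gcongr
              · exact hK z w
              · exact hK' w x
          _ = K * (br z ^ (k + 3))⁻¹ * K' * (br x ^ k)⁻¹ * (br w ^ 3)⁻¹ := by
              rw [pow_add (br w)]; field_simp
          _ ≤ K * (br z ^ k)⁻¹ * K' * (br x ^ k)⁻¹ * (br w ^ 3)⁻¹ := by
              have := inv_br_pow_anti z (Nat.le_add_right k 3)
              gcongr
          _ = _ := by ring
    _ = K * K' * (∫ w : ℝ × ℝ, (br w ^ 3)⁻¹) * (br z ^ k)⁻¹ * (br x ^ k)⁻¹ := by
        rw [integral_const_mul]; ring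
    _ ≤ _ := by gcongr; linarith

/-! ### The integral kernel -/

/-- The integral kernel of `nW χ`. -/
def nK (χ : ℝ × ℝ → ℝ) (x y : ℝ) : ℂ := ∫ η : ℝ, cis (2 * π * ((x - y) * η)) * χ ((x + y) / 2, η)

theorem conj_nK (χ : ℝ × ℝ → ℝ) (x y : ℝ) : conj (nK χ x y) = nK χ y x := by
  rw [nK, ← integral_conj, nK]
  congr 1; ext η
  rw [map_mul, conj_cis, Complex.conj_ofReal, add_comm]
  congr 2; ring

/-- Since `y = 2 · (x + y) / 2 - x`, decay of the symbol at the midpoint is decay in `y`, at the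
cost of a power of `br x`. -/
theorem IsBump.exists_abs_le_prod {χ : ℝ × ℝ → ℝ} (hχ : IsBump χ) :
    ∃ A : ℝ, 0 ≤ A ∧ ∀ x y η : ℝ,
      |χ ((x + y) / 2, η)| ≤ A * br x ^ 2 * (br y ^ 2)⁻¹ * (br η ^ 2)⁻¹ := by
  obtain ⟨A, hA0, hA⟩ := hχ.exists_abs_le (2 + 2)
  refine ⟨4 * A, by positivity, fun x y η => (hA _).trans ?_⟩
  set s := (x + y) / 2 with hs
  have hy := br_pos y
  have hx := br_pos x
  have hη := br_pos η
  have hs0 := br_pos s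
  have h1 : br y ≤ 2 * (br x * br s) := by
    have h2 : |y| ≤ 2 * |s| + |x| := by
      have : y = 2 * s - x := by rw [hs]; ring
      calc |y| = |2 * s - x| := by rw [← this]
        _ ≤ |2 * s| + |x| := abs_sub _ _
        _ = _ := by rw [abs_mul, abs_two]
    simp only [br_real]
    nlinarith [abs_nonneg x, abs_nonneg s, mul_nonneg (abs_nonneg x) (abs_nonneg s)]
  have h3 : (br s ^ 2)⁻¹ ≤ 4 * br x ^ 2 * (br y ^ 2)⁻¹ := by
    rw [← div_eq_mul_inv, le_div_iff₀ (by positivity), inv_mul_le_iff₀ (by positivity)]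
    calc br y ^ 2 ≤ (2 * (br x * br s)) ^ 2 := by gcongr
      _ = _ := by ring
  calc A * (br (s, η) ^ (2 + 2))⁻¹ ≤ A * (br s ^ 2 * br η ^ 2)⁻¹ := by
        rw [pow_add]
        gcongr
        · exact br_fst_le (s, η)
        · exact br_snd_le (s, η)
    _ = A * ((br s ^ 2)⁻¹ * (br η ^ 2)⁻¹) := by rw [mul_inv]
    _ ≤ A * (4 * br x ^ 2 * (br y ^ 2)⁻¹ * (br η ^ 2)⁻¹) := by gcongr
    _ = _ := by ring

theorem aestronglyMeasurable_nK {χ : ℝ × ℝ → ℝ} (hχ : Continuous χ) (x : ℝ) :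
    AEStronglyMeasurable (nK χ x) volume := by
  unfold nK
  exact AEStronglyMeasurable.integral_prod_right'
    (f := fun q : ℝ × ℝ => cis (2 * π * ((x - q.1) * q.2)) * χ ((x + q.1) / 2, q.2))
    (by fun_prop : Continuous fun q : ℝ × ℝ =>
      cis (2 * π * ((x - q.1) * q.2)) * χ ((x + q.1) / 2, q.2)).aestronglyMeasurable

theorem IsBump.memLp_nK {χ : ℝ × ℝ → ℝ} (hχ : IsBump χ) (x : ℝ) : MemLp (nK χ x) 2 volume := by
  obtain ⟨A, hA0, hA⟩ := hχ.exists_abs_le_prod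
  refine memLp_of_norm_le (aestronglyMeasurable_nK hχ.smooth.continuous x)
    (C := A * br x ^ 2 * ∫ η : ℝ, (br η ^ 2)⁻¹) fun y => ?_
  calc ‖nK χ x y‖ ≤ ∫ η : ℝ, A * br x ^ 2 * (br y ^ 2)⁻¹ * (br η ^ 2)⁻¹ := by
        refine norm_integral_le_of_norm_le ((integrable_inv_br_pow_real (k := 2) le_rfl).const_mul _)
          (ae_of_all _ fun η => ?_)
        rw [norm_mul, norm_cis, one_mul, Complex.norm_real, Real.norm_eq_abs]
        exact hA x y η
    _ = _ := by rw [integral_const_mul]; ring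

theorem IsBump.nW_eq {χ : ℝ × ℝ → ℝ} (hχ : IsBump χ) {u : ℝ → ℂ} (hu : MemLp u 2 volume) (x : ℝ) :
    nW χ u x = ∫ y, u y * nK χ x y := by
  obtain ⟨A, hA0, hA⟩ := hχ.exists_abs_le_prod
  have hχc := hχ.smooth.continuous
  have hi : Integrable (fun q : ℝ × ℝ =>
      cis (2 * π * ((x - q.2) * q.1)) * χ ((x + q.2) / 2, q.1) * u q.2) := by
    have hi := (integrable_inv_br_pow_real (k := 2) le_rfl).mul_prod
      (integrable_mul_of_memLp memLp_inv_br_sq hu).norm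
    refine (hi.const_mul (A * br x ^ 2)).mono' ?_ (ae_of_all _ fun q => ?_)
    · exact (by fun_prop : Continuous fun q : ℝ × ℝ =>
        cis (2 * π * ((x - q.2) * q.1)) * χ ((x + q.2) / 2, q.1)).aestronglyMeasurable.mul
        hu.1.comp_snd
    · have hy := br_pos q.2
      simp only [norm_mul, norm_cis, one_mul, Complex.norm_real, norm_inv, norm_pow,
        Real.norm_of_nonneg hy.le]
      rw [Real.norm_eq_abs]
      calc _ ≤ (A * br x ^ 2 * (br q.2 ^ 2)⁻¹ * (br q.1 ^ 2)⁻¹) * ‖u q.2‖ := by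
            gcongr
            exact hA x q.2 q.1
        _ = _ := by ring
  rw [Measure.volume_eq_prod] at hi
  rw [nW, integral_integral_swap
    (f := fun η y : ℝ => cis (2 * π * ((x - y) * η)) * χ ((x + y) / 2, η) * u y) hi]
  congr 1; ext y
  rw [integral_mul_const, mul_comm, nK]

theorem IsBump.memLp_nK' {χ : ℝ × ℝ → ℝ} (hχ : IsBump χ) (x : ℝ) :
    MemLp (fun y => nK χ y x) 2 volume := by
  simp_rw [← conj_nK χ x]
  exact memLp_conj (hχ.memLp_nK x)

theorem IsBump.bt_nK {χ : ℝ × ℝ → ℝ} (hχ : IsBump χ) (x : ℝ) (z : ℝ × ℝ) :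
    bt (fun y => nK χ y x) z = conj (syn (wm χ z) x) := by
  rw [← hχ.nW_gs, hχ.nW_eq (memLp_gs z), bt, ← integral_conj]
  congr 1; ext y
  rw [map_mul, conj_nK, mul_comm]

theorem stronglyMeasurable_syn_wm {χ : ℝ × ℝ → ℝ} (hχ : Continuous χ) :
    StronglyMeasurable (fun q : (ℝ × ℝ) × ℝ => syn (wm χ q.1) q.2) := by
  have m1 : Measurable fun r : ((ℝ × ℝ) × ℝ) × (ℝ × ℝ) => (r.1.1, r.2) := by fun_prop
  have m2 : Measurable fun r : ((ℝ × ℝ) × ℝ) × (ℝ × ℝ) => (r.2, r.1.2) := by fun_prop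
  have h1 := (stronglyMeasurable_wm hχ).comp_measurable m1
  have h2 := continuous_gs.stronglyMeasurable.comp_measurable m2
  exact (h1.mul h2).integral_prod_right' (ν := volume)

theorem IsBump.rapidDecay_bt_nK {χ : ℝ × ℝ → ℝ} (hχ : IsBump χ) (x : ℝ) :
    RapidDecay (bt (fun y => nK χ y x)) where
  aesm := aestronglyMeasurable_bt (hχ.memLp_nK' x).1
  decay k := by
    obtain ⟨K, hK0, hK⟩ := hχ.exists_norm_syn_wm_le k
    refine ⟨K, hK0, fun z => ?_⟩
    rw [hχ.bt_nK, RCLike.norm_conj]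
    exact (hK z x).trans (mul_le_of_le_one_right (by have := inv_br_pow_pos z k; positivity)
      (inv_br_pow_le_one x k))

/-! ### Bounded functions on phase space -/

theorem lpNorm_gs (z : ℝ × ℝ) : lpNorm (gs z) 2 volume = 1 := by
  have h := lpNorm_sq_eq (memLp_gs z)
  have h2 := integral_gs_mul_conj_gs z z
  simp only [Complex.mul_conj, Complex.normSq_eq_norm_sq] at h2
  rw [integral_complex_ofReal, ← h] at h2
  have h3 : gram z z = 1 := by
    rw [gram]
    simp [show π * (z.2 * z.1 - z.1 * z.2) = 0 by ring]
  rw [h3] at h2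
  have h4 : lpNorm (gs z) 2 volume ^ 2 = 1 := by exact_mod_cast h2
  exact (pow_eq_one_iff_of_nonneg lpNorm_nonneg two_ne_zero).1 h4

theorem norm_bt_le {u : ℝ → ℂ} (hu : MemLp u 2 volume) (z : ℝ × ℝ) : ‖bt u z‖ ≤ lpNorm u 2 volume := by
  have := norm_integral_mul_conj_le hu (memLp_gs z)
  rwa [lpNorm_gs, mul_one] at this

theorem RapidDecay.bounded {F : ℝ × ℝ → ℂ} (hF : RapidDecay F) : ∃ C, ∀ z, ‖F z‖ ≤ C := by
  obtain ⟨C, _, hC⟩ := hF.decay 0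
  exact ⟨C, fun z => by simpa using hC z⟩

/-- The kernel of a symbol bounded by `𝔴` maps functions bounded by the weight `𝔳` to functions
bounded by `𝔴 𝔳`. -/
theorem exists_norm_wact_le (C : ℝ) (N : ℕ) (B : ℕ → ℝ) (C' : ℝ) (N' : ℕ) (hC' : 0 ≤ C') :
    ∃ K : ℝ, 0 < K ∧ ∀ 𝔴 c, IsWeight C N 𝔴 → HasSymbolBounds B 𝔴 c → ∀ 𝔳, IsWeight C' N' 𝔳 →
      ∀ (F : ℝ × ℝ → ℂ) (M : ℝ), 0 ≤ M → (∀ z, ‖F z‖ ≤ M * 𝔳 z) → ∀ w,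
        ‖wact c F w‖ ≤ K * 𝔴 w * 𝔳 w * M := by
  -- A Schur estimate: `N'` powers move `𝔳` from `z` to `w`, three give integrability. Hermitian
  -- symmetry of `wm` lets `𝔴` be evaluated at the fixed point `w`.
  obtain ⟨K, hK0, hK⟩ := exists_norm_wm_le C N B (N' + 3)
  have hI : 0 ≤ ∫ w : ℝ × ℝ, (br w ^ 3)⁻¹ := integral_nonneg fun w => (inv_br_pow_pos w 3).le
  refine ⟨K * C' * (∫ w : ℝ × ℝ, (br w ^ 3)⁻¹) + 1, by positivity, ?_⟩
  intro 𝔴 c h𝔴 hc 𝔳 h𝔳 F M hM hF w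
  have h1 := h𝔴.nonneg w
  have h2 := h𝔳.nonneg w
  calc ‖wact c F w‖ ≤ ∫ z : ℝ × ℝ, K * C' * 𝔴 w * 𝔳 w * M * (br (z - w) ^ 3)⁻¹ := by
        refine norm_integral_le_of_norm_le
          (((integrable_inv_br_pow (k := 3) le_rfl).comp_sub_right w).const_mul _)
          (ae_of_all _ fun z => ?_)
        have hz := br_pos (z - w)
        rw [norm_mul, ← conj_wm, RCLike.norm_conj]
        calc _ ≤ (M * (C' * br (z - w) ^ N' * 𝔳 w)) * (K * 𝔴 w * (br (w - z) ^ (N' + 3))⁻¹) := by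
              gcongr
              · exact (hF z).trans (by gcongr; exact h𝔳.le z w)
              · exact hK 𝔴 c h𝔴 hc w z
          _ = _ := by rw [br_sub_comm w z, pow_add]; field_simp
    _ = K * C' * (∫ z : ℝ × ℝ, (br z ^ 3)⁻¹) * 𝔴 w * 𝔳 w * M := by
        rw [integral_const_mul, integral_sub_right_eq_self (fun z : ℝ × ℝ => (br z ^ 3)⁻¹)]; ring
    _ ≤ _ := by gcongr; linarith

theorem isWeight_one : IsWeight 1 0 (fun _ => 1) := ⟨fun _ => zero_le_one, fun z w => by simp⟩

theorem IsTemperate.exists_norm_wact_le {N : ℕ} {p : ℝ × ℝ → ℝ} (hp : IsTemperate N p)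
    {F : ℝ × ℝ → ℂ} {C : ℝ} (hF : ∀ z, ‖F z‖ ≤ C) :
    ∃ K : ℝ, 0 ≤ K ∧ ∀ w, ‖wact p F w‖ ≤ K * br w ^ N := by
  obtain ⟨B, hB⟩ := hp
  obtain ⟨K, hK0, hK⟩ := _root_.exists_norm_wact_le 1 N B 1 0 zero_le_one
  have hC : 0 ≤ C := (norm_nonneg _).trans (hF 0)
  refine ⟨K * C, by positivity, fun w => ?_⟩
  have := hK _ p (isWeight_br_pow N) hB _ isWeight_one F C hC (by simpa using hF) w
  linarith

theorem IsTemperate.integrable_mul_wm {N : ℕ} {p : ℝ × ℝ → ℝ} (hp : IsTemperate N p)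
    {F : ℝ × ℝ → ℂ} (hFm : AEStronglyMeasurable F volume) {C : ℝ} (hF : ∀ z, ‖F z‖ ≤ C) (w : ℝ × ℝ) :
    Integrable (fun z => F z * wm p z w) := by
  obtain ⟨K, hK0, hK⟩ := hp.exists_norm_wm_le 3
  have hC : 0 ≤ C := (norm_nonneg _).trans (hF 0)
  refine ((((integrable_inv_br_pow (k := 3) le_rfl).comp_sub_right w).const_mul
    (C * (K * br w ^ N)))).mono' (hFm.mul (aesm_wm_left hp.continuous w)) (ae_of_all _ fun z => ?_)
  rw [norm_mul, ← conj_wm, RCLike.norm_conj]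
  calc _ ≤ C * (K * br w ^ N * (br (w - z) ^ 3)⁻¹) := by
        gcongr
        · exact hF z
        · exact hK w z
    _ = _ := by rw [br_sub_comm]; ring

theorem IsTemperate.wact_sub_fun {N : ℕ} {p : ℝ × ℝ → ℝ} (hp : IsTemperate N p)
    {F G : ℝ × ℝ → ℂ} (hFm : AEStronglyMeasurable F volume) (hGm : AEStronglyMeasurable G volume)
    {C C' : ℝ} (hF : ∀ z, ‖F z‖ ≤ C) (hG : ∀ z, ‖G z‖ ≤ C') (w : ℝ × ℝ) :
    wact p (fun z => F z - G z) w = wact p F w - wact p G w := by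
  simp only [wact, sub_mul]
  exact integral_sub (hp.integrable_mul_wm hFm hF w) (hp.integrable_mul_wm hGm hG w)

theorem IsTemperate.wact_sub {N N' : ℕ} {p q : ℝ × ℝ → ℝ} (hp : IsTemperate N p)
    (hq : IsTemperate N' q) {F : ℝ × ℝ → ℂ} (hFm : AEStronglyMeasurable F volume)
    {C : ℝ} (hF : ∀ z, ‖F z‖ ≤ C) (w : ℝ × ℝ) :
    wact (fun z => p z - q z) F w = wact p F w - wact q F w := by
  obtain ⟨A, _, hA⟩ := hp.exists_le
  obtain ⟨A', _, hA'⟩ := hq.exists_le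
  simp only [wact, wm_sub hp.continuous hq.continuous hA hA', mul_sub]
  exact integral_sub (hp.integrable_mul_wm hFm hF w) (hq.integrable_mul_wm hFm hF w)

theorem wact_const_mul (a : ℝ) (p : ℝ × ℝ → ℝ) (F : ℝ × ℝ → ℂ) (w : ℝ × ℝ) :
    wact (fun z => a * p z) F w = a * wact p F w := by
  simp only [wact, wm_const_mul, ← integral_const_mul]
  congr 1; ext z; ring

theorem wact_one_bt {u : ℝ → ℂ} (hu : MemLp u 2 volume) : wact (fun _ => 1) (bt u) = bt u := by
  ext w
  rw [wact, wm_one, integral_bt_mul_gram hu]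

theorem IsBump.rapidDecay_wact {χ : ℝ × ℝ → ℝ} (hχ : IsBump χ) {F : ℝ × ℝ → ℂ}
    (hFm : AEStronglyMeasurable F volume) {C : ℝ} (hF : ∀ z, ‖F z‖ ≤ C) : RapidDecay (wact χ F) where
  aesm := aestronglyMeasurable_wact hχ.smooth.continuous hFm
  decay k := by
    obtain ⟨B, hB⟩ := hχ.exists_hasSymbolBounds (continuous_inv_br_pow k) fun z => inv_br_pow_pos z k
    obtain ⟨K, hK0, hK⟩ := exists_norm_wact_le 1 k B 1 0 zero_le_one
    have hC : 0 ≤ C := (norm_nonneg _).trans (hF 0)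
    refine ⟨K * C + 1, by positivity, fun w => ?_⟩
    have := hK _ χ (isWeight_inv_br_pow k) hB _ isWeight_one F C hC (by simpa using hF) w
    have h2 := inv_br_pow_pos w k
    nlinarith

/-- The kernel `wm p` is hermitian. -/
theorem integral_wact_mul_conj {N : ℕ} {p : ℝ × ℝ → ℝ} (hp : IsTemperate N p) {F G : ℝ × ℝ → ℂ}
    (hF : RapidDecay F) (hGm : AEStronglyMeasurable G volume) {C : ℝ} (hG : ∀ z, ‖G z‖ ≤ C) :
    ∫ w, wact p F w * conj (G w) = ∫ z, F z * conj (wact p G z) := by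
  obtain ⟨K, hK0, hK⟩ := hp.exists_norm_wm_le' 3
  obtain ⟨A, hA0, hA⟩ := hF.decay (N + 3 + 3)
  have hC : 0 ≤ C := (norm_nonneg _).trans (hG 0)
  have hi : Integrable (fun q : (ℝ × ℝ) × (ℝ × ℝ) => F q.2 * wm p q.2 q.1 * conj (G q.1)) := by
    have hi := (integrable_inv_br_pow (k := 3) le_rfl).mul_prod
      (integrable_inv_br_pow (k := 3) le_rfl)
    refine (hi.const_mul (A * K * C)).mono' ?_ (ae_of_all _ fun q => ?_)
    · exact (hF.aesm.comp_snd.mul ((stronglyMeasurable_wm hp.continuous).comp_measurable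
        measurable_swap).aestronglyMeasurable).mul
        (Complex.continuous_conj.comp_aestronglyMeasurable hGm).comp_fst
    · have h1 := br_pos q.1
      have h2 := br_pos q.2
      rw [norm_mul, norm_mul, RCLike.norm_conj]
      calc _ ≤ (A * (br q.2 ^ (N + 3 + 3))⁻¹) * (K * br q.2 ^ (N + 3) * (br q.1 ^ 3)⁻¹) * C := by
            gcongr
            · exact hA _
            · exact hK _ _
            · exact hG _
        _ = _ := by rw [pow_add (br q.2) (N + 3)]; field_simp
  rw [Measure.volume_eq_prod] at hi
  have hs := integral_integral_swap (f := fun w z : ℝ × ℝ => F z * wm p z w * conj (G w)) hi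
  simp only [wact, ← integral_mul_const]
  rw [hs]
  congr 1; ext z
  simp_rw [mul_assoc, integral_const_mul]
  rw [← integral_conj]
  congr 2; ext w
  rw [map_mul, conj_wm, mul_comm]

theorem IsBump.integral_wact_mul_conj {χ : ℝ × ℝ → ℝ} (hχ : IsBump χ) {F G : ℝ × ℝ → ℂ}
    (hFm : AEStronglyMeasurable F volume) (hGm : AEStronglyMeasurable G volume) {C C' : ℝ}
    (hF : ∀ z, ‖F z‖ ≤ C) (hG : ∀ z, ‖G z‖ ≤ C') :
    ∫ w, wact χ F w * conj (G w) = ∫ z, F z * conj (wact χ G z) := by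
  obtain ⟨K, hK0, hK⟩ := hχ.exists_norm_wm_le 3
  have hC : 0 ≤ C := (norm_nonneg _).trans (hF 0)
  have hi : Integrable (fun q : (ℝ × ℝ) × (ℝ × ℝ) => F q.2 * wm χ q.2 q.1 * conj (G q.1)) := by
    have hi := (integrable_inv_br_pow (k := 3) le_rfl).mul_prod
      (integrable_inv_br_pow (k := 3) le_rfl)
    refine (hi.const_mul (C * K * C')).mono' ?_ (ae_of_all _ fun q => ?_)
    · exact (hFm.comp_snd.mul ((stronglyMeasurable_wm hχ.smooth.continuous).comp_measurable
        measurable_swap).aestronglyMeasurable).mul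
        (Complex.continuous_conj.comp_aestronglyMeasurable hGm).comp_fst
    · have h1 := br_pos q.1
      have h2 := br_pos q.2
      rw [norm_mul, norm_mul, RCLike.norm_conj]
      calc _ ≤ C * (K * (br q.2 ^ 3)⁻¹ * (br q.1 ^ 3)⁻¹) * C' := by
            gcongr
            · exact hF _
            · exact hK _ _
            · exact hG _
        _ = _ := by ring
  rw [Measure.volume_eq_prod] at hi
  have hs := integral_integral_swap (f := fun w z : ℝ × ℝ => F z * wm χ z w * conj (G w)) hi
  simp only [wact, ← integral_mul_const]
  rw [hs]
  congr 1; ext z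
  simp_rw [mul_assoc, integral_const_mul]
  rw [← integral_conj]
  congr 2; ext w
  rw [map_mul, conj_wm, mul_comm]

/-! ### Weyl operators on `L²` functions -/

/-- For `u` in `L²` the function `bt u` need not decay, so `u` cannot be written as a superposition.
The value at `x` is instead the pairing of `u` with the integral kernel, transported to phase space
by the isometry. -/
theorem IsBump.nW_eq_syn {χ : ℝ × ℝ → ℝ} (hχ : IsBump χ) {u : ℝ → ℂ} (hu : MemLp u 2 volume) :
    nW χ u = syn (wact χ (bt u)) := by
  ext x
  obtain ⟨K, hK0, hK⟩ := hχ.exists_norm_wm_le 3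
  have h1 : nW χ u x = ∫ z, bt u z * syn (wm χ z) x := by
    rw [hχ.nW_eq hu]
    have h := integral_bt_mul_conj_bt hu (hχ.memLp_nK' x)
    simp_rw [hχ.bt_nK, conj_nK, Complex.conj_conj] at h
    exact h.symm
  have hi : Integrable (fun q : (ℝ × ℝ) × (ℝ × ℝ) => bt u q.1 * wm χ q.1 q.2 * gs q.2 x) := by
    have hi := (integrable_inv_br_pow (k := 3) le_rfl).mul_prod
      (integrable_inv_br_pow (k := 3) le_rfl)
    refine (hi.const_mul (lpNorm u 2 volume * K * 2)).mono' ?_ (ae_of_all _ fun q => ?_)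
    · exact ((aestronglyMeasurable_bt hu.1).comp_fst.mul
        (stronglyMeasurable_wm hχ.smooth.continuous).aestronglyMeasurable).mul
        (by fun_prop : Continuous fun q : (ℝ × ℝ) × (ℝ × ℝ) => gs q.2 x).aestronglyMeasurable
    · have h1 := br_pos q.1
      have h2 := br_pos q.2
      have h3 : 0 ≤ lpNorm u 2 volume := lpNorm_nonneg
      rw [norm_mul, norm_mul]
      calc _ ≤ lpNorm u 2 volume * (K * (br q.1 ^ 3)⁻¹ * (br q.2 ^ 3)⁻¹) * 2 := by
            gcongr
            · exact norm_bt_le hu _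
            · exact hK _ _
            · exact norm_gs_le_two _ _
        _ = _ := by ring
  rw [Measure.volume_eq_prod] at hi
  have hs := integral_integral_swap (f := fun z w : ℝ × ℝ => bt u z * wm χ z w * gs w x) hi
  rw [h1]
  simp only [syn, wact, ← integral_mul_const, ← integral_const_mul, ← mul_assoc]
  exact hs

theorem IsBump.rapidDecay_wact_bt {χ : ℝ × ℝ → ℝ} (hχ : IsBump χ) {u : ℝ → ℂ}
    (hu : MemLp u 2 volume) : RapidDecay (wact χ (bt u)) :=
  hχ.rapidDecay_wact (aestronglyMeasurable_bt hu.1) (norm_bt_le hu)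

theorem IsBump.memLp_nW {χ : ℝ × ℝ → ℝ} (hχ : IsBump χ) {u : ℝ → ℂ}
    (hu : MemLp u 2 volume) : MemLp (nW χ u) 2 volume := by
  rw [hχ.nW_eq_syn hu]
  exact memLp_syn (hχ.rapidDecay_wact_bt hu)

theorem IsBump.bt_nW {χ : ℝ × ℝ → ℝ} (hχ : IsBump χ) {u : ℝ → ℂ}
    (hu : MemLp u 2 volume) : bt (nW χ u) = wact χ (bt u) := by
  ext w
  obtain ⟨K, hK0, hK⟩ := hχ.exists_norm_wm_le 3
  rw [hχ.nW_eq_syn hu, bt_syn (hχ.rapidDecay_wact_bt hu)]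
  obtain ⟨A, _, hA⟩ := (hχ.isTemperate 0).exists_le
  have hi : Integrable (fun q : (ℝ × ℝ) × (ℝ × ℝ) => bt u q.2 * wm χ q.2 q.1 * gram q.1 w) := by
    have hi := (integrable_inv_br_pow (k := 3) le_rfl).mul_prod
      (integrable_inv_br_pow (k := 3) le_rfl)
    refine (hi.const_mul (lpNorm u 2 volume * K)).mono' ?_ (ae_of_all _ fun q => ?_)
    · exact ((aestronglyMeasurable_bt hu.1).comp_snd.mul
        ((stronglyMeasurable_wm hχ.smooth.continuous).comp_measurable
          measurable_swap).aestronglyMeasurable).mul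
        (by fun_prop : Continuous fun q : (ℝ × ℝ) × (ℝ × ℝ) => gram q.1 w).aestronglyMeasurable
    · have h1 := br_pos q.1
      have h2 := br_pos q.2
      have h3 : 0 ≤ lpNorm u 2 volume := lpNorm_nonneg
      have hg : ‖gram q.1 w‖ ≤ 1 := by
        rw [← bt_gs]
        exact (norm_bt_le (memLp_gs _) _).trans (lpNorm_gs _).le
      rw [norm_mul, norm_mul]
      calc _ ≤ lpNorm u 2 volume * (K * (br q.2 ^ 3)⁻¹ * (br q.1 ^ 3)⁻¹) * 1 := by
            gcongr
            · exact norm_bt_le hu _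
            · exact hK _ _
        _ = _ := by ring
  rw [Measure.volume_eq_prod] at hi
  have hs := integral_integral_swap (f := fun v z : ℝ × ℝ => bt u z * wm χ z v * gram v w) hi
  simp only [wact, ← integral_mul_const]
  rw [hs]
  simp_rw [mul_assoc, integral_const_mul, integral_wm_mul_gram hχ.smooth.continuous hA]

/-! ### The sesquilinear form `(Op(p) Op(χ) u | v)` -/

/-- The sesquilinear form `(Op(p) Op(χ) u | v)`, in terms of matrix elements. -/
def bform (p χ : ℝ × ℝ → ℝ) (u v : ℝ → ℂ) : ℂ := ∫ z, wact χ (bt u) z * conj (wact p (bt v) z)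

/-- The smoothing operator `Op(χ)` applied to the distribution `Op(p) u`. -/
def nS (χ p : ℝ × ℝ → ℝ) (u : ℝ → ℂ) (x : ℝ) : ℂ := ∫ y, u y * conj (nW p (fun y => nK χ y x) y)

section
variable {N : ℕ} {p χ ψ : ℝ × ℝ → ℝ} {u v : ℝ → ℂ}

theorem IsTemperate.nW_nW_ae_eq (hp : IsTemperate N p) (hχ : IsBump χ) (hu : MemLp u 2 volume) :
    nW p (nW χ u) =ᵐ[volume] syn (wact p (wact χ (bt u))) := by
  rw [hχ.nW_eq_syn hu]
  exact nW_syn_ae_eq hp (hχ.rapidDecay_wact_bt hu)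

theorem IsTemperate.memLp_nW_nW (hp : IsTemperate N p) (hχ : IsBump χ) (hu : MemLp u 2 volume) :
    MemLp (nW p (nW χ u)) 2 volume :=
  (memLp_congr_ae (hp.nW_nW_ae_eq hχ hu)).2 (memLp_syn (rapidDecay_wact hp (hχ.rapidDecay_wact_bt hu)))

theorem integral_nW_nW_mul_conj (hp : IsTemperate N p) (hχ : IsBump χ) (hu : MemLp u 2 volume)
    (hv : MemLp v 2 volume) : ∫ x, nW p (nW χ u) x * conj (v x) = bform p χ u v := by
  rw [bform, ← integral_wact_mul_conj hp (hχ.rapidDecay_wact_bt hu) (aestronglyMeasurable_bt hv.1)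
    (norm_bt_le hv), ← integral_syn_mul_conj (rapidDecay_wact hp (hχ.rapidDecay_wact_bt hu)) hv]
  exact integral_congr_ae ((hp.nW_nW_ae_eq hχ hu).mono fun x hx => by simp only [hx])

/-- The kernel `nK χ · x` has a rapidly decaying transform, so `Op(p)` acts on it through its matrix
elements, and hermitian symmetry moves them onto `u`. Thus `wact p (bt u)`, of polynomial growth,
stands for the distribution `Op(p) u`. -/
theorem nS_eq (hp : IsTemperate N p) (hχ : IsBump χ) (hu : MemLp u 2 volume) (x : ℝ) :
    nS χ p u x = ∫ z, wact p (bt u) z * syn (wm χ z) x := by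
  have hRD := hχ.rapidDecay_bt_nK x
  have h1 : nW p (fun y => nK χ y x) =ᵐ[volume] syn (wact p (bt fun y => nK χ y x)) := by
    rw [nW_congr_ae p (ae_eq_syn_bt (hχ.memLp_nK' x) hRD)]
    exact nW_syn_ae_eq hp hRD
  have h2 : nS χ p u x = ∫ y, u y * conj (syn (wact p (bt fun y => nK χ y x)) y) :=
    integral_congr_ae (h1.mono fun y hy => by simp only [hy])
  rw [h2, integral_conj_comm, integral_syn_mul_conj (rapidDecay_wact hp hRD) hu,
    integral_wact_mul_conj hp hRD (aestronglyMeasurable_bt hu.1) (norm_bt_le hu), ← integral_conj]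
  congr 1; ext z
  rw [hχ.bt_nK, map_mul, Complex.conj_conj, Complex.conj_conj, mul_comm]

theorem memLp_nS (hp : IsTemperate N p) (hχ : IsBump χ) (hu : MemLp u 2 volume) :
    MemLp (nS χ p u) 2 volume := by
  obtain ⟨K, hK0, hK⟩ := hp.exists_norm_wact_le (norm_bt_le hu)
  obtain ⟨A, hA0, hA⟩ := hχ.exists_norm_syn_wm_le (N + 3)
  rw [funext (nS_eq hp hχ hu)]
  refine memLp_of_norm_le (C := K * A * ∫ z : ℝ × ℝ, (br z ^ 3)⁻¹) ?_ fun x => ?_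
  · refine AEStronglyMeasurable.integral_prod_right'
      (f := fun q : ℝ × (ℝ × ℝ) => wact p (bt u) q.2 * syn (wm χ q.2) q.1) ?_
    exact (aestronglyMeasurable_wact hp.continuous (aestronglyMeasurable_bt hu.1)).comp_snd.mul
      ((stronglyMeasurable_syn_wm hχ.smooth.continuous).comp_measurable
        measurable_swap).aestronglyMeasurable
  · calc _ ≤ ∫ z : ℝ × ℝ, K * A * (br x ^ 2)⁻¹ * (br z ^ 3)⁻¹ := by
          refine norm_integral_le_of_norm_le ((integrable_inv_br_pow (k := 3) le_rfl).const_mul _)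
            (ae_of_all _ fun z => ?_)
          have hz := br_pos z
          have hx := br_pos x
          rw [norm_mul]
          calc _ ≤ (K * br z ^ N) * (A * (br z ^ (N + 3))⁻¹ * (br x ^ 2)⁻¹) := by
                gcongr
                · exact hK z
                · refine (hA z x).trans ?_
                  have := inv_br_pow_anti x (show 2 ≤ N + 3 by omega)
                  gcongr
            _ = _ := by rw [pow_add (br z)]; field_simp
      _ = _ := by rw [integral_const_mul]; ring

theorem integral_nS_mul_conj (hp : IsTemperate N p) (hχ : IsBump χ) (hu : MemLp u 2 volume)
    (hv : MemLp v 2 volume) : ∫ x, nS χ p u x * conj (v x) = conj (bform p χ v u) := by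
  obtain ⟨K, hK0, hK⟩ := hp.exists_norm_wact_le (norm_bt_le hu)
  obtain ⟨A, hA0, hA⟩ := hχ.exists_norm_syn_wm_le (N + 3)
  have hi : Integrable (fun q : ℝ × (ℝ × ℝ) =>
      wact p (bt u) q.2 * syn (wm χ q.2) q.1 * conj (v q.1)) := by
    have hi := (integrable_mul_of_memLp memLp_inv_br_sq hv).norm.mul_prod
      (integrable_inv_br_pow (k := 3) le_rfl)
    refine (hi.const_mul (K * A)).mono' ?_ (ae_of_all _ fun q => ?_)
    · refine AEStronglyMeasurable.mul ?_ (memLp_conj hv).1.comp_fst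
      exact (aestronglyMeasurable_wact hp.continuous (aestronglyMeasurable_bt hu.1)).comp_snd.mul
        ((stronglyMeasurable_syn_wm hχ.smooth.continuous).comp_measurable
          measurable_swap).aestronglyMeasurable
    · have hz := br_pos q.2
      have hx := br_pos q.1
      simp only [norm_mul, RCLike.norm_conj, Complex.norm_real, norm_inv, norm_pow,
        Real.norm_of_nonneg hx.le]
      calc _ ≤ (K * br q.2 ^ N) * (A * (br q.2 ^ (N + 3))⁻¹ * (br q.1 ^ 2)⁻¹) * ‖v q.1‖ := by
            gcongr
            · exact hK q.2
            · refine (hA q.2 q.1).trans ?_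
              have := inv_br_pow_anti q.1 (show 2 ≤ N + 3 by omega)
              gcongr
        _ = _ := by rw [pow_add (br q.2)]; field_simp
  rw [Measure.volume_eq_prod] at hi
  have hs := integral_integral_swap (f := fun (x : ℝ) (z : ℝ × ℝ) =>
    wact p (bt u) z * syn (wm χ z) x * conj (v x)) hi
  simp_rw [nS_eq hp hχ hu, ← integral_mul_const]
  rw [hs, bform, ← integral_conj]
  congr 1; ext z
  simp_rw [mul_assoc, integral_const_mul]
  rw [integral_syn_mul_conj (hχ.rapidDecay_wm z) hv, map_mul, Complex.conj_conj, mul_comm]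
  congr 1
  rw [wact, ← integral_conj]
  congr 1; ext w
  rw [map_mul, conj_wm, mul_comm]

theorem integral_nW_mul_conj (hχ : IsBump χ) (hu : MemLp u 2 volume) (hv : MemLp v 2 volume) :
    ∫ x, nW χ u x * conj (v x) = bform (fun _ => 1) χ u v := by
  rw [bform, wact_one_bt hv, ← hχ.bt_nW hu, integral_bt_mul_conj_bt (hχ.memLp_nW hu) hv]

theorem integral_mul_conj_nW (hχ : IsBump χ) (hu : MemLp u 2 volume) (hv : MemLp v 2 volume) :
    ∫ x, u x * conj (nW χ v x) = bform (fun _ => 1) χ u v := by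
  rw [← integral_nW_mul_conj hχ hu hv, ← integral_bt_mul_conj_bt hu (hχ.memLp_nW hv),
    ← integral_bt_mul_conj_bt (hχ.memLp_nW hu) hv, hχ.bt_nW hu, hχ.bt_nW hv,
    hχ.integral_wact_mul_conj (aestronglyMeasurable_bt hu.1) (aestronglyMeasurable_bt hv.1)
    (norm_bt_le hu) (norm_bt_le hv)]

/-- Formal self-adjointness of `Op(p)`, for real `p`. It exchanges the roles of `χ` and `ψ`, so that
either of the two cut-offs can be modified. -/
theorem bform_nW_right (hp : IsTemperate N p) (hχ : IsBump χ) (hψ : IsBump ψ) (hu : MemLp u 2 volume)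
    (hv : MemLp v 2 volume) : bform p χ u (nW ψ v) = conj (bform p ψ v (nW χ u)) := by
  obtain ⟨C, hC⟩ := (hψ.rapidDecay_wact_bt hv).bounded
  rw [bform, bform, hψ.bt_nW hv, hχ.bt_nW hu, ← integral_wact_mul_conj hp (hχ.rapidDecay_wact_bt hu)
    (hψ.rapidDecay_wact_bt hv).aesm hC, integral_conj_comm]

end

/-! ### Dilated symbols and weights -/

/-- The derivatives gain factors `l ^ k ≤ 1`, hence the constants `B` are uniform in `l`. -/
theorem HasSymbolBounds.dilate {B : ℕ → ℝ} {𝔴 c : ℝ × ℝ → ℝ} (hc : HasSymbolBounds B 𝔴 c) {l : ℝ}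
    (h0 : 0 ≤ l) (h1 : l ≤ 1) : HasSymbolBounds B (fun z => 𝔴 (l • z)) (fun z => c (l • z)) where
  smooth := hc.smooth.comp (contDiff_const_smul l)
  bound k z := by
    have h := norm_iteratedFDeriv_comp_add_clm_le hc.smooth (l • ContinuousLinearMap.id ℝ (ℝ × ℝ)) 0 k z
    simp only [zero_add, smul_apply, ContinuousLinearMap.id_apply] at h
    refine h.trans (le_trans (mul_le_of_le_one_right (norm_nonneg _) (pow_le_one₀ (norm_nonneg _) ?_))
      (hc.bound k (l • z)))
    rw [norm_smul, Real.norm_of_nonneg h0]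
    exact mul_le_one₀ h1 (norm_nonneg _) ContinuousLinearMap.norm_id_le

theorem br_smul_le {E : Type*} [NormedAddCommGroup E] [NormedSpace ℝ E] (z : E) {l : ℝ} (h0 : 0 ≤ l)
    (h1 : l ≤ 1) : br (l • z) ≤ br z := by
  unfold br
  rw [norm_smul, Real.norm_of_nonneg h0]
  linarith [mul_le_of_le_one_left (norm_nonneg z) h1]

theorem IsWeight.dilate {C : ℝ} (hC : 0 ≤ C) {N : ℕ} {𝔴 : ℝ × ℝ → ℝ} (h𝔴 : IsWeight C N 𝔴) {l : ℝ}
    (h0 : 0 ≤ l) (h1 : l ≤ 1) : IsWeight C N (fun z => 𝔴 (l • z)) where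
  nonneg z := h𝔴.nonneg _
  le z w := by
    refine (h𝔴.le (l • z) (l • w)).trans ?_
    have := h𝔴.nonneg (l • w)
    have h2 := br_pos (l • (z - w))
    rw [← smul_sub]
    gcongr
    exact br_smul_le _ h0 h1

/-- The weight `(1 + dist (l z, S) / l) ^ (-k)`. -/
def dw (l : ℝ) (S : Set (ℝ × ℝ)) (k : ℕ) (z : ℝ × ℝ) : ℝ := ((1 + Metric.infDist (l • z) S / l) ^ k)⁻¹

section
variable {l : ℝ} {S : Set (ℝ × ℝ)} {k : ℕ}

theorem one_le_dw_base (h0 : 0 < l) (z : ℝ × ℝ) : 1 ≤ 1 + Metric.infDist (l • z) S / l :=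
  le_add_of_nonneg_right (div_nonneg Metric.infDist_nonneg h0.le)

theorem dw_pos (h0 : 0 < l) (z : ℝ × ℝ) : 0 < dw l S k z :=
  inv_pos.2 (pow_pos (one_pos.trans_le (one_le_dw_base h0 z)) k)

/-- The distance of `l z` to `S` is measured in units of `l`, hence is 1-Lipschitz in `z`. The
constants of the weight therefore do not depend on `l`. -/
theorem isWeight_dw (h0 : 0 < l) : IsWeight 1 k (dw l S k) where
  nonneg z := (dw_pos h0 z).le
  le z w := by
    have hz := one_pos.trans_le (one_le_dw_base (S := S) h0 z)
    have hw := one_pos.trans_le (one_le_dw_base (S := S) h0 w)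
    have hb := br_pos (z - w)
    rw [dw, dw, one_mul, ← div_eq_mul_inv, le_div_iff₀ (by positivity), inv_mul_le_iff₀ (by positivity),
      ← mul_pow]
    refine pow_le_pow_left₀ hw.le ?_ k
    have h1 : Metric.infDist (l • w) S ≤ Metric.infDist (l • z) S + l * ‖z - w‖ := by
      have := Metric.infDist_le_infDist_add_dist (s := S) (x := l • w) (y := l • z)
      rwa [dist_eq_norm, ← smul_sub, norm_smul, Real.norm_of_nonneg h0.le, norm_sub_rev] at this
    have h2 : Metric.infDist (l • w) S / l ≤ Metric.infDist (l • z) S / l + ‖z - w‖ := by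
      rw [div_add' _ _ _ h0.ne', div_le_div_iff_of_pos_right h0]
      linarith
    have h3 : 0 ≤ Metric.infDist (l • z) S / l := div_nonneg Metric.infDist_nonneg h0.le
    unfold br
    nlinarith [norm_nonneg (z - w), mul_nonneg h3 (norm_nonneg (z - w))]

/-- The weight equals one on the support and the derivatives vanish off it, so arbitrary decay away
from the support is encoded without changing the constants. -/
theorem HasSymbolBounds.dilate_dw {B : ℕ → ℝ} {c : ℝ × ℝ → ℝ} (hc : HasSymbolBounds B (fun _ => 1) c)
    (h0 : 0 < l) (h1 : l ≤ 1) (k : ℕ) :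
    HasSymbolBounds B (dw l (tsupport c) k) (fun z => c (l • z)) where
  smooth := hc.smooth.comp (contDiff_const_smul l)
  bound j z := by
    have hB : 0 ≤ B j := by simpa using (norm_nonneg _).trans (hc.bound j 0)
    by_cases hz : l • z ∈ tsupport c
    · have : dw l (tsupport c) k z = 1 := by
        rw [dw, Metric.infDist_zero_of_mem hz]; simp
      rw [this]
      exact (hc.dilate h0.le h1).bound j z
    · have h3 : z ∉ tsupport (fun z => c (l • z)) := fun h => hz
        (tsupport_comp_subset_preimage c (continuous_const_smul l) h)
      have h2 : iteratedFDeriv ℝ j (fun z => c (l • z)) z = 0 :=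
        image_eq_zero_of_notMem_tsupport fun h => h3 (tsupport_iteratedFDeriv_subset j h)
      rw [h2, norm_zero]
      exact mul_nonneg hB (dw_pos h0 z).le

theorem dw_add (z : ℝ × ℝ) (j : ℕ) : dw l S (j + k) z = dw l S j z * dw l S k z := by
  rw [dw, pow_add, mul_inv]; rfl

/-- For bounded `S` the weight also decays at infinity, at the price of negative powers of `l`; this
supplies integrability over phase space. -/
theorem dw_le {R : ℝ} (hS : S.Nonempty) (hR : ∀ s ∈ S, ‖s‖ ≤ R) (h0 : 0 < l) (h1 : l ≤ 1) (z : ℝ × ℝ) :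
    dw l S k z ≤ ((1 + R) / l) ^ k * (br z ^ k)⁻¹ := by
  have hb := br_pos z
  have hz := one_pos.trans_le (one_le_dw_base (S := S) h0 z)
  have hR0 : 0 ≤ R := (norm_nonneg _).trans (hR _ hS.some_mem)
  have key : br z ≤ (1 + R) / l * (1 + Metric.infDist (l • z) S / l) := by
    have h2 : l * ‖z‖ - R ≤ Metric.infDist (l • z) S := by
      refine (Metric.le_infDist hS).2 fun s hs => ?_
      have := norm_sub_norm_le (l • z) s
      rw [norm_smul, Real.norm_of_nonneg h0.le] at this
      rw [dist_eq_norm]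
      linarith [hR s hs]
    have h3 : ‖z‖ ≤ Metric.infDist (l • z) S / l + R / l := by
      rw [← add_div, le_div_iff₀ h0]; linarith
    have h4 : 1 ≤ 1 / l := (one_le_div h0).2 h1
    have h5 : 0 ≤ R / l := div_nonneg hR0 h0.le
    have h6 : 0 ≤ Metric.infDist (l • z) S / l := div_nonneg Metric.infDist_nonneg h0.le
    rw [add_div]
    unfold br
    nlinarith [mul_nonneg h5 h6, mul_nonneg (sub_nonneg.2 h4) h6]
  rw [dw, ← div_eq_mul_inv, le_div_iff₀ (by positivity), inv_mul_le_iff₀ (by positivity), ← mul_pow]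
  exact pow_le_pow_left₀ hb.le (by rwa [mul_comm]) k

/-- The source of the powers of `h`: no point is close to both sets, so the product of the two bases
is at least `δ / l`. -/
theorem dw_mul_dw_le {S' : Set (ℝ × ℝ)} {δ : ℝ} (hδ : 0 < δ)
    (hS : ∀ x, δ ≤ Metric.infDist x S + Metric.infDist x S') (h0 : 0 < l) (z : ℝ × ℝ) :
    dw l S k z * dw l S' k z ≤ (l / δ) ^ k := by
  have h1 : 0 ≤ Metric.infDist (l • z) S / l := div_nonneg Metric.infDist_nonneg h0.le
  have h2 : 0 ≤ Metric.infDist (l • z) S' / l := div_nonneg Metric.infDist_nonneg h0.le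
  have h3 : δ / l ≤ (1 + Metric.infDist (l • z) S / l) * (1 + Metric.infDist (l • z) S' / l) := by
    have : δ / l ≤ Metric.infDist (l • z) S / l + Metric.infDist (l • z) S' / l := by
      rw [← add_div]; gcongr; exact hS _
    nlinarith [mul_nonneg h1 h2]
  rw [dw, dw, ← mul_inv, ← mul_pow, ← inv_pow, ← inv_div δ l]
  refine pow_le_pow_left₀ (by positivity) (inv_anti₀ (by positivity) h3) k

end

theorem exists_le_infDist_add_infDist {S S' : Set (ℝ × ℝ)} (hS : IsCompact S) (hS' : IsClosed S')
    (h : Disjoint S S') (hne : S.Nonempty) (hne' : S'.Nonempty) :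
    ∃ δ : ℝ, 0 < δ ∧ ∀ x, δ ≤ Metric.infDist x S + Metric.infDist x S' := by
  obtain ⟨r, hr0, hr⟩ := Metric.exists_pos_forall_lt_edist hS hS' h
  refine ⟨r, hr0, fun x => ?_⟩
  have h1 : r - Metric.infDist x S' ≤ Metric.infDist x S := by
    refine (Metric.le_infDist hne).2 fun y hy => ?_
    have h2 : r - dist x y ≤ Metric.infDist x S' := by
      refine (Metric.le_infDist hne').2 fun y' hy' => ?_
      have h3 := hr y hy y' hy'
      rw [edist_nndist] at h3
      have h4 : (r : ℝ) < dist y y' := by exact_mod_cast h3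
      linarith [dist_triangle_left y y' x]
    linarith
  linarith

/-! ### Semiclassical estimates -/

theorem IsOrderFunction.exists_isWeight {m : ℝ × ℝ → ℝ} (hm : IsOrderFunction m) :
    ∃ C N, 0 < C ∧ IsWeight C N m := by
  obtain ⟨h0, C, N, h⟩ := hm
  refine ⟨C, N, ?_, fun z => (h0 z).le, h⟩
  have h1 := h 0 0
  simp only [sub_self, norm_zero, add_zero, one_pow, mul_one] at h1
  by_contra hC
  nlinarith [h0 0]

theorem isWeight_dilate_le {C : ℝ} {N : ℕ} {m : ℝ × ℝ → ℝ} (hm : IsWeight C N m) (hC : 0 ≤ C) {l : ℝ}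
    (h0 : 0 < l) (h1 : l ≤ 1) (z : ℝ × ℝ) : m (l • z) ≤ C * m 0 * br z ^ N := by
  have h := (hm.dilate hC h0.le h1).le z 0
  simp only [smul_zero, sub_zero] at h
  linarith

theorem IsBump.hasSymbolBounds {χ : ℝ × ℝ → ℝ} (hχ : IsBump χ) :
    ∃ B, HasSymbolBounds B (fun _ => 1) χ :=
  hχ.exists_hasSymbolBounds continuous_const fun _ => one_pos

theorem wact_zero_symbol (F : ℝ × ℝ → ℂ) : wact (fun _ => 0) F = fun _ => 0 := by
  ext w; simp [wact, wm]

theorem wact_zero (p : ℝ × ℝ → ℝ) : wact p (fun _ => 0) = fun _ => 0 := by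
  ext w; simp [wact]

/-- Operators with symbols of disjoint supports compose to negligible ones. -/
theorem exists_norm_bform_disjoint_le {C : ℝ} (hC : 0 < C) {N : ℕ} {m : ℝ × ℝ → ℝ} (hm : IsWeight C N m)
    (B : ℕ → ℝ) {χ : ℝ × ℝ → ℝ} (hχ : IsBump χ) {Bφ : ℕ → ℝ} {φ : ℝ × ℝ → ℝ}
    (hφ : HasSymbolBounds Bφ (fun _ => 1) φ) (hd : Disjoint (tsupport χ) (tsupport φ)) (n : ℕ) :
    ∃ K : ℝ, 0 < K ∧ ∀ l : ℝ, 0 < l → l ≤ 1 → ∀ q, HasSymbolBounds B m q → ∀ u v : ℝ → ℂ,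
      MemLp u 2 volume → MemLp v 2 volume →
      ‖∫ z, wact (fun z => χ (l • z)) (bt u) z *
        conj (wact (fun z => q (l • z)) (wact (fun z => φ (l • z)) (bt v)) z)‖ ≤
        K * l ^ n * (lpNorm u 2 volume * lpNorm v 2 volume) := by
  rcases (tsupport χ).eq_empty_or_nonempty with hne | hne
  · rw [tsupport_eq_empty_iff] at hne
    refine ⟨1, one_pos, fun l h0 h1 q hq u v hu hv => ?_⟩
    simp only [hne, Pi.zero_apply, wact_zero_symbol, zero_mul, integral_zero, norm_zero]
    have h3 : 0 ≤ lpNorm u 2 volume := lpNorm_nonneg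
    have h4 : 0 ≤ lpNorm v 2 volume := lpNorm_nonneg
    positivity
  rcases (tsupport φ).eq_empty_or_nonempty with hne' | hne'
  · rw [tsupport_eq_empty_iff] at hne'
    refine ⟨1, one_pos, fun l h0 h1 q hq u v hu hv => ?_⟩
    simp only [hne', Pi.zero_apply, wact_zero_symbol, wact_zero, map_zero, mul_zero, integral_zero,
      norm_zero]
    have h3 : 0 ≤ lpNorm u 2 volume := lpNorm_nonneg
    have h4 : 0 ≤ lpNorm v 2 volume := lpNorm_nonneg
    positivity
  obtain ⟨δ, hδ, hδS⟩ := exists_le_infDist_add_infDist hχ.compact (isClosed_tsupport φ) hd hne hne'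
  obtain ⟨R, hR⟩ := hχ.compact.isBounded.exists_norm_le
  have hR0 : 0 ≤ R := (norm_nonneg _).trans (hR _ hne.some_mem)
  obtain ⟨Bχ, hBχ⟩ := hχ.hasSymbolBounds
  -- Separation of the supports gains `l ^ k2`. Of this, `N + 3` powers are spent on decay in `z`:
  -- `N` against the growth of `m` and three for integrability.
  set k2 := n + (N + 3) with hk2
  obtain ⟨K1, hK10, hK1⟩ := exists_norm_wact_le 1 (k2 + (N + 3)) Bχ 1 0 zero_le_one
  obtain ⟨K2, hK20, hK2⟩ := exists_norm_wact_le 1 k2 Bφ 1 0 zero_le_one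
  obtain ⟨K3, hK30, hK3⟩ := exists_norm_wact_le C N B 1 k2 zero_le_one
  have hI : 0 ≤ ∫ w : ℝ × ℝ, (br w ^ 3)⁻¹ := integral_nonneg fun w => (inv_br_pow_pos w 3).le
  have hm0 := hm.nonneg 0
  refine ⟨K1 * K3 * K2 * (δ⁻¹ ^ k2) * (1 + R) ^ (N + 3) * (C * m 0) * (∫ w : ℝ × ℝ, (br w ^ 3)⁻¹) + 1,
    by positivity, fun l h0 h1 q hq u v hu hv => ?_⟩
  have hu0 : 0 ≤ lpNorm u 2 volume := lpNorm_nonneg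
  have hv0 : 0 ≤ lpNorm v 2 volume := lpNorm_nonneg
  have e1 : ∀ z, ‖wact (fun z => χ (l • z)) (bt u) z‖ ≤
      K1 * dw l (tsupport χ) (k2 + (N + 3)) z * lpNorm u 2 volume := fun z => by
    simpa using hK1 _ _ (isWeight_dw h0) (hBχ.dilate_dw h0 h1 (k2 + (N + 3))) _ isWeight_one (bt u) _ hu0
      (by simpa using norm_bt_le hu) z
  have e2 : ∀ z, ‖wact (fun z => φ (l • z)) (bt v) z‖ ≤
      (K2 * lpNorm v 2 volume) * dw l (tsupport φ) k2 z := fun z => by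
    have := hK2 _ _ (isWeight_dw h0) (hφ.dilate_dw h0 h1 k2) _ isWeight_one (bt v) _ hv0
      (by simpa using norm_bt_le hv) z
    linarith
  have e3 := hK3 _ _ (hm.dilate hC.le h0.le h1) (hq.dilate h0.le h1) _ (isWeight_dw h0)
    (wact (fun z => φ (l • z)) (bt v)) _ (by positivity) e2
  calc _ ≤ ∫ z : ℝ × ℝ, K1 * K3 * K2 * (δ⁻¹ ^ k2) * (1 + R) ^ (N + 3) * (C * m 0) * l ^ n *
          (lpNorm u 2 volume * lpNorm v 2 volume) * (br z ^ 3)⁻¹ := by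
        refine norm_integral_le_of_norm_le ((integrable_inv_br_pow (k := 3) le_rfl).const_mul _)
          (ae_of_all _ fun z => ?_)
        have hz := br_pos z
        have d1 := dw_pos (S := tsupport χ) (k := k2) h0 z
        have d2 := dw_pos (S := tsupport φ) (k := k2) h0 z
        have d3 := dw_pos (S := tsupport χ) (k := N + 3) h0 z
        have hmz := hm.nonneg (l • z)
        rw [norm_mul, RCLike.norm_conj]
        calc _ ≤ (K1 * dw l (tsupport χ) (k2 + (N + 3)) z * lpNorm u 2 volume) *
              (K3 * m (l • z) * dw l (tsupport φ) k2 z * (K2 * lpNorm v 2 volume)) := by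
              have d4 := dw_pos (S := tsupport χ) (k := k2 + (N + 3)) h0 z
              exact mul_le_mul (e1 z) (e3 z) (norm_nonneg _) (by positivity)
          _ = K1 * K3 * K2 * (lpNorm u 2 volume * lpNorm v 2 volume) *
              ((dw l (tsupport χ) k2 z * dw l (tsupport φ) k2 z) *
                (dw l (tsupport χ) (N + 3) z * m (l • z))) := by rw [dw_add]; ring
          _ ≤ K1 * K3 * K2 * (lpNorm u 2 volume * lpNorm v 2 volume) *
              ((l / δ) ^ k2 * ((((1 + R) / l) ^ (N + 3) * (br z ^ (N + 3))⁻¹) *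
                (C * m 0 * br z ^ N))) := by
              gcongr
              · exact dw_mul_dw_le hδ hδS h0 z
              · exact dw_le hne hR h0 h1 z
              · exact isWeight_dilate_le hm hC.le h0 h1 z
          _ = _ := by
              rw [div_pow, div_pow, hk2, pow_add l, pow_add (br z), inv_pow]
              field_simp
    _ = K1 * K3 * K2 * (δ⁻¹ ^ k2) * (1 + R) ^ (N + 3) * (C * m 0) * (∫ w : ℝ × ℝ, (br w ^ 3)⁻¹) * l ^ n *
          (lpNorm u 2 volume * lpNorm v 2 volume) := by
        rw [integral_const_mul]; ring
    _ ≤ _ := by gcongr; linarith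

/-- The basic bound of the form `(Op(q) Op(χ) u | v)`. -/
theorem exists_norm_bform_le {C : ℝ} (hC : 0 < C) {N : ℕ} {m : ℝ × ℝ → ℝ} (hm : IsWeight C N m)
    (B : ℕ → ℝ) {χ : ℝ × ℝ → ℝ} (hχ : IsBump χ) :
    ∃ K : ℝ, 0 < K ∧ ∀ l : ℝ, 0 < l → l ≤ 1 → ∀ q, HasSymbolBounds B m q → ∀ u v : ℝ → ℂ,
      MemLp u 2 volume → MemLp v 2 volume →
      ‖bform (fun z => q (l • z)) (fun z => χ (l • z)) u v‖ ≤
        K * (l ^ (N + 3))⁻¹ * (lpNorm u 2 volume * lpNorm v 2 volume) := by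
  rcases (tsupport χ).eq_empty_or_nonempty with hne | hne
  · rw [tsupport_eq_empty_iff] at hne
    refine ⟨1, one_pos, fun l h0 h1 q hq u v hu hv => ?_⟩
    simp only [bform, hne, Pi.zero_apply, wact_zero_symbol, zero_mul, integral_zero, norm_zero]
    have h3 : 0 ≤ lpNorm u 2 volume := lpNorm_nonneg
    have h4 : 0 ≤ lpNorm v 2 volume := lpNorm_nonneg
    positivity
  obtain ⟨R, hR⟩ := hχ.compact.isBounded.exists_norm_le
  have hR0 : 0 ≤ R := (norm_nonneg _).trans (hR _ hne.some_mem)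
  obtain ⟨Bχ, hBχ⟩ := hχ.hasSymbolBounds
  obtain ⟨K1, hK10, hK1⟩ := exists_norm_wact_le 1 (N + 3) Bχ 1 0 zero_le_one
  obtain ⟨K3, hK30, hK3⟩ := exists_norm_wact_le C N B 1 0 zero_le_one
  have hI : 0 ≤ ∫ w : ℝ × ℝ, (br w ^ 3)⁻¹ := integral_nonneg fun w => (inv_br_pow_pos w 3).le
  have hm0 := hm.nonneg 0
  refine ⟨K1 * K3 * (1 + R) ^ (N + 3) * (C * m 0) * (∫ w : ℝ × ℝ, (br w ^ 3)⁻¹) + 1,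
    by positivity, fun l h0 h1 q hq u v hu hv => ?_⟩
  have hu0 : 0 ≤ lpNorm u 2 volume := lpNorm_nonneg
  have hv0 : 0 ≤ lpNorm v 2 volume := lpNorm_nonneg
  have e1 : ∀ z, ‖wact (fun z => χ (l • z)) (bt u) z‖ ≤
      K1 * dw l (tsupport χ) (N + 3) z * lpNorm u 2 volume := fun z => by
    simpa using hK1 _ _ (isWeight_dw h0) (hBχ.dilate_dw h0 h1 (N + 3)) _ isWeight_one (bt u) _ hu0
      (by simpa using norm_bt_le hu) z
  have e3 : ∀ z, ‖wact (fun z => q (l • z)) (bt v) z‖ ≤ K3 * m (l • z) * lpNorm v 2 volume := fun z => by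
    simpa using hK3 _ _ (hm.dilate hC.le h0.le h1) (hq.dilate h0.le h1) _ isWeight_one (bt v) _ hv0
      (by simpa using norm_bt_le hv) z
  calc _ ≤ ∫ z : ℝ × ℝ, K1 * K3 * (1 + R) ^ (N + 3) * (C * m 0) * (l ^ (N + 3))⁻¹ *
          (lpNorm u 2 volume * lpNorm v 2 volume) * (br z ^ 3)⁻¹ := by
        refine norm_integral_le_of_norm_le ((integrable_inv_br_pow (k := 3) le_rfl).const_mul _)
          (ae_of_all _ fun z => ?_)
        have hz := br_pos z
        have d3 := dw_pos (S := tsupport χ) (k := N + 3) h0 z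
        have hmz := hm.nonneg (l • z)
        rw [norm_mul, RCLike.norm_conj]
        calc _ ≤ (K1 * dw l (tsupport χ) (N + 3) z * lpNorm u 2 volume) *
              (K3 * m (l • z) * lpNorm v 2 volume) := by
              gcongr
              · exact e1 z
              · exact e3 z
          _ ≤ (K1 * (((1 + R) / l) ^ (N + 3) * (br z ^ (N + 3))⁻¹) * lpNorm u 2 volume) *
              (K3 * (C * m 0 * br z ^ N) * lpNorm v 2 volume) := by
              gcongr
              · exact dw_le hne hR h0 h1 z
              · exact isWeight_dilate_le hm hC.le h0 h1 z
          _ = _ := by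
              rw [div_pow, pow_add (br z)]
              field_simp
    _ = K1 * K3 * (1 + R) ^ (N + 3) * (C * m 0) * (∫ w : ℝ × ℝ, (br w ^ 3)⁻¹) * (l ^ (N + 3))⁻¹ *
          (lpNorm u 2 volume * lpNorm v 2 volume) := by
        rw [integral_const_mul]; ring
    _ ≤ _ := by gcongr; linarith

/-! ### Unitary dilations -/

/-- The unitary dilation of `L²(ℝ)`. -/
def dil (l : ℝ) (f : ℝ → ℂ) (x : ℝ) : ℂ := (√l : ℝ) * f (l * x)

section
variable {l : ℝ} {f g : ℝ → ℂ}

theorem memLp_dil (hl : 0 < l) (hf : MemLp f 2 volume) : MemLp (dil l f) 2 volume := by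
  have h : MemLp f 2 (Measure.map (fun x => l * x) volume) := by
    rw [Real.map_volume_mul_left hl.ne']
    exact hf.smul_measure ENNReal.ofReal_ne_top
  exact (h.comp_of_map (by fun_prop)).const_mul _

theorem integrable_dil (hl : 0 < l) (hf : Integrable f) : Integrable (dil l f) :=
  (hf.comp_mul_left' hl.ne').const_mul _

theorem integral_dil_mul_conj (hl : 0 < l) (f g : ℝ → ℂ) :
    ∫ x, dil l f x * conj (dil l g x) = ∫ x, f x * conj (g x) := by
  have h := Measure.integral_comp_mul_left (fun x => f x * conj (g x)) l
  have e : ∀ x, dil l f x * conj (dil l g x) = l * (f (l * x) * conj (g (l * x))) := by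
    intro x
    have h2 : ((√l : ℝ) : ℂ) * ((√l : ℝ) : ℂ) = l := by
      rw [← Complex.ofReal_mul, Real.mul_self_sqrt hl.le]
    simp only [dil, map_mul, Complex.conj_ofReal]
    linear_combination (f (l * x) * conj (g (l * x))) * h2
  simp_rw [e, integral_const_mul]
  rw [h, abs_of_pos (inv_pos.2 hl), Complex.real_smul, ← mul_assoc, ← Complex.ofReal_mul,
    mul_inv_cancel₀ hl.ne', Complex.ofReal_one, one_mul]

theorem lpNorm_dil (hl : 0 < l) (hf : MemLp f 2 volume) :
    lpNorm (dil l f) 2 volume = lpNorm f 2 volume := by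
  have h := integral_dil_mul_conj hl f f
  simp only [Complex.mul_conj, Complex.normSq_eq_norm_sq] at h
  rw [integral_complex_ofReal, integral_complex_ofReal, ← lpNorm_sq_eq hf,
    ← lpNorm_sq_eq (memLp_dil hl hf)] at h
  exact (pow_left_inj₀ lpNorm_nonneg lpNorm_nonneg two_ne_zero).1 (by exact_mod_cast h)

theorem dil_dil_inv (hl : 0 < l) (f : ℝ → ℂ) : dil l (dil l⁻¹ f) = f := by
  ext x
  simp only [dil, Real.sqrt_inv]
  rw [inv_mul_cancel_left₀ hl.ne', ← mul_assoc, ← Complex.ofReal_mul,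
    mul_inv_cancel₀ (Real.sqrt_pos.2 hl).ne', Complex.ofReal_one, one_mul]

end

/-! ### Rescaling to Planck's constant `h = (2π)⁻¹` -/

/-- The length scale on which Planck's constant is `(2π)⁻¹`. -/
def scale (h : ℝ) : ℝ := √(2 * π * h)

section
variable {h : ℝ}

theorem scale_pos (hh : 0 < h) : 0 < scale h := Real.sqrt_pos.2 (by positivity)

theorem scale_mul_scale (hh : 0 < h) : scale h * scale h = 2 * π * h :=
  Real.mul_self_sqrt (by positivity)

theorem integral_comp_scale (hh : 0 < h) (g : ℝ → ℂ) :
    ∫ x, g x = scale h * ∫ x, g (scale h * x) := by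
  have hl := scale_pos hh
  rw [Measure.integral_comp_mul_left g, abs_of_pos (inv_pos.2 hl), Complex.real_smul, ← mul_assoc,
    ← Complex.ofReal_mul, mul_inv_cancel₀ hl.ne', Complex.ofReal_one, one_mul]

theorem exp_eq_cis (hh : 0 < h) (x y η : ℝ) :
    Complex.exp (Complex.I * ((scale h * x - scale h * y) * (scale h * η) / h : ℝ)) =
      cis (2 * π * ((x - y) * η)) := by
  have h1 : (scale h * x - scale h * y) * (scale h * η) / h = 2 * π * ((x - y) * η) := by
    rw [show (scale h * x - scale h * y) * (scale h * η) = (scale h * scale h) * ((x - y) * η) by ring,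
      scale_mul_scale hh]
    field_simp
  rw [h1, cis, mul_comm]

theorem weyl_scale (hh : 0 < h) (p : ℝ × ℝ → ℝ) (f : ℝ → ℂ) (x : ℝ) :
    weyl h p f (scale h * x) = nW (fun z => p (scale h • z)) (fun y => f (scale h * y)) x := by
  have hl := scale_pos hh
  rw [weyl, integral_comp_scale hh]
  have e : ∀ η : ℝ, ∫ y : ℝ, Complex.exp (Complex.I * ((scale h * x - y) * (scale h * η) / h : ℝ)) *
      p ((scale h * x + y) / 2, scale h * η) * f y = scale h * ∫ y : ℝ, cis (2 * π * ((x - y) * η)) *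
        p (scale h • ((x + y) / 2, η)) * f (scale h * y) := by
    intro η
    rw [integral_comp_scale hh]
    simp_rw [exp_eq_cis hh, ← mul_add, mul_div_assoc, Prod.smul_mk, smul_eq_mul]
  simp_rw [e, integral_const_mul]
  rw [nW, ← mul_assoc, ← mul_assoc, ← Complex.ofReal_mul, ← Complex.ofReal_mul, ← scale_mul_scale hh,
    mul_assoc, inv_mul_cancel₀ (by positivity), Complex.ofReal_one, one_mul]

theorem nW_const_mul (p : ℝ × ℝ → ℝ) (a : ℂ) (f : ℝ → ℂ) :
    nW p (fun y => a * f y) = fun x => a * nW p f x := by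
  ext x
  simp only [nW, ← integral_const_mul]
  congr 1; ext η; congr 1; ext y; ring

theorem dil_weyl (hh : 0 < h) (p : ℝ × ℝ → ℝ) (f : ℝ → ℂ) :
    dil (scale h) (weyl h p f) = nW (fun z => p (scale h • z)) (dil (scale h) f) := by
  ext x
  unfold dil
  rw [nW_const_mul, weyl_scale hh]

theorem weylKernel_scale (hh : 0 < h) (θ : ℝ × ℝ → ℝ) (x y : ℝ) :
    weylKernel h θ (scale h * x) (scale h * y) =
      ((scale h)⁻¹ : ℝ) * nK (fun z => θ (scale h • z)) x y := by
  have hl := scale_pos hh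
  rw [weylKernel, integral_comp_scale hh]
  simp_rw [exp_eq_cis hh, ← mul_add, mul_div_assoc]
  rw [nK, ← mul_assoc, ← Complex.ofReal_mul, ← scale_mul_scale hh, mul_inv,
    inv_mul_cancel_right₀ hl.ne']
  simp_rw [Prod.smul_mk, smul_eq_mul]

theorem dil_weylSmooth (hh : 0 < h) (θ p : ℝ × ℝ → ℝ) (u : ℝ → ℂ) :
    dil (scale h) (weylSmooth h θ p u) =
      nS (fun z => θ (scale h • z)) (fun z => p (scale h • z)) (dil (scale h) u) := by
  have hl := scale_pos hh
  ext x
  simp only [dil, weylSmooth, weylPairing]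
  rw [integral_comp_scale hh]
  simp_rw [weyl_scale hh, weylKernel_scale hh, nW_const_mul, nS, map_mul, Complex.conj_ofReal,
    ← integral_const_mul]
  congr 1; ext y
  have h1 : ((scale h : ℝ) : ℂ) * (((scale h)⁻¹ : ℝ) : ℂ) = 1 := by
    rw [← Complex.ofReal_mul, mul_inv_cancel₀ hl.ne', Complex.ofReal_one]
  unfold dil
  linear_combination (((√(scale h) : ℝ) : ℂ) * u (scale h * y) * conj (nW (fun z => p (scale h • z))
    (fun y => nK (fun z => θ (scale h • z)) y x) y)) * h1

end

/-! ### Fourier transforms -/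

theorem integral_gauss_cis_pi (κ : ℝ) :
    ∫ y : ℝ, (rexp (-π * y ^ 2) : ℂ) * cis (2 * π * (κ * y)) = (rexp (-π * κ ^ 2) : ℝ) := by
  have hb : 0 < ((π : ℝ) : ℂ).re := by simp [Real.pi_pos]
  have h := fourierIntegral_gaussian hb ((2 * π * κ : ℝ) : ℂ)
  have hpiC : (π : ℂ) ≠ 0 := by exact_mod_cast Real.pi_pos.ne'
  calc _ = ∫ x : ℝ, Complex.exp (Complex.I * ((2 * π * κ : ℝ) : ℂ) * x) *
        Complex.exp (-((π : ℝ) : ℂ) * x ^ 2) := by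
        congr 1; ext y
        rw [cis, mul_comm]; push_cast; congr 2; ring
    _ = _ := by
        rw [h, div_self hpiC, Complex.one_cpow, one_mul]
        push_cast; congr 1; field_simp; ring

theorem fourier_gs (z : ℝ × ℝ) : 𝓕 (gs z) = gs (rot z) := by
  ext η
  rw [fourier_eq_cis, ← integral_add_right_eq_self _ z.1]
  have e : ∀ t : ℝ, gs z (t + z.1) * cis (-(2 * π * ((t + z.1) * η))) =
      (((2 ^ (1 / 4 : ℝ) : ℝ) : ℂ) * cis (2 * π * (-z.1 * (η - z.2 / 2)))) *
        ((rexp (-π * t ^ 2) : ℂ) * cis (2 * π * ((z.2 - η) * t))) := by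
    intro t
    have h1 : cis (2 * π * (z.2 * (t + z.1 - z.1 / 2))) * cis (-(2 * π * ((t + z.1) * η))) =
        cis (2 * π * (-z.1 * (η - z.2 / 2))) * cis (2 * π * ((z.2 - η) * t)) := by
      rw [← cis_add, ← cis_add]; congr 1; ring
    rw [gs, add_sub_cancel_right]
    push_cast
    linear_combination (((2 ^ (1 / 4 : ℝ) : ℝ) : ℂ) * Complex.exp (-π * t ^ 2)) * h1
  simp_rw [e, integral_const_mul, integral_gauss_cis_pi]
  rw [gs, rot]
  push_cast
  rw [show ((z.2 : ℂ) - η) ^ 2 = (η - z.2) ^ 2 by ring]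
  ring

theorem fourier_dil_inv {l : ℝ} (hl : 0 < l) (g : ℝ → ℂ) : 𝓕 (dil l⁻¹ g) = dil l (𝓕 g) := by
  ext ξ
  rw [fourier_eq_cis, dil, fourier_eq_cis]
  have h := Measure.integral_comp_mul_left
    (fun y => dil l⁻¹ g y * cis (-(2 * π * (y * ξ)))) l
  rw [abs_of_pos (inv_pos.2 hl), Complex.real_smul] at h
  have h2 : ∫ y, dil l⁻¹ g y * cis (-(2 * π * (y * ξ))) =
      l * ∫ y, dil l⁻¹ g (l * y) * cis (-(2 * π * (l * y * ξ))) := by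
    rw [h, ← mul_assoc, ← Complex.ofReal_mul, mul_inv_cancel₀ hl.ne', Complex.ofReal_one, one_mul]
  rw [h2, ← integral_const_mul, ← integral_const_mul]
  congr 1; ext y
  have h3 : ((l : ℝ) : ℂ) * ((√l)⁻¹ : ℝ) = (√l : ℝ) := by
    rw [← Complex.ofReal_mul]; congr 1
    nth_rw 1 [← Real.mul_self_sqrt hl.le]
    rw [mul_assoc, mul_inv_cancel₀ (Real.sqrt_pos.2 hl).ne', mul_one]
  rw [dil, inv_mul_cancel_left₀ hl.ne', Real.sqrt_inv,
    show l * y * ξ = y * (l * ξ) by ring]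
  linear_combination (g y * cis (-(2 * π * (y * (l * ξ))))) * h3

theorem memLp_fourier (u : Lp ℂ 2 (volume : Measure ℝ)) :
    MemLp ((𝓕 u : Lp ℂ 2 (volume : Measure ℝ)) : ℝ → ℂ) 2 volume := Lp.memLp _

theorem integral_fourier_Lp_mul_conj (u : Lp ℂ 2 (volume : Measure ℝ)) {g : ℝ → ℂ} (hg1 : Integrable g)
    (hg2 : MemLp g 2 volume) :
    ∫ ξ, (𝓕 u : Lp ℂ 2 (volume : Measure ℝ)) ξ * conj (𝓕 g ξ) = ∫ x, u x * conj (g x) := by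
  have hG := fourier_toLp_ae_eq hg1 hg2
  have h1 := memLp_toLp_inner (Lp.memLp u) hg2
  rw [Lp.toLp_coeFn] at h1
  rw [← h1, ← Lp.inner_fourier_eq, L2.inner_def]
  refine integral_congr_ae ?_
  filter_upwards [hG] with x h1
  rw [h1, RCLike.inner_apply]

/-- Since `2πh = scale h ^ 2`, the `h`-Fourier transform is `𝓕` followed by the dilation with factor
`(scale h)⁻²`; the rescaling undoes one of the two powers. -/
theorem dil_hFourier {h : ℝ} (hh : 0 < h) (u : Lp ℂ 2 (volume : Measure ℝ)) :
    dil (scale h) (hFourier h u) = dil (scale h)⁻¹ (𝓕 u : Lp ℂ 2 (volume : Measure ℝ)) := by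
  have hl := scale_pos hh
  ext η
  rw [dil, dil, hFourier, ← mul_assoc, ← Complex.ofReal_mul, ← scale_mul_scale hh,
    Real.sqrt_mul_self hl.le, Real.sqrt_inv]
  congr 2
  · nth_rw 2 [← Real.mul_self_sqrt hl.le]
    rw [mul_inv, mul_inv_cancel_left₀ (Real.sqrt_pos.2 hl).ne']
  · field_simp

theorem memLp_dil_hFourier {h : ℝ} (hh : 0 < h) (u : Lp ℂ 2 (volume : Measure ℝ)) :
    MemLp (dil (scale h) (hFourier h u)) 2 volume := by
  rw [dil_hFourier hh]
  exact memLp_dil (inv_pos.2 (scale_pos hh)) (memLp_fourier u)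

/-- Plancherel: `𝓕` turns the centre of a coherent state by a right angle and conjugates a dilation
into its inverse. -/
theorem bt_hFourier_rot {h : ℝ} (hh : 0 < h) (u : Lp ℂ 2 (volume : Measure ℝ)) (z : ℝ × ℝ) :
    bt (dil (scale h) (hFourier h u)) (rot z) = bt (dil (scale h) u) z := by
  have hl := scale_pos hh
  have hl' := inv_pos.2 hl
  have e1 := integral_dil_mul_conj hl (dil (scale h)⁻¹ (𝓕 u : Lp ℂ 2 (volume : Measure ℝ))) (gs (rot z))
  rw [dil_dil_inv hl] at e1
  have e2 := integral_dil_mul_conj hl u (dil (scale h)⁻¹ (gs z))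
  rw [dil_dil_inv hl] at e2
  rw [bt, bt, dil_hFourier hh, ← e1, e2, ← fourier_gs, ← fourier_dil_inv hl]
  exact integral_fourier_Lp_mul_conj u (integrable_dil hl' (integrable_gs z)) (memLp_dil hl' (memLp_gs z))

theorem wact_rot {c : ℝ × ℝ → ℝ} {F G : ℝ × ℝ → ℂ} (h : ∀ z, F (rot z) = G z) (z : ℝ × ℝ) :
    wact (fourierSymbol c) F (rot z) = wact c G z := by
  rw [wact, ← measurePreserving_rot.integral_comp measurableEmbedding_rot, wact]
  simp_rw [h, wm_rot]

theorem bform_fourierSymbol {p χ : ℝ × ℝ → ℝ} {u v u' v' : ℝ → ℂ} (hu : ∀ z, bt u' (rot z) = bt u z)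
    (hv : ∀ z, bt v' (rot z) = bt v z) :
    bform (fourierSymbol p) (fourierSymbol χ) u' v' = bform p χ u v := by
  rw [bform, ← measurePreserving_rot.integral_comp measurableEmbedding_rot, bform]
  simp_rw [wact_rot hu, wact_rot hv]

/-! ### Stability of the symbol classes under quarter turn and dilation. -/

/-- `rot⁻¹`, as a linear map. -/
def rotInv : ℝ × ℝ →L[ℝ] ℝ × ℝ :=
  (-ContinuousLinearMap.snd ℝ ℝ ℝ).prod (ContinuousLinearMap.fst ℝ ℝ ℝ)

theorem fourierSymbol_eq (c : ℝ × ℝ → ℝ) : fourierSymbol c = fun z => c (0 + rotInv z) := by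
  ext z; simp [fourierSymbol, rotInv]

theorem norm_rotInv (z : ℝ × ℝ) : ‖rotInv z‖ = ‖z‖ := by
  simp [rotInv, Prod.norm_def, max_comm]

theorem norm_rotInv_le : ‖rotInv‖ ≤ 1 :=
  ContinuousLinearMap.opNorm_le_bound _ zero_le_one fun z => by rw [norm_rotInv, one_mul]

theorem IsTemperate.fourierSymbol {N : ℕ} {p : ℝ × ℝ → ℝ} (hp : IsTemperate N p) :
    IsTemperate N (fourierSymbol p) := by
  obtain ⟨B, hB⟩ := hp
  refine ⟨B, ?_, fun k z => ?_⟩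
  · rw [fourierSymbol_eq]
    exact hB.smooth.comp (contDiff_const.add rotInv.contDiff)
  · rw [fourierSymbol_eq]
    refine (norm_iteratedFDeriv_comp_add_clm_le hB.smooth rotInv 0 k z).trans ?_
    refine (mul_le_of_le_one_right (norm_nonneg _) (pow_le_one₀ (norm_nonneg _) norm_rotInv_le)).trans ?_
    refine (hB.bound k _).trans (le_of_eq ?_)
    rw [zero_add, br, norm_rotInv, br]

theorem IsBump.fourierSymbol {χ : ℝ × ℝ → ℝ} (hχ : IsBump χ) : IsBump (fourierSymbol χ) where
  smooth := by
    rw [fourierSymbol_eq]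
    exact hχ.smooth.comp (contDiff_const.add rotInv.contDiff)
  compact := by
    obtain ⟨R, hR⟩ := hχ.compact.isBounded.exists_norm_le
    refine HasCompactSupport.of_support_subset_isCompact (isCompact_closedBall (0 : ℝ × ℝ) R) fun z hz => ?_
    rw [fourierSymbol_eq, Function.mem_support] at hz
    have := hR _ (subset_tsupport _ hz)
    rw [zero_add, norm_rotInv] at this
    simpa using this

theorem IsTemperate.dilate {N : ℕ} {p : ℝ × ℝ → ℝ} (hp : IsTemperate N p) {l : ℝ} (h0 : 0 ≤ l)
    (h1 : l ≤ 1) : IsTemperate N (fun z => p (l • z)) := by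
  obtain ⟨B, hB⟩ := hp
  refine ⟨B, (hB.dilate h0 h1).smooth, fun k z => ((hB.dilate h0 h1).bound k z).trans ?_⟩
  have hB0 : 0 ≤ B k := by simpa [br] using (norm_nonneg _).trans (hB.bound k 0)
  have := br_pos (l • z)
  gcongr
  exact br_smul_le z h0 h1

theorem IsBump.dilate {χ : ℝ × ℝ → ℝ} (hχ : IsBump χ) {l : ℝ} (hl : 0 < l) :
    IsBump (fun z => χ (l • z)) where
  smooth := hχ.smooth.comp (contDiff_const_smul l)
  compact := by
    simpa using hχ.compact.comp_smul hl.ne'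

/-! ### Tempered and negligible families -/

/-- `f_h = O(h^∞)`. -/
def Negligible (f : ℝ → ℂ) : Prop := ∀ N : ℕ, f =O[𝓝[>] 0] (fun h : ℝ => h ^ N)

/-- `f_h = O(h^∞)` in `L²`. -/
def NegligibleL2 (a : ℝ → ℝ → ℂ) : Prop :=
  ∀ N : ℕ, (fun h => lpNorm (a h) 2 volume) =O[𝓝[>] 0] (fun h : ℝ => h ^ N)

/-- Families in `L²` with norms `O(h ^ (-N))`. -/
structure Tempered (a : ℝ → ℝ → ℂ) : Prop where
  memLp : ∀ h, 0 < h → MemLp (a h) 2 volume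
  bound : ∃ N : ℕ, (fun h => lpNorm (a h) 2 volume) =O[𝓝[>] 0] (fun h : ℝ => (h ^ N)⁻¹)

theorem Negligible.add {f g : ℝ → ℂ} (hf : Negligible f) (hg : Negligible g) : Negligible (fun h => f h + g h) :=
  fun N => (hf N).add (hg N)

theorem Negligible.sub {f g : ℝ → ℂ} (hf : Negligible f) (hg : Negligible g) : Negligible (fun h => f h - g h) :=
  fun N => (hf N).sub (hg N)

theorem Negligible.const_mul {f : ℝ → ℂ} (c : ℂ) (hf : Negligible f) : Negligible (fun h => c * f h) :=
  fun N => (hf N).const_mul_left c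

theorem Negligible.congr' {f g : ℝ → ℂ} (hf : Negligible f) (h : f =ᶠ[𝓝[>] 0] g) : Negligible g :=
  fun N => (hf N).congr' h EventuallyEq.rfl

theorem Negligible.conj {f : ℝ → ℂ} (hf : Negligible f) : Negligible (fun h => conj (f h)) :=
  fun N => (hf N).norm_left.congr_left (fun h => by rw [RCLike.norm_conj]) |>.of_norm_left

theorem Negligible.div_self {f : ℝ → ℂ} (hf : Negligible f) (c : ℂ) : Negligible (fun h => c / h * f h) := by
  intro N
  have h1 : (fun h : ℝ => c / h) =O[𝓝[>] 0] (fun h : ℝ => h⁻¹) := by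
    refine IsBigO.of_bound ‖c‖ (Eventually.of_forall fun h => le_of_eq ?_)
    rw [norm_div, Complex.norm_real, norm_inv, div_eq_mul_inv]
  refine (h1.mul (hf (N + 1))).congr' EventuallyEq.rfl ?_
  filter_upwards [self_mem_nhdsWithin] with h (hh : 0 < h)
  rw [pow_succ]; field_simp

/-! ### Comparison of powers of `h` and of the scale. -/

theorem tendsto_scale : Tendsto scale (𝓝[>] 0) (𝓝 0) := by
  have : Continuous scale := by unfold scale; fun_prop
  have h := this.tendsto 0
  rw [scale, mul_zero, Real.sqrt_zero] at h
  exact h.mono_left nhdsWithin_le_nhds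

theorem eventually_scale_le_one : ∀ᶠ h in 𝓝[>] (0 : ℝ), scale h ≤ 1 :=
  tendsto_scale.eventually (eventually_le_nhds one_pos)

theorem eventually_mem_Ioc {h₀ : ℝ} (hh₀ : 0 < h₀) : ∀ᶠ h in 𝓝[>] (0 : ℝ), h ∈ Ioc 0 h₀ :=
  Ioc_mem_nhdsGT hh₀

theorem isBigO_inv_scale_pow (k : ℕ) :
    (fun h => (scale h ^ k)⁻¹) =O[𝓝[>] 0] (fun h : ℝ => (h ^ k)⁻¹) := by
  refine IsBigO.of_bound 1 ?_
  filter_upwards [eventually_mem_Ioc one_pos] with h hh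
  have hs := scale_pos hh.1
  have h0 := hh.1
  rw [one_mul, Real.norm_of_nonneg (by positivity), Real.norm_of_nonneg (by positivity)]
  gcongr
  refine Real.le_sqrt_of_sq_le ?_
  nlinarith [hh.1, hh.2, Real.pi_gt_three]

theorem isBigO_scale_pow (k : ℕ) :
    (fun h => scale h ^ (2 * k)) =O[𝓝[>] 0] (fun h : ℝ => h ^ k) := by
  refine IsBigO.of_bound ((2 * π) ^ k) ?_
  filter_upwards [self_mem_nhdsWithin] with h (hh : 0 < h)
  have hs := scale_pos hh
  rw [Real.norm_of_nonneg (by positivity), Real.norm_of_nonneg (by positivity), pow_mul, pow_two,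
    scale_mul_scale hh, mul_pow]

theorem Tempered.isBigO_mul_of_smallL2 {a b : ℝ → ℝ → ℂ} (ha : NegligibleL2 a) (hb : Tempered b) (k N : ℕ) :
    (fun h => (scale h ^ k)⁻¹ * (lpNorm (a h) 2 volume * lpNorm (b h) 2 volume)) =O[𝓝[>] 0]
      (fun h : ℝ => h ^ N) := by
  obtain ⟨M, hM⟩ := hb.bound
  refine ((isBigO_inv_scale_pow k).mul ((ha (N + M + k)).mul hM)).congr' EventuallyEq.rfl ?_
  filter_upwards [self_mem_nhdsWithin] with h (hh : 0 < h)
  rw [pow_add, pow_add]; field_simp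

/-! ### The sesquilinear form on families -/

/-- The form `(Op(q) Op(χ) a | b)` for families of symbols and functions, rescaled. -/
def dform (q : ℝ → ℝ × ℝ → ℝ) (χ : ℝ × ℝ → ℝ) (a b : ℝ → ℝ → ℂ) (h : ℝ) : ℂ :=
  bform (fun z => q h (scale h • z)) (fun z => χ (scale h • z)) (a h) (b h)

/-- `Op(χ) a` for families, rescaled. -/
def dop (χ : ℝ × ℝ → ℝ) (a : ℝ → ℝ → ℂ) (h : ℝ) : ℝ → ℂ := nW (fun z => χ (scale h • z)) (a h)

theorem hasSymbolBounds_const (c : ℝ) :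
    HasSymbolBounds (fun k => if k = 0 then |c| else 0) (fun _ => 1) (fun _ => c) where
  smooth := contDiff_const
  bound k z := by
    rcases eq_or_ne k 0 with rfl | hk
    · simp
    · simp [iteratedFDeriv_const_of_ne hk, hk]

theorem IsWeight.isTemperate {C : ℝ} (hC : 0 < C) {N : ℕ} {m : ℝ × ℝ → ℝ} (hm : IsWeight C N m)
    {B : ℕ → ℝ} {q : ℝ × ℝ → ℝ} (hq : HasSymbolBounds B m q) : IsTemperate N q := by
  refine ⟨fun k => |B k| * (C * m 0), hq.smooth, fun k z => (hq.bound k z).trans ?_⟩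
  have h1 := isWeight_dilate_le hm hC.le one_pos le_rfl z
  rw [one_smul] at h1
  have h2 := hm.nonneg z
  calc B k * m z ≤ |B k| * (C * m 0 * br z ^ N) := by
        gcongr
        exact le_abs_self _
    _ = _ := by ring

/-- A family of symbols that is bounded in the class of the weight `m`. -/
structure SymbolFamily (h₀ : ℝ) (q : ℝ → ℝ × ℝ → ℝ) (C : ℝ) (N : ℕ) (m : ℝ × ℝ → ℝ) (B : ℕ → ℝ) :
    Prop where
  h_pos : 0 < h₀
  C_pos : 0 < C
  weight : IsWeight C N m
  bounds : ∀ h ∈ Ioc 0 h₀, HasSymbolBounds B m (q h)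

section
variable {h₀ C : ℝ} {q : ℝ → ℝ × ℝ → ℝ} {N : ℕ} {m : ℝ × ℝ → ℝ} {B : ℕ → ℝ}
  {χ ψ : ℝ × ℝ → ℝ} {a b : ℝ → ℝ → ℂ}

theorem SymbolFamily.isTemperate (hq : SymbolFamily h₀ q C N m B) {h : ℝ} (hh : h ∈ Ioc 0 h₀)
    (h1 : scale h ≤ 1) : IsTemperate N (fun z => q h (scale h • z)) :=
  (hq.weight.isTemperate hq.C_pos (hq.bounds h hh)).dilate (scale_pos hh.1).le h1

theorem SymbolFamily.isBigO_dform (hq : SymbolFamily h₀ q C N m B) (hχ : IsBump χ)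
    (ha : ∀ h, 0 < h → MemLp (a h) 2 volume) (hb : ∀ h, 0 < h → MemLp (b h) 2 volume) :
    dform q χ a b =O[𝓝[>] 0] fun h => (scale h ^ (N + 3))⁻¹ *
      (lpNorm (a h) 2 volume * lpNorm (b h) 2 volume) := by
  obtain ⟨K, hK0, hK⟩ := exists_norm_bform_le hq.C_pos hq.weight B hχ
  refine IsBigO.of_bound K ?_
  filter_upwards [eventually_mem_Ioc hq.h_pos, eventually_scale_le_one] with h hh h1
  have hs := scale_pos hh.1
  have h2 : 0 ≤ lpNorm (a h) 2 volume := lpNorm_nonneg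
  have h3 : 0 ≤ lpNorm (b h) 2 volume := lpNorm_nonneg
  rw [Real.norm_of_nonneg (by positivity), ← mul_assoc]
  exact hK _ hs h1 _ (hq.bounds h hh) _ _ (ha h hh.1) (hb h hh.1)

theorem SymbolFamily.small_dform_right (hq : SymbolFamily h₀ q C N m B) (hχ : IsBump χ)
    (ha : Tempered a) (hb : ∀ h, 0 < h → MemLp (b h) 2 volume) (hb' : NegligibleL2 b) :
    Negligible (dform q χ a b) := fun k => by
  refine (hq.isBigO_dform hχ ha.memLp hb).trans ?_
  simp_rw [mul_comm (lpNorm (a _) 2 volume)]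
  exact ha.isBigO_mul_of_smallL2 hb' (N + 3) k

theorem symbolFamily_one : SymbolFamily 1 (fun _ _ => 1) 1 0 (fun _ => 1)
    (fun k => if k = 0 then |1| else 0) where
  h_pos := one_pos
  C_pos := one_pos
  weight := isWeight_one
  bounds _ _ := hasSymbolBounds_const 1

theorem memLp_dop (hψ : IsBump ψ) (ha : ∀ h, 0 < h → MemLp (a h) 2 volume) (h : ℝ) (hh : 0 < h) :
    MemLp (dop ψ a h) 2 volume :=
  (hψ.dilate (scale_pos hh)).memLp_nW (ha h hh)

/-- Applied to the pair `a`, `Op(ψ)a`, the bound on the form estimates `‖Op(ψ)a‖²` by `scale h ^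
(-3) ‖a‖ ‖Op(ψ)a‖`, and one factor cancels. Uniform boundedness on `L²` is not needed, since
temperedness tolerates the loss. -/
theorem Tempered.dop (ha : Tempered a) (hψ : IsBump ψ) : Tempered (dop ψ a) where
  memLp := memLp_dop hψ ha.memLp
  bound := by
    obtain ⟨M, hM⟩ := ha.bound
    have h1 := symbolFamily_one.isBigO_dform hψ ha.memLp (memLp_dop hψ ha.memLp)
    obtain ⟨K, hK0, hK⟩ := h1.exists_pos
    have h2 : (fun h => lpNorm (_root_.dop ψ a h) 2 volume) =O[𝓝[>] 0]
        fun h => (scale h ^ 3)⁻¹ * lpNorm (a h) 2 volume := by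
      refine IsBigO.of_bound K ?_
      filter_upwards [hK.bound, self_mem_nhdsWithin] with h hb (hh : 0 < h)
      have hs := scale_pos hh
      have hb1 := hψ.dilate hs
      have h3 : 0 ≤ lpNorm (a h) 2 volume := lpNorm_nonneg
      have h4 : 0 ≤ lpNorm (_root_.dop ψ a h) 2 volume := lpNorm_nonneg
      have h5 := lpNorm_sq_eq (memLp_dop hψ ha.memLp h hh)
      have h6 : ((lpNorm (_root_.dop ψ a h) 2 volume ^ 2 : ℝ) : ℂ) =
          dform (fun _ _ => 1) ψ a (_root_.dop ψ a) h := by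
        rw [dform, ← integral_nW_mul_conj hb1 (ha.memLp h hh) (memLp_dop hψ ha.memLp h hh), h5,
          ← integral_complex_ofReal]
        congr 1; ext x
        rw [← Complex.normSq_eq_norm_sq, ← Complex.mul_conj]; rfl
      rw [← h6, Complex.norm_real, Real.norm_of_nonneg (by positivity),
        Real.norm_of_nonneg (by positivity)] at hb
      rw [Real.norm_of_nonneg h4, Real.norm_of_nonneg (by positivity)]
      rcases h4.eq_or_lt with h7 | h7
      · rw [← h7]; positivity
      · refine le_of_mul_le_mul_right ?_ h7
        calc _ = lpNorm (_root_.dop ψ a h) 2 volume ^ 2 := by ring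
          _ ≤ _ := hb
          _ = _ := by rw [zero_add]; ring
    refine ⟨3 + M, (h2.trans ((isBigO_inv_scale_pow 3).mul hM)).congr_right fun h => ?_⟩
    rw [pow_add, mul_inv]

theorem SymbolFamily.small_of_disjoint (hq : SymbolFamily h₀ q C N m B) (hχ : IsBump χ)
    {Bφ : ℕ → ℝ} {φ : ℝ × ℝ → ℝ} (hφ : HasSymbolBounds Bφ (fun _ => 1) φ)
    (hd : Disjoint (tsupport χ) (tsupport φ)) (ha : Tempered a) (hb : Tempered b) :
    Negligible (fun h => ∫ z, wact (fun z => χ (scale h • z)) (bt (a h)) z *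
        conj (wact (fun z => q h (scale h • z)) (wact (fun z => φ (scale h • z)) (bt (b h))) z)) := by
  intro n
  obtain ⟨Ma, hMa⟩ := ha.bound
  obtain ⟨Mb, hMb⟩ := hb.bound
  -- The factor 2 is there because `scale h ^ 2` is comparable to `h`; `Ma + Mb` compensates the
  -- growth of the norms of `a` and `b`.
  obtain ⟨K, hK0, hK⟩ := exists_norm_bform_disjoint_le hq.C_pos hq.weight B hχ hφ hd (2 * (n + (Ma + Mb)))
  have h1 : (fun h => ∫ z, wact (fun z => χ (scale h • z)) (bt (a h)) z *
        conj (wact (fun z => q h (scale h • z)) (wact (fun z => φ (scale h • z)) (bt (b h))) z))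
      =O[𝓝[>] 0] fun h => scale h ^ (2 * (n + (Ma + Mb))) *
        (lpNorm (a h) 2 volume * lpNorm (b h) 2 volume) := by
    refine IsBigO.of_bound K ?_
    filter_upwards [eventually_mem_Ioc hq.h_pos, eventually_scale_le_one] with h hh h1
    have hs := scale_pos hh.1
    have h2 : 0 ≤ lpNorm (a h) 2 volume := lpNorm_nonneg
    have h3 : 0 ≤ lpNorm (b h) 2 volume := lpNorm_nonneg
    rw [Real.norm_of_nonneg (by positivity), ← mul_assoc]
    exact hK _ hs h1 _ (hq.bounds h hh) _ _ (ha.memLp h hh.1) (hb.memLp h hh.1)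
  refine (h1.trans ((isBigO_scale_pow _).mul (hMa.mul hMb))).congr' EventuallyEq.rfl ?_
  filter_upwards [self_mem_nhdsWithin] with h (hh : 0 < h)
  rw [pow_add, pow_add]; field_simp

theorem SymbolFamily.small_dform_disjoint (hq : SymbolFamily h₀ q C N m B) (hχ : IsBump χ)
    (hψ : IsBump ψ) (hd : Disjoint (tsupport χ) (tsupport ψ)) (ha : Tempered a) (hb : Tempered b) :
    Negligible (dform q χ a (dop ψ b)) := by
  obtain ⟨Bφ, hBφ⟩ := hψ.hasSymbolBounds
  refine (hq.small_of_disjoint hχ hBφ hd ha hb).congr' ?_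
  filter_upwards [self_mem_nhdsWithin] with h (hh : 0 < h)
  rw [dform, bform, dop, (hψ.dilate (scale_pos hh)).bt_nW (hb.memLp h hh)]

theorem HasSymbolBounds.one_sub {Bψ : ℕ → ℝ} (hψ : HasSymbolBounds Bψ (fun _ => 1) ψ) :
    HasSymbolBounds (fun k => (if k = 0 then |1| else 0) + Bψ k) (fun _ => 1) (fun z => 1 - ψ z) where
  smooth := contDiff_const.sub hψ.smooth
  bound k z := by
    have h1 := (hasSymbolBounds_const 1).bound k z
    have h2 := hψ.bound k z
    have h3 : iteratedFDeriv ℝ k (fun z => 1 - ψ z) z =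
        iteratedFDeriv ℝ k (fun _ => (1 : ℝ)) z - iteratedFDeriv ℝ k ψ z :=
      fun_iteratedFDeriv_sub_apply (contDiff_const.contDiffAt) ((hψ.smooth.of_le (by exact_mod_cast le_top)).contDiffAt)
    rw [h3]
    refine (norm_sub_le _ _).trans ?_
    linarith

/-- The difference carries the symbol `1 - ψ`, which is bounded but not compactly supported. For its
sake the disjointness estimate asks for compact support of only one of the two symbols. -/
theorem SymbolFamily.small_dform_sub (hq : SymbolFamily h₀ q C N m B) (hχ : IsBump χ)
    (hψ : IsBump ψ) (hd : Disjoint (tsupport χ) (tsupport fun z => 1 - ψ z)) (ha : Tempered a)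
    (hb : Tempered b) : Negligible (fun h => dform q χ a b h - dform q χ a (dop ψ b) h) := by
  obtain ⟨Bψ, hBψ⟩ := hψ.hasSymbolBounds
  refine (hq.small_of_disjoint hχ hBψ.one_sub hd ha hb).congr' ?_
  filter_upwards [eventually_mem_Ioc hq.h_pos, eventually_scale_le_one] with h hh h1
  have hs := scale_pos hh.1
  have hψs := hψ.dilate hs
  have hχs := hχ.dilate hs
  have hbm := hb.memLp h hh.1
  have hqs := hq.isTemperate hh h1
  have h2 : IsTemperate 0 (fun _ : ℝ × ℝ => (1 : ℝ)) := ⟨_, by simpa using hasSymbolBounds_const 1⟩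
  have hRD := hψs.rapidDecay_wact_bt hbm
  obtain ⟨K, hK⟩ := hRD.bounded
  have e1 : wact (fun z => 1 - ψ (scale h • z)) (bt (b h)) =
      fun z => bt (b h) z - wact (fun z => ψ (scale h • z)) (bt (b h)) z := by
    ext z
    rw [h2.wact_sub (hψs.isTemperate 0) (aestronglyMeasurable_bt hbm.1) (norm_bt_le hbm),
      wact_one_bt hbm]
  have hi : ∀ {G : ℝ × ℝ → ℂ} (_ : AEStronglyMeasurable G volume) {K : ℝ} (_ : ∀ z, ‖G z‖ ≤ K),
      Integrable fun z => wact (fun z => χ (scale h • z)) (bt (a h)) z *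
        conj (wact (fun z => q h (scale h • z)) G z) := by
    intro G hGm K hG
    obtain ⟨K', _, hK'⟩ := hqs.exists_norm_wact_le hG
    refine (hχs.rapidDecay_wact_bt (ha.memLp h hh.1)).integrable_mul (C := K') (N := N) ?_ ?_
    · exact Complex.continuous_conj.comp_aestronglyMeasurable (aestronglyMeasurable_wact hqs.continuous hGm)
    · intro w; rw [RCLike.norm_conj]; exact hK' w
  simp only [dform, bform]
  rw [← integral_sub]
  · congr 1; ext z
    rw [dop, hψs.bt_nW hbm, e1, hqs.wact_sub_fun (aestronglyMeasurable_bt hbm.1) hRD.aesm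
      (norm_bt_le hbm) hK, map_sub, mul_sub]
  · exact hi (aestronglyMeasurable_bt hbm.1) (norm_bt_le hbm)
  · rw [dop, hψs.bt_nW hbm]
    exact hi hRD.aesm hK

theorem SymbolFamily.dform_dop (hq : SymbolFamily h₀ q C N m B) (hχ : IsBump χ) (hψ : IsBump ψ)
    (ha : Tempered a) (hb : Tempered b) :
    dform q χ a (dop ψ b) =ᶠ[𝓝[>] 0] fun h => conj (dform q ψ b (dop χ a) h) := by
  filter_upwards [eventually_mem_Ioc hq.h_pos, eventually_scale_le_one] with h hh h1
  have hs := scale_pos hh.1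
  exact bform_nW_right (hq.isTemperate hh h1) (hχ.dilate hs) (hψ.dilate hs) (ha.memLp h hh.1)
    (hb.memLp h hh.1)

theorem SymbolFamily.dform_lincomb (hq : SymbolFamily h₀ q C N m B) {χ' : ℝ × ℝ → ℝ} (hχ : IsBump χ)
    (hχ' : IsBump χ') (c : ℝ) (ha : Tempered a) (hb : Tempered b) :
    dform q (fun z => χ z - c * χ' z) a b =ᶠ[𝓝[>] 0] fun h => dform q χ a b h - c * dform q χ' a b h := by
  filter_upwards [eventually_mem_Ioc hq.h_pos, eventually_scale_le_one] with h hh h1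
  have hs := scale_pos hh.1
  have ham := ha.memLp h hh.1
  have hbm := hb.memLp h hh.1
  have hqs := hq.isTemperate hh h1
  obtain ⟨K', _, hK'⟩ := hqs.exists_norm_wact_le (norm_bt_le hbm)
  have hi : ∀ {χ : ℝ × ℝ → ℝ} (_ : IsBump χ),
      Integrable fun z => wact (fun z => χ (scale h • z)) (bt (a h)) z *
        conj (wact (fun z => q h (scale h • z)) (bt (b h)) z) := by
    intro χ hχ
    refine ((hχ.dilate hs).rapidDecay_wact_bt ham).integrable_mul (C := K') (N := N) ?_ ?_
    · exact Complex.continuous_conj.comp_aestronglyMeasurable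
        (aestronglyMeasurable_wact hqs.continuous (aestronglyMeasurable_bt hbm.1))
    · intro w; rw [RCLike.norm_conj]; exact hK' w
  have hcχ : IsBump (fun z => c * χ' z) := ⟨contDiff_const.mul hχ'.smooth, hχ'.compact.mul_left⟩
  simp only [dform, bform]
  rw [← integral_const_mul, ← integral_sub (hi hχ) ((hi hχ').const_mul _)]
  congr 1; ext z
  rw [((hχ.dilate hs).isTemperate 0).wact_sub ((hcχ.dilate hs).isTemperate 0)
    (aestronglyMeasurable_bt ham.1) (norm_bt_le ham),
    wact_const_mul c (fun z => χ' (scale h • z)), sub_mul, mul_assoc]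

end

/-! ### Cut-off functions -/

open scoped Manifold in
theorem exists_isBump {K O : Set (ℝ × ℝ)} (hK : IsCompact K) (hO : IsOpen O) (hKO : K ⊆ O) :
    ∃ f : ℝ × ℝ → ℝ, IsBump f ∧ tsupport f ⊆ O ∧ ∀ z ∈ K, ∀ᶠ w in 𝓝 z, f w = 1 := by
  obtain ⟨L, hL, hKL, hLO⟩ := exists_compact_between hK hO hKO
  obtain ⟨f, hf0, hf1, -⟩ := exists_contMDiffMap_zero_one_nhds_of_isClosed (n := (⊤ : ℕ∞)) 𝓘(ℝ, ℝ × ℝ)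
    (s := (interior L)ᶜ) (t := K) isOpen_interior.isClosed_compl hK.isClosed
    (disjoint_compl_left_iff_subset.2 hKL)
  have hsupp : tsupport f ⊆ L := by
    refine closure_minimal (fun z hz => ?_) hL.isClosed
    by_contra hzL
    have h0 : ∀ᶠ x in 𝓝 z, f x = 0 := mem_nhdsSet_iff_forall.1 hf0 z fun h => hzL (interior_subset h)
    exact hz h0.self_of_nhds
  exact ⟨f, ⟨f.contMDiff.contDiff, hL.of_isClosed_subset (isClosed_tsupport _) hsupp⟩,
    hsupp.trans hLO, fun z hz => mem_nhdsSet_iff_forall.1 hf1 z hz⟩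

theorem disjoint_tsupport_one_sub {K : Set (ℝ × ℝ)} {f : ℝ × ℝ → ℝ}
    (h : ∀ z ∈ K, ∀ᶠ w in 𝓝 z, f w = 1) : Disjoint K (tsupport fun z => 1 - f z) := by
  refine Set.disjoint_left.2 fun z hz => notMem_tsupport_iff_eventuallyEq.2 ?_
  exact (h z hz).mono fun w hw => by simp [hw]

theorem eventually_eq_of_notMem_tsupport_fderiv {χ : ℝ × ℝ → ℝ} (hχ : ContDiff ℝ ∞ χ) {z : ℝ × ℝ}
    (hz : z ∉ tsupport (fderiv ℝ χ)) : ∀ᶠ w in 𝓝 z, χ w = χ z := by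
  obtain ⟨r, hr, h⟩ := Metric.eventually_nhds_iff_ball.1 (notMem_tsupport_iff_eventuallyEq.1 hz)
  refine Metric.eventually_nhds_iff_ball.2 ⟨r, hr, fun w hw => ?_⟩
  refine (convex_ball z r).is_const_of_fderivWithin_eq_zero (𝕜 := ℝ)
    (hχ.differentiable (by simp)).differentiableOn (fun x hx => ?_) hw (Metric.mem_ball_self hr)
  rw [fderivWithin_of_isOpen Metric.isOpen_ball hx]
  exact h x hx

theorem IsBump.sub {f g : ℝ × ℝ → ℝ} (hf : IsBump f) (hg : IsBump g) : IsBump (fun z => f z - g z) :=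
  ⟨hf.smooth.sub hg.smooth, hf.compact.sub hg.compact⟩

theorem IsBump.mul_left {f g : ℝ × ℝ → ℝ} (hf : ContDiff ℝ ∞ f) (hg : IsBump g) :
    IsBump (fun z => f z * g z) :=
  ⟨hf.mul hg.smooth, hg.compact.mul_left⟩

theorem IsBump.const_mul {g : ℝ × ℝ → ℝ} (c : ℝ) (hg : IsBump g) : IsBump (fun z => c * g z) :=
  IsBump.mul_left contDiff_const hg

theorem IsTestSymbol.isBump {U : Set (ℝ × ℝ)} {θ : ℝ × ℝ → ℝ} (h : IsTestSymbol U θ) : IsBump θ :=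
  ⟨h.smooth, h.compact⟩

theorem IsBump.isTestSymbol {U : Set (ℝ × ℝ)} {θ : ℝ × ℝ → ℝ} (h : IsBump θ) (hU : tsupport θ ⊆ U) :
    IsTestSymbol U θ := ⟨h.smooth, h.compact, hU⟩

/-! ### Microlocal solutions -/

/-- Families of functions that are, in `Ω`, microlocalized on `Λ` and annihilated by `Op(q)`. -/
structure MicroSol (q : ℝ → ℝ × ℝ → ℝ) (Λ Ω : Set (ℝ × ℝ)) (a : ℝ → ℝ → ℂ) : Prop where
  tempered : Tempered a
  loc : ∀ θ, IsTestSymbol (Ω \ Λ) θ → NegligibleL2 (dop θ a)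
  eqn : ∀ θ, IsTestSymbol Ω θ → ∀ w, Tempered w → Negligible (dform q θ w a)

section
variable {h₀ C : ℝ} {q : ℝ → ℝ × ℝ → ℝ} {N : ℕ} {m : ℝ × ℝ → ℝ} {B : ℕ → ℝ}
  {Λ Ω : Set (ℝ × ℝ)} {φ χ ψ : ℝ × ℝ → ℝ} {a b : ℝ → ℝ → ℂ}

theorem SymbolFamily.negligible_swap (hq : SymbolFamily h₀ q C N m B) (hχ : IsBump χ) (hψ : IsBump ψ)
    (ha : Tempered a) (hb : Tempered b) (h : Negligible (dform q ψ b (dop χ a))) :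
    Negligible (dform q χ a (dop ψ b)) :=
  h.conj.congr' (hq.dform_dop hχ hψ ha hb).symm

/-- Behind `χ` the operator `Op(ψ)` acts as the identity, and without it the form is the equation
for `b` tested with `χ`. -/
theorem SymbolFamily.negligible_of_one_near (hq : SymbolFamily h₀ q C N m B) (hχ : IsTestSymbol Ω χ)
    (hψ : IsBump ψ) (h1 : ∀ z ∈ tsupport χ, ∀ᶠ w in 𝓝 z, ψ w = 1) (ha : Tempered a)
    (hb : MicroSol q Λ Ω b) : Negligible (dform q χ a (dop ψ b)) := by
  have h := (hb.eqn χ hχ a ha).sub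
    (hq.small_dform_sub hχ.isBump hψ (disjoint_tsupport_one_sub h1) ha hb.tempered)
  simpa only [sub_sub_cancel] using h

theorem SymbolFamily.negligible_of_lincomb (hq : SymbolFamily h₀ q C N m B) (hφ : IsBump φ)
    (hχ : IsBump χ) (c : ℝ) (ha : Tempered a) (hb : Tempered b)
    (h1 : Negligible (dform q (fun z => φ z - c * χ z) a b)) (h2 : Negligible (dform q χ a b)) :
    Negligible (dform q φ a b) := by
  refine (h1.add (h2.const_mul c)).congr' ?_
  filter_upwards [hq.dform_lincomb hφ hχ c ha hb] with h hh
  rw [hh, sub_add_cancel]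

/-- The form vanishes if its symbols do not interact on the curve `Λ`. -/
theorem SymbolFamily.negligible_of_localized (hq : SymbolFamily h₀ q C N m B) (hΩ : IsOpen Ω)
    (hΛ : IsClosed Λ) (ha : MicroSol q Λ Ω a) (hb : MicroSol q Λ Ω b) (hφ : IsBump φ) (hχ : IsBump χ)
    (hsupp : tsupport φ ∩ tsupport χ ⊆ Ω)
    (hz : ∀ z ∈ tsupport (fderiv ℝ χ) ∩ Λ, z ∉ tsupport φ) :
    Negligible (dform q φ a (dop χ b)) := by
  have hta := ha.tempered
  have htb := hb.tempered
  suffices ∃ O, IsOpen O ∧ tsupport φ ⊆ O ∧ ∀ f, IsBump f → tsupport f ⊆ O →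
      Negligible (dform q f a (dop χ b)) by
    obtain ⟨O, -, hO, h⟩ := this
    exact h φ hφ hO
  -- The property of being covered by such an `O` passes to subsets and finite unions, so
  -- compactness of supp `φ` reduces the claim to small neighbourhoods of its points.
  refine hφ.compact.induction_on (p := fun s => ∃ O, IsOpen O ∧ s ⊆ O ∧ ∀ f, IsBump f →
    tsupport f ⊆ O → Negligible (dform q f a (dop χ b))) ?_ ?_ ?_ ?_
  · refine ⟨∅, isOpen_empty, subset_rfl, fun f hf hs => ?_⟩
    exact hq.small_dform_disjoint hf hχ (by rw [subset_empty_iff.1 hs]; exact Set.empty_disjoint _) hta htb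
  · rintro s t hst ⟨O, hO, htO, h⟩
    exact ⟨O, hO, hst.trans htO, h⟩
  · rintro s t ⟨O₁, hO₁, hs, h1⟩ ⟨O₂, hO₂, ht, h2⟩
    refine ⟨O₁ ∪ O₂, hO₁.union hO₂, union_subset_union hs ht, fun f hf hfO => ?_⟩
    -- A partition of unity: `g` is 1 near the part of supp `f` outside `O₂`, so that `g f` lives in
    -- `O₁` and `(1 - g) f` in `O₂`.
    obtain ⟨g, hg, hgO, hg1⟩ := exists_isBump (hf.compact.diff hO₂) hO₁ (by
      rintro z ⟨hz1, hz2⟩; exact (hfO hz1).resolve_right hz2)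
    have hgf : IsBump (fun z => g z * f z) := IsBump.mul_left hg.smooth hf
    refine hq.negligible_of_lincomb hf hgf 1 hta (htb.dop hχ) (h2 _ (hf.sub (hgf.const_mul 1)) ?_)
      (h1 _ hgf ((tsupport_mul_subset_left).trans hgO))
    intro z hz
    by_contra hzO
    have e : (fun z => f z - 1 * (g z * f z)) = fun z => (1 - g z) * f z := by ext z; ring
    rw [e] at hz
    refine (notMem_tsupport_iff_eventuallyEq (f := fun z => 1 - g z)).2 ?_ (tsupport_mul_subset_left hz)
    exact (hg1 z ⟨tsupport_mul_subset_right hz, hzO⟩).mono fun w hw => by simp [hw]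
  · intro z hzφ
    suffices ∃ O, IsOpen O ∧ z ∈ O ∧ ∀ f, IsBump f → tsupport f ⊆ O →
        Negligible (dform q f a (dop χ b)) by
      obtain ⟨O, hO, hzO, h⟩ := this
      exact ⟨O, mem_nhdsWithin_of_mem_nhds (hO.mem_nhds hzO), O, hO, subset_rfl, h⟩
    by_cases hzχ : z ∈ tsupport χ
    · have hzΩ : z ∈ Ω := hsupp ⟨hzφ, hzχ⟩
      by_cases hzΛ : z ∈ Λ
      -- On `Λ` the function `χ` is constant near `z`. Hence it may be replaced by `χ z` times a
      -- bump `g` that is 1 near supp `f`, and then the equation for `b` applies.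
      · have hzd : z ∉ tsupport (fderiv ℝ χ) := fun h => hz z ⟨h, hzΛ⟩ hzφ
        obtain ⟨O, hO1, hO, hzO⟩ := eventually_nhds_iff.1
          (eventually_eq_of_notMem_tsupport_fderiv hχ.smooth hzd)
        refine ⟨O ∩ Ω, hO.inter hΩ, ⟨hzO, hzΩ⟩, fun f hf hfO => ?_⟩
        obtain ⟨g, hg, -, hg1⟩ := exists_isBump hf.compact isOpen_univ (subset_univ _)
        refine hq.negligible_swap hf hχ hta htb ?_
        refine hq.negligible_of_lincomb hχ hg (χ z) htb (hta.dop hf) ?_ ?_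
        · refine hq.small_dform_disjoint (hχ.sub (hg.const_mul _)) hf ?_ htb hta
          refine Set.disjoint_right.2 fun w hw => notMem_tsupport_iff_eventuallyEq.2 ?_
          filter_upwards [hg1 w hw, hO.mem_nhds (hfO hw).1] with y hy1 hy2
          simp [hy1, hO1 y hy2]
        · refine hq.negligible_swap hg hf htb hta ?_
          exact hq.negligible_of_one_near (hf.isTestSymbol fun w hw => (hfO hw).2) hg hg1 hta hb
      -- In `Ω` off `Λ` no equation is needed: `Op(f) a` is itself negligible.
      · refine ⟨Ω \ Λ, hΩ.sdiff hΛ, ⟨hzΩ, hzΛ⟩, fun f hf hfO => ?_⟩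
        refine hq.negligible_swap hf hχ hta htb ?_
        exact hq.small_dform_right hχ htb (memLp_dop hf hta.memLp) (ha.loc f (hf.isTestSymbol hfO))
    · refine ⟨(tsupport χ)ᶜ, (isClosed_tsupport χ).isOpen_compl, hzχ, fun f hf hfO => ?_⟩
      exact hq.small_dform_disjoint hf hχ (Set.disjoint_left.2 fun w hw => hfO hw) hta htb

end

/-! ### Geometry of the closed orbit -/

section
variable {p₀ : ℝ × ℝ → ℝ} {E T s : ℝ} {γ : ℝ → ℝ × ℝ} {Ω : Set (ℝ × ℝ)} {χ χ₀ ψ : ℝ × ℝ → ℝ} {ρ : ℤˣ}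

theorem IsPeriodicOrbit.continuous (hγ : IsPeriodicOrbit p₀ E T γ) : Continuous γ :=
  continuous_iff_continuousAt.2 fun t => (hγ.flow t).continuousAt

theorem IsPeriodicOrbit.isCompact_range (hγ : IsPeriodicOrbit p₀ E T γ) : IsCompact (range γ) := by
  rw [← hγ.periodic.image_uIcc hγ.pos.ne' 0]
  exact isCompact_uIcc.image hγ.continuous

/-- The period window beginning at `s - T` has the cut at its ends and `a` at parameter 0, so the
two segments become the positive and the negative parameters. -/
theorem IsPeriodicOrbit.injOn_Ico (hγ : IsPeriodicOrbit p₀ E T γ) (hs0 : 0 ≤ s) (hsT : s ≤ T) :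
    InjOn γ (Ico (s - T) s) := by
  have h : ∀ t ∈ Ico (s - T) s, ∃ t' ∈ Ico 0 T, γ t' = γ t ∧
      (t' = t ∧ t' < s ∨ t' = t + T ∧ s ≤ t') := by
    intro t ht
    rcases lt_or_ge t 0 with h0 | h0
    · exact ⟨t + T, ⟨by linarith [ht.1], by linarith⟩, hγ.periodic t, Or.inr ⟨rfl, by linarith [ht.1]⟩⟩
    · exact ⟨t, ⟨h0, by linarith [ht.2]⟩, rfl, Or.inl ⟨rfl, ht.2⟩⟩
  intro t₁ h1 t₂ h2 h12
  obtain ⟨t₁', h1', e1, c1⟩ := h t₁ h1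
  obtain ⟨t₂', h2', e2, c2⟩ := h t₂ h2
  have h3 : t₁' = t₂' := hγ.inj h1' h2' (by rw [e1, e2, h12])
  rcases c1 with ⟨c1, d1⟩ | ⟨c1, d1⟩ <;> rcases c2 with ⟨c2, d2⟩ | ⟨c2, d2⟩ <;> linarith

/-- The point at which the orbit is cut lies outside the support of the cut-off. -/
theorem IsPeriodicOrbit.exists_param (hγ : IsPeriodicOrbit p₀ E T γ) (S : Set (ℝ × ℝ)) (hs : γ s ∉ S)
    {z : ℝ × ℝ} (hzS : z ∈ S) (hz : z ∈ range γ) : ∃ t ∈ Ioo (s - T) s, γ t = z := by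
  obtain ⟨x, rfl⟩ := hz
  obtain ⟨t, ht, hxt⟩ := hγ.periodic.exists_mem_Ico hγ.pos x (s - T)
  rw [sub_add_cancel] at ht
  refine ⟨t, ⟨lt_of_le_of_ne ht.1 fun h => hs ?_, ht.2⟩, hxt.symm⟩
  have := hγ.periodic (s - T)
  rw [sub_add_cancel] at this
  rwa [this, h, ← hxt]

theorem notMem_tsupport_fderiv_of_eventually_eq {z : ℝ × ℝ} {c : ℝ} (h : ∀ᶠ w in 𝓝 z, χ w = c) :
    z ∉ tsupport (fderiv ℝ χ) := by
  refine notMem_tsupport_iff_eventuallyEq.2 ?_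
  filter_upwards [h.eventually_nhds] with w hw
  have : χ =ᶠ[𝓝 w] fun _ => c := hw
  rw [this.fderiv_eq]; simp

theorem IsPeriodicOrbit.mem_orbitSegment (hγ : IsPeriodicOrbit p₀ E T γ) (hχ : IsCutoffAt Ω (γ 0) χ)
    (hs : γ s ∉ tsupport χ) {z : ℝ × ℝ} (hz : z ∈ tsupport (fderiv ℝ χ)) (hzγ : z ∈ range γ) :
    z ∈ orbitSegment γ T s 1 ∨ z ∈ orbitSegment γ T s (-1) := by
  obtain ⟨t, ht, rfl⟩ := hγ.exists_param (tsupport χ) hs (tsupport_fderiv_subset ℝ hz) hzγ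
  rcases lt_trichotomy t 0 with h | rfl | h
  · right; rw [orbitSegment, if_neg (by decide)]; exact ⟨t, ⟨ht.1, h⟩, rfl⟩
  · exact absurd hz (notMem_tsupport_fderiv_of_eventually_eq hχ.eq_one)
  · left; rw [orbitSegment, if_pos rfl]; exact ⟨t, ⟨h, ht.2⟩, rfl⟩

/-- There are cut-offs that only see a short piece of the orbit. -/
theorem IsPeriodicOrbit.exists_cutoff (hγ : IsPeriodicOrbit p₀ E T γ) (hΩ : IsOpen Ω) (ha : γ 0 ∈ Ω)
    {ε : ℝ} (hε : 0 < ε) (hεT : 2 * ε ≤ T) : ∃ χ, IsCutoffAt Ω (γ 0) χ ∧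
      ∀ z ∈ tsupport χ ∩ range γ, ∃ t ∈ Ioo (-ε) ε, γ t = z := by
  -- The remainder of the orbit is a compact arc that avoids `a`; the cut-off is supported in its
  -- complement.
  have hK : IsCompact (γ '' Icc ε (T - ε)) := isCompact_Icc.image hγ.continuous
  obtain ⟨χ, hχ, hχO, hχ1⟩ := exists_isBump (isCompact_singleton (x := γ 0))
    (hΩ.sdiff hK.isClosed) (by
      rintro _ rfl
      refine ⟨ha, ?_⟩
      rintro ⟨t, ht, h⟩
      have := hγ.inj ⟨by linarith [ht.1], by linarith [ht.2]⟩ ⟨le_rfl, hγ.pos⟩ h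
      linarith [ht.1])
  refine ⟨χ, ⟨hχ.isTestSymbol fun z hz => (hχO hz).1, hχ1 _ rfl⟩, ?_⟩
  rintro _ ⟨hz, x, rfl⟩
  obtain ⟨t, ht, hxt⟩ := hγ.periodic.exists_mem_Ico hγ.pos x (-ε)
  have h1 : ∀ t' ∈ Icc ε (T - ε), γ t' ≠ γ x := fun t' ht' h => (hχO hz).2 ⟨t', ht', h⟩
  have h2 : t < ε := by
    by_contra h
    exact h1 t ⟨not_lt.1 h, by linarith [ht.2]⟩ hxt.symm
  refine ⟨t, ⟨lt_of_le_of_ne ht.1 fun h => ?_, h2⟩, hxt.symm⟩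
  refine h1 (T - ε) ⟨by linarith, le_rfl⟩ ?_
  rw [hxt, ← h, ← hγ.periodic (-ε)]; congr 1; ring

end

/-! ### Independence of the cut-off -/

section
variable {p₀ : ℝ × ℝ → ℝ} {E T s ε : ℝ} {γ : ℝ → ℝ × ℝ} {Ω : Set (ℝ × ℝ)} {χ χ₀ ψ : ℝ × ℝ → ℝ} {ρ : ℤˣ}
  {h₀ C : ℝ} {q : ℝ → ℝ × ℝ → ℝ} {N : ℕ} {m : ℝ × ℝ → ℝ} {B : ℕ → ℝ} {a b : ℝ → ℝ → ℂ}

theorem SymbolFamily.negligible_sub_left (hq : SymbolFamily h₀ q C N m B) {φ φ' : ℝ × ℝ → ℝ}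
    (hφ : IsBump φ) (hφ' : IsBump φ') (ha : Tempered a) (hb : Tempered b)
    (h : Negligible (dform q (fun z => φ z - φ' z) a b)) :
    Negligible (fun h => dform q φ a b h - dform q φ' a b h) := by
  refine h.congr' ?_
  filter_upwards [hq.dform_lincomb hφ hφ' 1 ha hb] with h hh
  simpa using hh

theorem SymbolFamily.negligible_sub_right (hq : SymbolFamily h₀ q C N m B) {φ φ' : ℝ × ℝ → ℝ}
    (hφ : IsBump φ) (hφ' : IsBump φ') (hχ : IsBump χ) (ha : Tempered a) (hb : Tempered b)
    (h : Negligible (dform q (fun z => φ z - φ' z) b (dop χ a))) :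
    Negligible (fun h => dform q χ a (dop φ b) h - dform q χ a (dop φ' b) h) := by
  refine (hq.negligible_sub_left hφ hφ' hb (ha.dop hχ) h).conj.congr' ?_
  filter_upwards [hq.dform_dop hχ hφ ha hb, hq.dform_dop hχ hφ' ha hb] with h h1 h2
  rw [h1, h2, map_sub]

/-- Change of cut-off in two moves: `ψ` to `ψ₀` with `χ` fixed, then `χ` to `χ₀` with `ψ₀` fixed.
The role of `ψ₀` is to serve both cut-offs at once. Near the relevant points of the short arc its
values depend only on the sign of `t` and on `ρ`, no longer on the cut. -/
theorem SymbolFamily.exists_localizer (hq : SymbolFamily h₀ q C N m B) (hΩ : IsOpen Ω)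
    (hγ : IsPeriodicOrbit p₀ E T γ) (ha : MicroSol q (range γ) Ω a) (hb : MicroSol q (range γ) Ω b)
    (hχ : IsCutoffAt Ω (γ 0) χ) (hψ : IsSegmentLocalizer γ T s χ ρ ψ) (hε : 0 < ε) (hεs : ε ≤ s)
    (hεT : ε ≤ T - s) (hχ₀ : IsCutoffAt Ω (γ 0) χ₀)
    (hχ₀γ : ∀ z ∈ tsupport χ₀ ∩ range γ, ∃ t ∈ Ioo (-ε) ε, γ t = z) :
    ∃ ψ₀, IsBump ψ₀ ∧ (∀ t ∈ Ioo (-ε) ε, γ t ∈ tsupport (fderiv ℝ χ₀) →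
      ∀ᶠ w in 𝓝 (γ t), ψ₀ w = if 0 < t ↔ ρ = 1 then 1 else 0) ∧
      Negligible (fun h => dform q χ a (dop ψ b) h - dform q χ₀ a (dop ψ₀ b) h) := by
  have hs0 := hψ.cut_mem.1
  have hsT := hψ.cut_mem.2
  have hinj := hγ.injOn_Ico hs0.le hsT.le
  set S := tsupport χ ∪ tsupport χ₀ with hS
  have hγsT : γ (s - T) = γ s := by
    have := hγ.periodic (s - T)
    rw [sub_add_cancel] at this
    exact this.symm
  have hsS : γ s ∉ S := by
    rintro (h | h)
    · exact hψ.cut_notMem h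
    · obtain ⟨t, ht, hts⟩ := hχ₀γ _ ⟨h, mem_range_self s⟩
      rw [← hγsT] at hts
      have := hinj ⟨by linarith [ht.1], by linarith [ht.2]⟩ ⟨le_rfl, by linarith⟩ hts
      linarith [ht.1]
  -- For `|t| < δ` both cut-offs are 1 and nothing has to be separated. Omitting these parameters
  -- leaves two disjoint compact pieces `K 1` and `K (-1)`; the closed end at the cut is harmless
  -- because `γ s ∉ S`.
  obtain ⟨δ, hδ, hδ1⟩ : ∃ δ > 0, ∀ t, |t| < δ → ∀ᶠ w in 𝓝 (γ t), χ w = 1 ∧ χ₀ w = 1 := by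
    have h1 := (hγ.continuous.continuousAt (x := 0)).eventually ((hχ.eq_one.and hχ₀.eq_one).eventually_nhds)
    obtain ⟨δ, hδ, h2⟩ := Metric.eventually_nhds_iff.1 h1
    exact ⟨δ, hδ, fun t ht => h2 (by simpa using ht)⟩
  set K : ℤˣ → Set (ℝ × ℝ) := fun ρ => S ∩ γ '' (if ρ = 1 then Icc δ s else Icc (s - T) (-δ)) with hK
  have hSc : IsCompact S := hχ.compact.union hχ₀.compact
  have hKc : ∀ ρ, IsCompact (K ρ) := by
    intro ρ
    refine hSc.inter_right (IsCompact.isClosed ?_)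
    split_ifs <;> exact isCompact_Icc.image hγ.continuous
  have hK1 : ∀ z ∈ K 1, ∃ t ∈ Ioo 0 s, γ t = z := by
    rintro _ ⟨hz, t, ht, rfl⟩
    rw [if_pos rfl] at ht
    exact ⟨t, ⟨by linarith [ht.1], lt_of_le_of_ne ht.2 (by rintro rfl; exact hsS hz)⟩, rfl⟩
  have hK2 : ∀ z ∈ K (-1), ∃ t ∈ Ioo (s - T) 0, γ t = z := by
    rintro _ ⟨hz, t, ht, rfl⟩
    rw [if_neg (by decide)] at ht
    exact ⟨t, ⟨lt_of_le_of_ne ht.1 (by rintro rfl; exact hsS (hγsT ▸ hz)), by linarith [ht.2]⟩, rfl⟩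
  have hKd : Disjoint (K 1) (K (-1)) := by
    refine Set.disjoint_left.2 fun z h1 h2 => ?_
    obtain ⟨t, ht, rfl⟩ := hK1 z h1
    obtain ⟨t', ht', h⟩ := hK2 _ h2
    have := hinj ⟨ht'.1.le, by linarith [ht'.2]⟩ ⟨by linarith [ht.1], ht.2⟩ h
    linarith [ht'.2, ht.1]
  have hKdρ : Disjoint (K ρ) (K (-ρ)) := by
    rcases Int.units_eq_one_or ρ with rfl | rfl
    · exact hKd
    · rw [neg_neg]; exact hKd.symm
  have hKseg : ∀ ρ, K ρ ⊆ orbitSegment γ T s ρ := by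
    intro ρ z hz
    rcases Int.units_eq_one_or ρ with rfl | rfl
    · rw [orbitSegment, if_pos rfl]; exact hK1 z hz
    · rw [orbitSegment, if_neg (by decide)]; exact hK2 z hz
  have hcases : ∀ z ∈ S, z ∈ range γ → z ∈ K ρ ∨ z ∈ K (-ρ) ∨ ∀ᶠ w in 𝓝 z, χ w = 1 ∧ χ₀ w = 1 := by
    intro z hz hzγ
    have h1 : z ∈ K 1 ∨ z ∈ K (-1) ∨ ∀ᶠ w in 𝓝 z, χ w = 1 ∧ χ₀ w = 1 := by
      obtain ⟨t, ht, rfl⟩ := hγ.exists_param S hsS hz hzγ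
      rcases lt_or_ge |t| δ with h | h
      · exact Or.inr (Or.inr (hδ1 t h))
      · rcases le_abs.1 h with h | h
        · exact Or.inl ⟨hz, t, by rw [if_pos rfl]; exact ⟨h, ht.2.le⟩, rfl⟩
        · exact Or.inr (Or.inl ⟨hz, t, by rw [if_neg (by decide)]; exact ⟨ht.1.le, by linarith⟩, rfl⟩)
    rcases Int.units_eq_one_or ρ with rfl | rfl
    · exact h1
    · rw [neg_neg]; tauto
  obtain ⟨ψ₀, hψ₀, hψ₀O, hψ₀1⟩ := exists_isBump (hKc ρ) (hKc (-ρ)).isClosed.isOpen_compl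
    (subset_compl_iff_disjoint_right.2 hKdρ)
  have hψ₀0 : ∀ z ∈ K (-ρ), ∀ᶠ w in 𝓝 z, ψ₀ w = 0 := fun z hz =>
    notMem_tsupport_iff_eventuallyEq.1 fun h => hψ₀O h hz
  have hψb : IsBump ψ := ⟨hψ.smooth, hψ.compact⟩
  refine ⟨ψ₀, hψ₀, fun t ht htd => ?_, ?_⟩
  · have htS : γ t ∈ S := Or.inr (tsupport_fderiv_subset ℝ htd)
    have htI : t ∈ Ico (s - T) s := ⟨by linarith [ht.1], by linarith [ht.2]⟩
    have e1 : γ t ∈ K 1 → 0 < t := fun h => by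
      obtain ⟨t', ht', h'⟩ := hK1 _ h
      have := hinj ⟨by linarith [ht'.1], ht'.2⟩ htI h'
      linarith [ht'.1]
    have e2 : γ t ∈ K (-1) → ¬ 0 < t := fun h => by
      obtain ⟨t', ht', h'⟩ := hK2 _ h
      have := hinj ⟨ht'.1.le, by linarith [ht'.2]⟩ htI h'
      linarith [ht'.2]
    rcases hcases _ htS (mem_range_self t) with h | h | h
    · rw [if_pos]
      · exact hψ₀1 _ h
      · rcases Int.units_eq_one_or ρ with rfl | rfl
        · exact iff_of_true (e1 h) rfl
        · exact iff_of_false (e2 h) (by decide)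
    · rw [if_neg]
      · exact hψ₀0 _ h
      · rcases Int.units_eq_one_or ρ with rfl | rfl
        · exact fun h' => e2 h (h'.2 rfl)
        · rw [neg_neg] at h
          exact fun h' => absurd (h'.1 (e1 h)) (by decide)
    · exact absurd htd (notMem_tsupport_fderiv_of_eventually_eq (h.mono fun w hw => hw.2))
  · have hta := ha.tempered
    have htb := hb.tempered
    have hχb := hχ.isBump
    have hχ₀b := hχ₀.isBump
    have hΛ := hγ.isCompact_range.isClosed
    -- On the orbit, `ψ` and `ψ₀` coincide near supp `dχ`.
    have s1 : Negligible (fun h => dform q χ a (dop ψ b) h - dform q χ a (dop ψ₀ b) h) := by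
      refine hq.negligible_sub_right hψb hψ₀ hχb hta htb ?_
      refine hq.negligible_of_localized hΩ hΛ hb ha (hψb.sub hψ₀) hχb (fun z hz => hχ.support hz.2) ?_
      rintro z ⟨hzd, hzγ⟩
      refine notMem_tsupport_iff_eventuallyEq.2 ?_
      rcases hcases z (Or.inl (tsupport_fderiv_subset ℝ hzd)) hzγ with h | h | h
      · filter_upwards [hψ.eq_one z ⟨hzd, hKseg ρ h⟩, hψ₀1 z h] with w h1 h2
        simp [h1, h2]
      · filter_upwards [hψ.eq_zero z ⟨hzd, hKseg (-ρ) h⟩, hψ₀0 z h] with w h1 h2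
        simp [h1, h2]
      · exact absurd hzd (notMem_tsupport_fderiv_of_eventually_eq (h.mono fun w hw => hw.1))
    -- Here `ψ₀` plays the part of the cut-off: at each point of the orbit in `S`, either `ψ₀` is
    -- locally constant or `χ - χ₀` vanishes nearby.
    have s2 : Negligible (fun h => dform q χ a (dop ψ₀ b) h - dform q χ₀ a (dop ψ₀ b) h) := by
      refine hq.negligible_sub_left hχb hχ₀b hta (htb.dop hψ₀) ?_
      have hSs : tsupport (fun z => χ z - χ₀ z) ⊆ S := tsupport_sub χ χ₀
      refine hq.negligible_of_localized hΩ hΛ ha hb (hχb.sub hχ₀b) hψ₀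
        (fun z hz => (hSs hz.1).elim (fun h => hχ.support h) fun h => hχ₀.support h) ?_
      rintro z ⟨hzd, hzγ⟩ hz
      rcases hcases z (hSs hz) hzγ with h | h | h
      · exact notMem_tsupport_fderiv_of_eventually_eq (hψ₀1 z h) hzd
      · exact notMem_tsupport_fderiv_of_eventually_eq (hψ₀0 z h) hzd
      · exact notMem_tsupport_iff_eventuallyEq.2 (h.mono fun w hw => by simp [hw.1, hw.2]) hz
    simpa only [sub_add_sub_cancel] using s1.add s2

/-- A direct comparison fails when the cuts differ, as points between them belong to different
segments. A common cut-off `χ₀`, whose arc about `a` contains neither cut, serves as intermediary.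
-/
theorem SymbolFamily.negligible_independent (hq : SymbolFamily h₀ q C N m B) (hΩ : IsOpen Ω)
    (h0Ω : γ 0 ∈ Ω) (hγ : IsPeriodicOrbit p₀ E T γ) (ha : MicroSol q (range γ) Ω a)
    (hb : MicroSol q (range γ) Ω b) {χ' ψ' : ℝ × ℝ → ℝ} {s' : ℝ} (hχ : IsCutoffAt Ω (γ 0) χ)
    (hψ : IsSegmentLocalizer γ T s χ ρ ψ) (hχ' : IsCutoffAt Ω (γ 0) χ')
    (hψ' : IsSegmentLocalizer γ T s' χ' ρ ψ') :
    Negligible (fun h => dform q χ a (dop ψ b) h - dform q χ' a (dop ψ' b) h) := by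
  obtain ⟨s0, sT⟩ := hψ.cut_mem
  obtain ⟨s0', sT'⟩ := hψ'.cut_mem
  -- With this `ε`, the parameters in `(-ε, ε)` lie in the period windows `(s - T, s)` and `(s' - T,
  -- s')` of both cuts.
  set ε := min (min s (T - s)) (min s' (T - s')) with hε
  have hε0 : 0 < ε := by simp only [hε, lt_min_iff, sub_pos]; exact ⟨⟨s0, sT⟩, s0', sT'⟩
  have e1 : ε ≤ s := (min_le_left _ _).trans (min_le_left _ _)
  have e2 : ε ≤ T - s := (min_le_left _ _).trans (min_le_right _ _)
  have e3 : ε ≤ s' := (min_le_right _ _).trans (min_le_left _ _)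
  have e4 : ε ≤ T - s' := (min_le_right _ _).trans (min_le_right _ _)
  obtain ⟨χ₀, hχ₀, hχ₀γ⟩ := hγ.exists_cutoff hΩ h0Ω hε0 (by linarith)
  obtain ⟨ψ₁, hψ₁, hψ₁1, h1⟩ := hq.exists_localizer hΩ hγ ha hb hχ hψ hε0 e1 e2 hχ₀ hχ₀γ
  obtain ⟨ψ₂, hψ₂, hψ₂1, h2⟩ := hq.exists_localizer hΩ hγ ha hb hχ' hψ' hε0 e3 e4 hχ₀ hχ₀γ
  have h3 : Negligible (fun h => dform q χ₀ a (dop ψ₁ b) h - dform q χ₀ a (dop ψ₂ b) h) := by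
    refine hq.negligible_sub_right hψ₁ hψ₂ hχ₀.isBump ha.tempered hb.tempered ?_
    refine hq.negligible_of_localized hΩ hγ.isCompact_range.isClosed hb ha (hψ₁.sub hψ₂) hχ₀.isBump
      (fun z hz => hχ₀.support hz.2) ?_
    rintro z ⟨hzd, hzγ⟩
    obtain ⟨t, ht, rfl⟩ := hχ₀γ z ⟨tsupport_fderiv_subset ℝ hzd, hzγ⟩
    refine notMem_tsupport_iff_eventuallyEq.2 ?_
    filter_upwards [hψ₁1 t ht hzd, hψ₂1 t ht hzd] with w h1 h2
    rw [h1, h2, sub_self, Pi.zero_apply]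
  have h4 := (h1.add h3).sub h2
  refine h4.congr' (Eventually.of_forall fun h => ?_)
  ring

/-- The contributions of the two segments cancel. -/
theorem SymbolFamily.negligible_add (hq : SymbolFamily h₀ q C N m B) (hΩ : IsOpen Ω)
    (hγ : IsPeriodicOrbit p₀ E T γ) (ha : MicroSol q (range γ) Ω a)
    (hb : MicroSol q (range γ) Ω b) {ψ₁ ψ₂ : ℝ × ℝ → ℝ} (hχ : IsCutoffAt Ω (γ 0) χ)
    (hψ₁ : IsSegmentLocalizer γ T s χ 1 ψ₁) (hψ₂ : IsSegmentLocalizer γ T s χ (-1) ψ₂) :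
    Negligible (fun h => dform q χ a (dop ψ₁ b) h + dform q χ a (dop ψ₂ b) h) := by
  have hta := ha.tempered
  have htb := hb.tempered
  have hχb := hχ.isBump
  have hψ₁b : IsBump ψ₁ := ⟨hψ₁.smooth, hψ₁.compact⟩
  have hψ₂b : IsBump ψ₂ := ⟨hψ₂.smooth, hψ₂.compact⟩
  -- Near supp `dχ` on the orbit, `ψ₁ + ψ₂ = 1 = g`, so `ψ₁` may be exchanged for `g - ψ₂`.
  obtain ⟨g, hg, -, hg1⟩ := exists_isBump hχ.compact isOpen_univ (subset_univ _)
  have h1 : Negligible (fun h => dform q χ a (dop ψ₁ b) h -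
      dform q χ a (dop (fun z => g z - ψ₂ z) b) h) := by
    refine hq.negligible_sub_right hψ₁b (hg.sub hψ₂b) hχb hta htb ?_
    refine hq.negligible_of_localized hΩ hγ.isCompact_range.isClosed hb ha
      (hψ₁b.sub (hg.sub hψ₂b)) hχb (fun z hz => hχ.support hz.2) ?_
    rintro z ⟨hzd, hzγ⟩
    refine notMem_tsupport_iff_eventuallyEq.2 ?_
    have hgz := hg1 z (tsupport_fderiv_subset ℝ hzd)
    rcases hγ.mem_orbitSegment hχ hψ₁.cut_notMem hzd hzγ with h | h
    · filter_upwards [hψ₁.eq_one z ⟨hzd, h⟩, hψ₂.eq_zero z ⟨hzd, by rwa [neg_neg]⟩, hgz] with w h1 h2 h3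
      simp [h1, h2, h3]
    · filter_upwards [hψ₁.eq_zero z ⟨hzd, h⟩, hψ₂.eq_one z ⟨hzd, h⟩, hgz] with w h1 h2 h3
      simp [h1, h2, h3]
  -- The contribution of `g` vanishes by the equation for `b`, exactly as for the full Wronskian.
  have h2 := hq.negligible_of_one_near hχ.toIsTestSymbol hg hg1 hta hb
  refine (h1.add h2).congr' ?_
  have h4 := hq.dform_lincomb hg hψ₂b 1 htb (hta.dop hχb)
  filter_upwards [hq.dform_dop hχb (hg.sub hψ₂b) hta htb, hq.dform_dop hχb hg hta htb,
    hq.dform_dop hχb hψ₂b hta htb, h4] with h e1 e2 e3 e4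
  simp only [one_mul, Complex.ofReal_one] at e4
  rw [e1, e2, e3, e4, map_sub]
  ring

end

/-! ### Wronskians in terms of the sesquilinear form -/

section
variable {N : ℕ} {p χ ψ : ℝ × ℝ → ℝ} {u v w : ℝ → ℂ}

theorem isTemperate_const (c : ℝ) : IsTemperate 0 (fun _ : ℝ × ℝ => c) :=
  ⟨_, by simpa using hasSymbolBounds_const c⟩

theorem bform_sub_const (hp : IsTemperate N p) (hχ : IsBump χ) (hu : MemLp u 2 volume)
    (hv : MemLp v 2 volume) (E : ℝ) :
    bform (fun z => p z - E) χ u v = bform p χ u v - E * bform (fun _ => 1) χ u v := by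
  have hRD := hχ.rapidDecay_wact_bt hu
  obtain ⟨K, _, hK⟩ := hp.exists_norm_wact_le (norm_bt_le hv)
  have hvm := aestronglyMeasurable_bt hv.1
  have e : ∀ z, wact (fun z => p z - E) (bt v) z = wact p (bt v) z - E * bt v z := by
    intro z
    rw [hp.wact_sub (isTemperate_const E) hvm (norm_bt_le hv)]
    have := wact_const_mul E (fun _ => 1) (bt v) z
    rw [wact_one_bt hv] at this
    simpa using this
  simp only [bform, wact_one_bt hv, e, ← integral_const_mul]
  rw [← integral_sub]
  · congr 1; ext z; simp only [map_sub, map_mul, Complex.conj_ofReal]; ring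
  · refine hRD.integrable_mul (C := K) (N := N) ?_ fun w => ?_
    · exact Complex.continuous_conj.comp_aestronglyMeasurable (aestronglyMeasurable_wact hp.continuous hvm)
    · rw [RCLike.norm_conj]; exact hK w
  · refine (hRD.integrable_mul (C := lpNorm v 2 volume) (N := 0) ?_ fun w => ?_).const_mul _
    · exact Complex.continuous_conj.comp_aestronglyMeasurable hvm
    · rw [RCLike.norm_conj, pow_zero, mul_one]; exact norm_bt_le hv w

theorem conj_bform_one (hχ : IsBump χ) (hu : MemLp u 2 volume) (hv : MemLp v 2 volume) :
    conj (bform (fun _ => 1) χ v u) = bform (fun _ => 1) χ u v := by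
  rw [← integral_mul_conj_nW hχ hv hu, ← integral_conj_comm, integral_nW_mul_conj hχ hu hv]

theorem integral_nS_sub_mul_conj (hp : IsTemperate N p) (hχ : IsBump χ) (hu : MemLp u 2 volume)
    (hw : MemLp w 2 volume) (E : ℝ) : ∫ x, (nS χ p u x - E * nW χ u x) * conj (w x) =
      conj (bform (fun z => p z - E) χ w u) := by
  have h1 := integrable_mul_conj (memLp_nS hp hχ hu) hw
  have h2 := (integrable_mul_conj (hχ.memLp_nW hu) hw).const_mul (E : ℂ)
  simp only [sub_mul, mul_assoc]
  rw [integral_sub h1 h2, integral_const_mul, integral_nS_mul_conj hp hχ hu hw,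
    integral_nW_mul_conj hχ hu hw, bform_sub_const hp hχ hw hu, map_sub, map_mul,
    conj_bform_one hχ hu hw, Complex.conj_ofReal]

theorem memLp_commutator (hp : IsTemperate N p) (hχ : IsBump χ) (hu : MemLp u 2 volume) :
    MemLp (fun x => nW p (nW χ u) x - nS χ p u x) 2 volume :=
  (hp.memLp_nW_nW hχ hu).sub (memLp_nS hp hχ hu)

/-- The commutator is unchanged by subtracting the constant `E`. It is inserted so that `P - E`
appears in each term separately, where the equations for `u` and `w` can be used. -/
theorem integral_commutator_mul_conj (hp : IsTemperate N p) (hχ : IsBump χ) (hu : MemLp u 2 volume)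
    (hw : MemLp w 2 volume) (E : ℝ) : ∫ x, (nW p (nW χ u) x - nS χ p u x) * conj (w x) =
      bform (fun z => p z - E) χ u w - conj (bform (fun z => p z - E) χ w u) := by
  simp only [sub_mul]
  rw [integral_sub (integrable_mul_conj (hp.memLp_nW_nW hχ hu) hw)
    (integrable_mul_conj (memLp_nS hp hχ hu) hw), integral_nW_nW_mul_conj hp hχ hu hw,
    integral_nS_mul_conj hp hχ hu hw, bform_sub_const hp hχ hw hu, bform_sub_const hp hχ hu hw, map_sub,
    map_mul, conj_bform_one hχ hu hw, Complex.conj_ofReal]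
  ring

theorem memLp_of_dil {l : ℝ} (hl : 0 < l) {f : ℝ → ℂ} (hf : MemLp (dil l f) 2 volume) :
    MemLp f 2 volume := by
  have h := memLp_dil (inv_pos.2 hl) hf
  have e : dil l⁻¹ (dil l f) = f := by
    have := dil_dil_inv (inv_pos.2 hl) f
    rwa [inv_inv] at this
  rwa [e] at h

theorem dil_weylCommutator {h : ℝ} (hh : 0 < h) (p χ : ℝ × ℝ → ℝ) (u : ℝ → ℂ) :
    dil (scale h) (weylCommutator h p χ u) = fun x =>
      nW (fun z => p (scale h • z)) (nW (fun z => χ (scale h • z)) (dil (scale h) u)) x -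
        nS (fun z => χ (scale h • z)) (fun z => p (scale h • z)) (dil (scale h) u) x := by
  rw [← dil_weyl hh, ← dil_weyl hh, ← dil_weylSmooth hh]
  ext x
  simp only [dil, weylCommutator, mul_sub]

theorem dil_const_mul (l : ℝ) (c : ℂ) (f : ℝ → ℂ) : dil l (fun x => c * f x) = fun x => c * dil l f x := by
  ext x; simp only [dil]; ring

theorem fullWronskian_eq {h : ℝ} (hh : 0 < h) (hp : IsTemperate N fun z => p (scale h • z))
    (hχ : IsBump χ) (hu : MemLp (dil (scale h) u) 2 volume) (hv : MemLp (dil (scale h) v) 2 volume)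
    (E : ℝ) : fullWronskian h p χ u v = Complex.I / h *
      (bform (fun z => p (scale h • z) - E) (fun z => χ (scale h • z)) (dil (scale h) u) (dil (scale h) v) -
        conj (bform (fun z => p (scale h • z) - E) (fun z => χ (scale h • z)) (dil (scale h) v)
          (dil (scale h) u))) := by
  have hs := scale_pos hh
  rw [fullWronskian, scalarProd, ← integral_dil_mul_conj hs, dil_const_mul, dil_weylCommutator hh]
  simp only [mul_assoc]
  rw [integral_const_mul, integral_commutator_mul_conj hp (hχ.dilate hs) hu hv E]

/-- `Op(ψ)` is self-adjoint and moves to the other side, which makes this the full Wronskian of `u`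
with `Op(ψ) v`. -/
theorem microlocalWronskian_eq {h : ℝ} (hh : 0 < h) (hp : IsTemperate N fun z => p (scale h • z))
    (hχ : IsBump χ) (hψ : IsBump ψ) (hu : MemLp (dil (scale h) u) 2 volume)
    (hv : MemLp (dil (scale h) v) 2 volume) (E : ℝ) :
    microlocalWronskian h p χ ψ u v = Complex.I / h *
      (bform (fun z => p (scale h • z) - E) (fun z => χ (scale h • z)) (dil (scale h) u)
        (nW (fun z => ψ (scale h • z)) (dil (scale h) v)) -
        conj (bform (fun z => p (scale h • z) - E) (fun z => χ (scale h • z))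
          (nW (fun z => ψ (scale h • z)) (dil (scale h) v)) (dil (scale h) u))) := by
  have hs := scale_pos hh
  have hψs := hψ.dilate hs
  rw [microlocalWronskian, scalarProd, ← integral_dil_mul_conj hs, dil_const_mul, dil_weyl hh,
    dil_weylCommutator hh]
  simp only [mul_assoc]
  have hm := memLp_commutator hp (hχ.dilate hs) hu
  rw [integral_const_mul, integral_nW_mul_conj hψs hm hv, ← integral_mul_conj_nW hψs hm hv,
    integral_commutator_mul_conj hp (hχ.dilate hs) hu (hψs.memLp_nW hv) E]

theorem fullWronskian_fourier {h : ℝ} (hh : 0 < h) (hp : IsTemperate N fun z => p (scale h • z))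
    (hχ : IsBump χ) (u v : Lp ℂ 2 (volume : Measure ℝ)) :
    fullWronskian h (fourierSymbol p) (fourierSymbol χ) (hFourier h u) (hFourier h v) =
      fullWronskian h p χ u v := by
  have hs := scale_pos hh
  have e : ∀ c : ℝ × ℝ → ℝ, (fun z => fourierSymbol c (scale h • z)) =
      fourierSymbol fun z => c (scale h • z) := by
    intro c; ext z; simp [fourierSymbol]
  have hp' : IsTemperate N fun z => fourierSymbol p (scale h • z) := by
    rw [e]; exact hp.fourierSymbol
  rw [fullWronskian_eq hh hp' hχ.fourierSymbol (memLp_dil_hFourier hh u) (memLp_dil_hFourier hh v) 0,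
    fullWronskian_eq hh hp hχ (memLp_dil hs (Lp.memLp u)) (memLp_dil hs (Lp.memLp v)) 0]
  have e2 : (fun z => fourierSymbol p (scale h • z) - 0) =
      fourierSymbol fun z => p (scale h • z) - 0 := by
    ext z; simp [fourierSymbol]
  rw [e2, e χ, bform_fourierSymbol (bt_hFourier_rot hh u) (bt_hFourier_rot hh v),
    bform_fourierSymbol (bt_hFourier_rot hh v) (bt_hFourier_rot hh u)]

end

/-! ### Microlocal solutions, rescaled -/

theorem IsHInftyL2.isBigO {f : ℝ → ℝ → ℂ} (hf : IsHInftyL2 f)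
    (hm : ∀ᶠ h in 𝓝[>] (0 : ℝ), AEStronglyMeasurable (f h) volume) (N : ℕ) :
    (fun h => lpNorm (f h) 2 volume) =O[𝓝[>] 0] (fun h : ℝ => h ^ N) := by
  obtain ⟨C, hC⟩ := hf N
  refine IsBigO.of_bound |C| ?_
  filter_upwards [hC, hm, self_mem_nhdsWithin] with h h1 h2 (h3 : 0 < h)
  rw [Real.norm_of_nonneg lpNorm_nonneg, Real.norm_of_nonneg (by positivity), ← toReal_eLpNorm h2]
  refine ENNReal.toReal_le_of_le_ofReal (by positivity) (h1.trans (ENNReal.ofReal_le_ofReal ?_))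
  gcongr
  exact le_abs_self C

section
variable {h₀ : ℝ} {m : ℝ × ℝ → ℝ} {p : ℝ → ℝ × ℝ → ℝ} {pj : ℕ → ℝ × ℝ → ℝ}

/-- The expansion of order 0 states that `p` is bounded in the class of `m`. The weight is enlarged
to `m + 1` to accommodate the constant `E`. -/
theorem IsClassicalSymbol.exists_symbolFamily (hh₀ : 0 < h₀) (hm : IsOrderFunction m)
    (hp : IsClassicalSymbol h₀ m p pj) (E : ℝ) :
    ∃ C N B, SymbolFamily h₀ (fun h z => p h z - E) C N (fun z => m z + 1) B := by
  obtain ⟨C, N, hC, hw⟩ := hm.exists_isWeight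
  obtain ⟨hs, hb⟩ := hp.expansion 0
  simp only [Finset.range_zero, Finset.sum_empty, sub_zero, pow_zero, mul_one] at hs hb
  choose B hB using hb
  refine ⟨C + 1, N, fun k => |B k| + |E|, hh₀, by positivity, ⟨fun z => ?_, fun z w => ?_⟩,
    fun h hh => ⟨?_, fun k z => ?_⟩⟩
  · have := hw.nonneg z; positivity
  · have h1 := hw.le z w
    have h2 : 1 ≤ br (z - w) ^ N := one_le_pow₀ (one_le_br _)
    have h3 := hw.nonneg w
    nlinarith [mul_nonneg (zero_le_one.trans h2) h3, mul_nonneg hC.le (zero_le_one.trans h2)]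
  · exact (hs h hh).sub contDiff_const
  · have h1 := hB k h hh z
    have h2 := (hasSymbolBounds_const E).bound k z
    have h3 : iteratedFDeriv ℝ k (fun z => p h z - E) z =
        iteratedFDeriv ℝ k (p h) z - iteratedFDeriv ℝ k (fun _ => E) z :=
      fun_iteratedFDeriv_sub_apply (((hs h hh).of_le (by exact_mod_cast le_top)).contDiffAt)
        contDiff_const.contDiffAt
    have h4 := hw.nonneg z
    have h5 : (if k = 0 then |E| else 0) ≤ |E| := by split_ifs <;> simp
    have h6 : ‖iteratedFDeriv ℝ k (fun _ : ℝ × ℝ => E) z‖ ≤ |E| := by linarith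
    rw [h3]
    calc _ ≤ B k * m z + |E| := (norm_sub_le _ _).trans (add_le_add h1 h6)
      _ ≤ |B k| * m z + |E| := by gcongr; exact le_abs_self _
      _ ≤ _ := by nlinarith [abs_nonneg (B k), mul_nonneg (abs_nonneg E) h4]

theorem eventually_isTemperate (hh₀ : 0 < h₀) (hm : IsOrderFunction m)
    (hp : IsClassicalSymbol h₀ m p pj) :
    ∃ N, ∀ᶠ h in 𝓝[>] (0 : ℝ), 0 < h ∧ IsTemperate N (fun z => p h (scale h • z)) := by
  obtain ⟨C, N, B, hq⟩ := hp.exists_symbolFamily hh₀ hm 0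
  refine ⟨N, ?_⟩
  filter_upwards [eventually_mem_Ioc hh₀, eventually_scale_le_one] with h hh h1
  exact ⟨hh.1, by simpa using hq.isTemperate hh h1⟩

/-- The dilation is unitary, so the bounds persist. The equation becomes a weak one by
Cauchy–Schwarz: pairing with a tempered `w` loses a fixed power of `h`, which `O(h^∞)` absorbs. -/
theorem IsMicrolocalSolution.microSol (hh₀ : 0 < h₀) (hm : IsOrderFunction m)
    (hp : IsClassicalSymbol h₀ m p pj) {E : ℝ} {Λ Ω : Set (ℝ × ℝ)}
    {u : ℝ → Lp ℂ 2 (volume : Measure ℝ)} (hu : IsMicrolocalSolution p E Λ Ω u) :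
    MicroSol (fun h z => p h z - E) Λ Ω (fun h => dil (scale h) (u h)) := by
  obtain ⟨N, hT⟩ := eventually_isTemperate hh₀ hm hp
  have hmem : ∀ h, 0 < h → MemLp (dil (scale h) (u h)) 2 volume := fun h hh =>
    memLp_dil (scale_pos hh) (Lp.memLp _)
  refine ⟨⟨hmem, ?_⟩, fun θ hθ k => ?_, fun θ hθ w hw k => ?_⟩
  · obtain ⟨M, C, hMC⟩ := hu.tempered
    refine ⟨M, IsBigO.of_bound |C| ?_⟩
    filter_upwards [hMC, self_mem_nhdsWithin] with h h1 (h2 : 0 < h)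
    rw [lpNorm_dil (scale_pos h2) (Lp.memLp _), Real.norm_of_nonneg lpNorm_nonneg,
      Real.norm_of_nonneg (by positivity), ← norm_toLp_eq_lpNorm (Lp.memLp (u h)), Lp.toLp_coeFn]
    refine h1.trans ?_
    gcongr
    exact le_abs_self C
  · have h1 : ∀ h, 0 < h → MemLp (weyl h θ (u h)) 2 volume := fun h hh =>
      memLp_of_dil (scale_pos hh) (by
        rw [dil_weyl hh]; exact (hθ.isBump.dilate (scale_pos hh)).memLp_nW (hmem h hh))
    have h2 := (hu.localized θ hθ).isBigO
      (by filter_upwards [self_mem_nhdsWithin] with h (hh : 0 < h) using (h1 h hh).1) k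
    refine h2.congr' ?_ EventuallyEq.rfl
    filter_upwards [self_mem_nhdsWithin] with h (hh : 0 < h)
    rw [dop, ← dil_weyl hh, lpNorm_dil (scale_pos hh) (h1 h hh)]
  · set f : ℝ → ℝ → ℂ := fun h x => weylSmooth h θ (p h) (u h) x - E * weyl h θ (u h) x with hf
    have hfd : ∀ h, 0 < h → dil (scale h) (f h) = fun x =>
        nS (fun z => θ (scale h • z)) (fun z => p h (scale h • z)) (dil (scale h) (u h)) x -
          E * nW (fun z => θ (scale h • z)) (dil (scale h) (u h)) x := by
      intro h hh
      rw [← dil_weyl hh, ← dil_weylSmooth hh]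
      ext x
      simp only [dil, hf]; ring
    have hfm : ∀ᶠ h in 𝓝[>] (0 : ℝ), MemLp (f h) 2 volume := by
      filter_upwards [hT] with h ⟨hh, hp⟩
      refine memLp_of_dil (scale_pos hh) ?_
      have hb := hθ.isBump.dilate (scale_pos hh)
      rw [hfd h hh]
      exact (memLp_nS hp hb (hmem h hh)).sub ((hb.memLp_nW (hmem h hh)).const_mul _)
    have h1 := (hu.equation θ hθ).isBigO (hfm.mono fun h hh => hh.1)
    obtain ⟨M, hM⟩ := hw.bound
    have h2 : dform (fun h z => p h z - E) θ w (fun h => dil (scale h) (u h)) =O[𝓝[>] 0]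
        fun h => lpNorm (f h) 2 volume * lpNorm (w h) 2 volume := by
      refine IsBigO.of_bound 1 ?_
      filter_upwards [hT, hfm] with h ⟨hh, hp⟩ hfh
      have hs := scale_pos hh
      have e := integral_nS_sub_mul_conj hp (hθ.isBump.dilate hs) (hmem h hh) (hw.memLp h hh) E
      have hd := hfd h hh
      have h3 := norm_integral_mul_conj_le (memLp_dil hs hfh) (hw.memLp h hh)
      rw [hd, e, RCLike.norm_conj, ← hd, lpNorm_dil hs hfh] at h3
      rw [one_mul]
      exact h3.trans (le_abs_self _)
    refine (h2.trans ((h1 (k + M)).mul hM)).congr' EventuallyEq.rfl ?_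
    filter_upwards [self_mem_nhdsWithin] with h (hh : 0 < h)
    rw [pow_add]; field_simp

end
theorem Negligible.eqModHInfty {f g : ℝ → ℂ} (h : Negligible fun h => f h - g h) : EqModHInfty f g := h

end

/-! ### The proposition. -/

theorem mainTheorem2
    (h₀ : ℝ) (hh₀ : 0 < h₀)
    (m : ℝ × ℝ → ℝ) (hm : IsOrderFunction m)
    (p : ℝ → ℝ × ℝ → ℝ) (pj : ℕ → ℝ × ℝ → ℝ) (hp : IsClassicalSymbol h₀ m p pj)
    (E T : ℝ) (γ : ℝ → ℝ × ℝ) (hγ : IsPeriodicOrbit (pj 0) E T γ)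
    (Ω : Set (ℝ × ℝ)) (hΩ : IsOpen Ω) (ha : γ 0 ∈ Ω)
    (u v : ℝ → Lp ℂ 2 (volume : Measure ℝ))
    (hu : IsMicrolocalSolution p E (range γ) Ω u)
    (hv : IsMicrolocalSolution p E (range γ) Ω v) :
    (∀ χ, IsCutoffAt Ω (γ 0) χ →
      EqModHInfty (fun h => fullWronskian h (p h) χ (u h) (v h))
        (fun h => fullWronskian h (fourierSymbol (p h)) (fourierSymbol χ)
          (hFourier h (u h)) (hFourier h (v h))) ∧
      EqModHInfty (fun h => fullWronskian h (fourierSymbol (p h)) (fourierSymbol χ)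
          (hFourier h (u h)) (hFourier h (v h))) 0 ∧
      EqModHInfty (fun h => fullWronskian h (p h) χ (u h) (v h)) 0) ∧
    (∀ χ s ψplus ψminus, IsCutoffAt Ω (γ 0) χ →
      IsSegmentLocalizer γ T s χ 1 ψplus → IsSegmentLocalizer γ T s χ (-1) ψminus →
      EqModHInfty (fun h => microlocalWronskian h (p h) χ ψplus (u h) (v h))
        (fun h => -microlocalWronskian h (p h) χ ψminus (u h) (v h))) ∧
    (∀ (ρ : ℤˣ) χ χ' s s' ψ ψ', IsCutoffAt Ω (γ 0) χ → IsCutoffAt Ω (γ 0) χ' →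
      IsSegmentLocalizer γ T s χ ρ ψ → IsSegmentLocalizer γ T s' χ' ρ ψ' →
      EqModHInfty (fun h => microlocalWronskian h (p h) χ ψ (u h) (v h))
        (fun h => microlocalWronskian h (p h) χ' ψ' (u h) (v h))) := by
  obtain ⟨C, N, B, hq⟩ := hp.exists_symbolFamily hh₀ hm E
  obtain ⟨N', hT⟩ := eventually_isTemperate hh₀ hm hp
  have hU := hu.microSol hh₀ hm hp
  have hV := hv.microSol hh₀ hm hp
  set U : ℝ → ℝ → ℂ := fun h => dil (scale h) (u h) with hUdef
  set V : ℝ → ℝ → ℂ := fun h => dil (scale h) (v h) with hVdef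
  set q : ℝ → ℝ × ℝ → ℝ := fun h z => p h z - E with hqdef
  have full : ∀ χ, IsCutoffAt Ω (γ 0) χ →
      Negligible (fun h => fullWronskian h (p h) χ (u h) (v h)) := by
    intro χ hχ
    -- Each of the two terms of the commutator is negligible separately: one by the equation for
    -- `v`, the other by that for `u`.
    have h1 := ((hV.eqn χ hχ.toIsTestSymbol U hU.tempered).sub
      (hU.eqn χ hχ.toIsTestSymbol V hV.tempered).conj).div_self Complex.I
    refine h1.congr' ?_
    filter_upwards [hT] with h ⟨hh, hp⟩
    rw [fullWronskian_eq hh hp hχ.isBump (hU.tempered.memLp h hh) (hV.tempered.memLp h hh) E]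
    rfl
  have fourier : ∀ χ, IsCutoffAt Ω (γ 0) χ →
      (fun h => fullWronskian h (p h) χ (u h) (v h)) =ᶠ[𝓝[>] 0]
        (fun h => fullWronskian h (fourierSymbol (p h)) (fourierSymbol χ)
          (hFourier h (u h)) (hFourier h (v h))) := by
    intro χ hχ
    filter_upwards [hT] with h ⟨hh, hp⟩
    rw [fullWronskian_fourier hh hp hχ.isBump]
  have micro : ∀ χ ψ, IsCutoffAt Ω (γ 0) χ → IsBump ψ →
      Negligible (fun h => microlocalWronskian h (p h) χ ψ (u h) (v h) -
        Complex.I / h * dform q χ U (dop ψ V) h) := by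
    intro χ ψ hχ hψ
    -- The difference is minus the term in which `P - E` falls on `u` behind `χ`, tested with `Op(ψ)
    -- v`; the equation for `u` removes it.
    have h1 := (((hU.eqn χ hχ.toIsTestSymbol (dop ψ V) (hV.tempered.dop hψ)).conj).div_self
      Complex.I).const_mul (-1)
    refine h1.congr' ?_
    filter_upwards [hT] with h ⟨hh, hp⟩
    rw [microlocalWronskian_eq hh hp hχ.isBump hψ (hU.tempered.memLp h hh) (hV.tempered.memLp h hh) E]
    simp only [dform, dop, hqdef, hUdef, hVdef]
    ring
  refine ⟨fun χ hχ => ⟨?_, ?_, ?_⟩, fun χ s ψ₁ ψ₂ hχ hψ₁ hψ₂ => ?_,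
    fun ρ χ χ' s s' ψ ψ' hχ hχ' hψ hψ' => ?_⟩
  · refine Negligible.eqModHInfty (((full χ hχ).sub (full χ hχ)).congr' ?_)
    filter_upwards [fourier χ hχ] with h hh
    rw [hh]
  · refine Negligible.eqModHInfty ((full χ hχ).congr' ?_)
    filter_upwards [fourier χ hχ] with h hh
    rw [hh, Pi.zero_apply, sub_zero]
  · refine Negligible.eqModHInfty ((full χ hχ).congr' ?_)
    filter_upwards with h
    rw [Pi.zero_apply, sub_zero]
  · have h1 := ((micro χ ψ₁ hχ ⟨hψ₁.smooth, hψ₁.compact⟩).add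
      (micro χ ψ₂ hχ ⟨hψ₂.smooth, hψ₂.compact⟩)).add
      ((hq.negligible_add hΩ hγ hU hV hχ hψ₁ hψ₂).div_self Complex.I)
    refine Negligible.eqModHInfty (h1.congr' (Eventually.of_forall fun h => ?_))
    ring
  · have h1 := ((micro χ ψ hχ ⟨hψ.smooth, hψ.compact⟩).sub
      (micro χ' ψ' hχ' ⟨hψ'.smooth, hψ'.compact⟩)).add
      ((hq.negligible_independent hΩ ha hγ hU hV hχ hψ hχ' hψ').div_self Complex.I)
    refine Negligible.eqModHInfty (h1.congr' (Eventually.of_forall fun h => ?_))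
    ring
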